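/- Let $m>0$. A hyperbolic monopole of mass $m$ is a smooth pair $(A,\Phi)$, where $A$ is an $SU(2)$ connection on the trivial bundle $\mathbb{H}^3\times\mathbb{C}^2$ with $L^2$ curvature $F_A$ and $\Phi:\mathbb{H}^3\to\mathfrak{su}(2)$, satisfying $d_A\Phi=*F_A$ and $\|\Phi\|\to m$ at infinity (with $\|\operatorname{diag}(im,-im)\|=m$). Identify $\mathbb{CP}^1$ with the boundary sphere $S^2_\infty$ of the ball model of $\mathbb{H}^3$ by stereographic projection, and write $\hat w$ for the antipodal point of $w$ on this sphere. For distinct $a,b\in S^2_\infty$, parametrise the geodesic from $a$ to $b$ by arc length $t$. Choose along it a solution $s_+$ of $(\partial_t^A-i\Phi)s=0$ with $\lim_{t\to\infty}e^{mt}\|s_+(t)\|=1$ and a solution $r_+$ of $(\partial_t^A+i\Phi)r=0$ with $\lim_{t\to-\infty}e^{-mt}\|r_+(t)\|=1$. The 2-point function is $\langle P_aP_b\rangle=|(r_+(t),s_+(t))|^2$, and $\langle P_aP_a\rangle=1$. The spectral curve $\Sigma\subset\mathbb{CP}^1\times\mathbb{CP}^1$ is the set of pairs $(w,z)$ with $\hat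 w\ne z$ for which $(\partial_t^A-i\Phi)s=0$ has a nonzero $L^2$ solution along the geodesic from $\hat w$ to $z$. Theorem. Let $(A,\Phi)$ be a hyperbolic monopole of mass $m>0$. (1) The 2-point function is well defined: for $a\neq b$ solutions $r_+,s_+$ as above exist, and $|(r_+(t),s_+(t))|^2$ depends neither on $t$ nor on their choice. (2) $\Sigma=\{(w,z)\in\mathbb{CP}^1\times\mathbb{CP}^1 : \langle P_{\hat w}P_z\rangle=0\}$. (3) The 2-point function uniquely determines the spectral curve: two hyperbolic monopoles (of positive masses) with the same 2-point function have the same spectral curve. -/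

import Mathlib

open Filter Topology MeasureTheory
open scoped ContDiff

noncomputable section

namespace HypMonopole

/-- The space `ℝ³` that contains the Poincaré ball model of hyperbolic space
`ℍ³ = {x ∈ ℝ³ : ‖x‖ < 1}`, with metric `4 |dx|² / (1 - ‖x‖²)²`. -/
abbrev V : Type := EuclideanSpace ℝ (Fin 3)

/-- The open unit ball as a model of `ℍ³`. -/
def H3 : Set V := Metric.ball 0 1

/-- The conformal boundary two-sphere of `ℍ³`, i.e. `ℂℙ¹` by stereographic projection.
The antipodal point of `w` is `-w`. -/
abbrev S2 : Type := Metric.sphere (0 : V) 1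

/-- The fibre `ℂ²` of the trivial bundle, with its Hermitian inner product. -/
abbrev E : Type := EuclideanSpace ℂ (Fin 2)

/-- Endomorphisms of the fibre, with the operator norm. On `su(2)` this norm is `‖X‖ = √(det X)`,
i.e. `‖diag(i m, -i m)‖ = |m|`, and it comes from an invariant inner product. -/
abbrev EndE : Type := E →L[ℂ] E

/-- Skew-Hermitian and trace-free endomorphisms of `ℂ²`. -/
def IsSu2 (X : EndE) : Prop :=
  ContinuousLinearMap.adjoint X = -X ∧ LinearMap.trace ℂ E (X : E →ₗ[ℂ] E) = 0

/-- The `i`-th standard basis vector of `ℝ³`. -/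
def e (i : Fin 3) : V := EuclideanSpace.single i 1

/-- The conformal factor `2 / (1 - ‖x‖²)`: lengths of the hyperbolic metric are Euclidean lengths
multiplied by it. -/
def conf (x : V) : ℝ := 2 / (1 - ‖x‖ ^ 2)

/-- The covariant derivative `d_A Φ = dΦ + [A, Φ]` at `x` in the direction `v`. -/
def covDeriv (A : V → V →L[ℝ] EndE) (Φ : V → EndE) (x v : V) : EndE :=
  fderiv ℝ Φ x v + (A x v * Φ x - Φ x * A x v)

/-- The curvature `F_A = dA + A ∧ A` at `x` on the pair of tangent vectors `u, v`. -/
def curv (A : V → V →L[ℝ] EndE) (x u v : V) : EndE :=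
  fderiv ℝ A x u v - fderiv ℝ A x v u + (A x u * A x v - A x v * A x u)

/-- The component on `e i` of the one-form `* F` at `x`, for the Hodge star of the hyperbolic metric
and the standard orientation. As `θ i = conf x • dx i` is an oriented orthonormal coframe, one has
`* (dx (i+1) ∧ dx (i+2)) = (conf x)⁻¹ • dx i`, with the indices taken modulo 3. -/
def hodge (x : V) (F : V → V → EndE) (i : Fin 3) : EndE :=
  (conf x)⁻¹ • F (e (i + 1)) (e (i + 2))

/-- The energy density of the curvature in Euclidean coordinates, i.e. `|F_A|² dvol` of the
hyperbolic metric divided by Lebesgue measure: `|F|²` scales by `(conf x)⁻⁴` and the volume by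
`(conf x)³`. -/
def curvDensity (A : V → V →L[ℝ] EndE) (x : V) : ℝ :=
  (conf x)⁻¹ * ∑ i : Fin 3, ‖curv A x (e (i + 1)) (e (i + 2))‖ ^ 2

end HypMonopole

open HypMonopole

/-- A hyperbolic `SU(2)` monopole `(A, Φ)` of mass `m` on the trivial bundle `ℍ³ × ℂ²`. Only the
values of `A` and `Φ` on the unit ball matter. -/
structure HyperbolicMonopole (m : ℝ) where
  /-- the connection one-form -/
  A : V → V →L[ℝ] EndE
  /-- the Higgs field -/
  Φ : V → EndE
  smooth_A : ContDiffOn ℝ ∞ A H3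
  smooth_Φ : ContDiffOn ℝ ∞ Φ H3
  su2_A : ∀ x ∈ H3, ∀ v, IsSu2 (A x v)
  su2_Φ : ∀ x ∈ H3, IsSu2 (Φ x)
  /-- the Bogomolny equation `d_A Φ = * F_A` -/
  bogomolny : ∀ x ∈ H3, ∀ i, covDeriv A Φ x (e i) = hodge x (curv A x) i
  /-- the curvature is square integrable on `ℍ³` -/
  curv_L2 : IntegrableOn (curvDensity A) H3
  /-- `‖Φ‖ → m` at infinity in `ℍ³` -/
  mass : Tendsto (fun x => ‖Φ x‖) (comap norm (𝓝[<] (1 : ℝ))) (𝓝 m)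

namespace HypMonopole

/-- The oriented geodesic of `ℍ³` from `a` to `b` (for `a ≠ b` on the boundary sphere),
parametrised by arc length: the projection to the ball of the curve
`(exp (-t) • (1, a) + exp t • (1, b)) / ‖a - b‖` in the hyperboloid. -/
def geodesic (a b : S2) (t : ℝ) : V :=
  (‖(a : V) - b‖ + Real.exp (-t) + Real.exp t)⁻¹ •
    (Real.exp (-t) • (a : V) + Real.exp t • (b : V))

variable {m : ℝ}

/-- `s` solves the scattering equation `(∂_t^A - i Φ) s = 0` along the geodesic from `a` to `b`. -/
def IsScatteringSol (M : HyperbolicMonopole m) (a b : S2) (s : ℝ → E) : Prop :=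
  ∀ t, HasDerivAt s
    (-(M.A (geodesic a b t) (deriv (geodesic a b) t) (s t))
      + Complex.I • M.Φ (geodesic a b t) (s t)) t

/-- `r` solves the equation `(∂_t^A + i Φ) r = 0` along the geodesic from `a` to `b`. -/
def IsOppositeScatteringSol (M : HyperbolicMonopole m) (a b : S2) (r : ℝ → E) : Prop :=
  ∀ t, HasDerivAt r
    (-(M.A (geodesic a b t) (deriv (geodesic a b) t) (r t))
      - Complex.I • M.Φ (geodesic a b t) (r t)) t

/-- `s` is a decaying solution `s₊`, normalised at the end `b` of the geodesic from `a` to `b`. -/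
def IsNormalisedS (M : HyperbolicMonopole m) (a b : S2) (s : ℝ → E) : Prop :=
  IsScatteringSol M a b s ∧ Tendsto (fun t => Real.exp (m * t) * ‖s t‖) atTop (𝓝 1)

/-- `r` is a decaying solution `r₊`, normalised at the end `a` of the geodesic from `a` to `b`. -/
def IsNormalisedR (M : HyperbolicMonopole m) (a b : S2) (r : ℝ → E) : Prop :=
  IsOppositeScatteringSol M a b r ∧ Tendsto (fun t => Real.exp (-(m * t)) * ‖r t‖) atBot (𝓝 1)

/-- `c = |(r₊, s₊)|²` for some normalised solutions along the geodesic from `a` to `b`, where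
`(r₊, s₊)` does not depend on `t`. -/
def IsTwoPointValue (M : HyperbolicMonopole m) (a b : S2) (c : ℝ) : Prop :=
  ∃ r s : ℝ → E, IsNormalisedR M a b r ∧ IsNormalisedS M a b s ∧
    ∀ t, ‖inner ℂ (r t) (s t)‖ ^ 2 = c

open Classical in
/-- The 2-point function `⟨P_a P_b⟩`, equal to `|(r₊, s₊)|²` when `a ≠ b`, and to `1` when
`a = b`. -/
def twoPoint (M : HyperbolicMonopole m) (a b : S2) : ℝ :=
  if a = b then 1 else Classical.epsilon (IsTwoPointValue M a b)

/-- The spectral curve: the pairs `(w, z)` off the anti-diagonal such that the scattering equation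
along the geodesic from the antipodal point of `w` to `z` has a nonzero `L²` solution. -/
def spectralCurve (M : HyperbolicMonopole m) : Set (S2 × S2) :=
  {p | -p.1 ≠ p.2 ∧ ∃ s : ℝ → E, IsScatteringSol M (-p.1) p.2 s ∧ (∃ t, s t ≠ 0) ∧
    Integrable (fun t => ‖s t‖ ^ 2)}

end HypMonopole

end

noncomputable section

namespace HypMonopole

section

/-! ### Algebra of `su(2)` -/

/-! Along a geodesic the two scattering equations are linear systems of rank two, and the algebra is
short. The pairing of a solution of one with a solution of the other is constant, because the
connection is skew and `i Φ` is Hermitian with opposite signs in the two equations. The quaternionic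
structure `J` commutes with `su(2)` and conjugates `i`, so it exchanges the equations. Hence `(J s₁,
s₂)` is a constant Wronskian for two solutions of the same equation. It vanishes when both decay at
the same end, so normalised solutions are unique up to a phase and `|(r₊, s₊)|²` is well defined. It
is zero exactly when `s₊` is proportional to `J r₊`, that is, when one solution decays at both ends.
Conversely, a square integrable solution pairs to a constant with each of the decaying `r₊` and `J
s₊`, and these constants must vanish. So the spectral curve is the zero set of the 2-point function
(`exists_integrable_iff_twoPoint_eq_zero`), and the third claim follows.

The work lies in the existence of a solution with the exact rate `e^{-mt}` (`exists_isNormalisedS`).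
This needs the defect `h = m² - |Φ|²` to be integrable along the geodesic, whereas only `F_A ∈ L²`
and `|Φ| → m` are assumed. The Bogomolny equation and the Bianchi identity give `Δ|Φ|² = 2 |d_A
Φ|²`, so `|Φ| ≤ m` by the maximum principle. A Bochner inequality and a Bernstein type cutoff
argument give the pointwise estimate `|d_A Φ|² ≤ K h` in the hyperbolic metric
(`exists_gradient_bound`). The function `W = 1 / cosh²(distance to the geodesic)` satisfies `Δ W =
-4 W²`, and Green's formula against `h` bounds `∫ W² h` by the energy
(`setIntegral_weighted_defect_le`). Since `-Δ h ≤ 2 K h`, a mean value inequality bounds `h` at a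
point by its integral over a small ball (`exists_defect_le_setIntegral`). Slicing space along the
geodesic then bounds the line integral of `h` (`exists_line_bound`).

Given this, a solution `σ` that starts in the growing eigenspace of `i Φ` far out keeps growing. Its
component off that direction is damped, and integrability of `h` gives `|σ|² ~ ν e^{2mt}` with `ν >
0`. Reduction of order from `σ` produces the decaying solution (`LineData.exists_decaying`). -/

theorem IsSu2.inner_apply_left {X : EndE} (hX : IsSu2 X) (v w : E) :
    inner ℂ (X v) w = -inner ℂ v (X w) := by
  have h := ContinuousLinearMap.adjoint_inner_left X w v
  rw [hX.1] at h
  simp only [_root_.neg_apply, inner_neg_left] at h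
  rw [← h, neg_neg]

theorem IsSu2.coords {X : EndE} (hX : IsSu2 X) : ∃ (α : ℝ) (β : ℂ), ∀ v : E,
    X v 0 = Complex.I * α * v 0 + β * v 1 ∧
    X v 1 = -(starRingEnd ℂ β) * v 0 - Complex.I * α * v 1 := by
  set f : Fin 2 → E := fun j => EuclideanSpace.single j (1 : ℂ) with hf
  have hv : ∀ v : E, v = v 0 • f 0 + v 1 • f 1 := by
    intro v; ext i; fin_cases i <;> simp [hf]
  have hsk : ∀ i j, starRingEnd ℂ (X (f i) j) = -(X (f j) i) := by
    intro i j
    have := hX.inner_apply_left (f i) (f j)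
    simpa [hf, EuclideanSpace.inner_single_left, EuclideanSpace.inner_single_right] using this
  have htr : X (f 0) 0 + X (f 1) 1 = 0 := by
    have h := hX.2
    rw [LinearMap.trace_eq_matrix_trace ℂ (EuclideanSpace.basisFun (Fin 2) ℂ).toBasis] at h
    simpa [Matrix.trace, LinearMap.toMatrix_apply, hf, Fin.sum_univ_two] using h
  have h00 := hsk 0 0
  have hre : (X (f 0) 0).re = 0 := by
    have := congrArg Complex.re h00
    simp at this; linarith
  refine ⟨(X (f 0) 0).im, X (f 1) 0, fun v => ?_⟩
  have e00 : X (f 0) 0 = Complex.I * ((X (f 0) 0).im : ℝ) := by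
    apply Complex.ext <;> simp [hre]
  have e11 : X (f 1) 1 = -(Complex.I * ((X (f 0) 0).im : ℝ)) := by
    rw [← e00]; linear_combination htr
  have e10 : X (f 0) 1 = -(starRingEnd ℂ (X (f 1) 0)) := by
    rw [hsk 1 0, neg_neg]
  have hXv : ∀ i, X v i = v 0 * X (f 0) i + v 1 * X (f 1) i := by
    intro i
    conv_lhs => rw [hv v]
    simp
  constructor
  · rw [hXv, ← e00]; ring
  · rw [hXv, e10, e11]; ring

theorem norm_sq_coords (v : E) : ‖v‖ ^ 2 = Complex.normSq (v 0) + Complex.normSq (v 1) := by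
  rw [EuclideanSpace.norm_sq_eq, Fin.sum_univ_two, Complex.normSq_eq_norm_sq,
    Complex.normSq_eq_norm_sq]

theorem inner_coords (v w : E) :
    inner ℂ v w = starRingEnd ℂ (v 0) * w 0 + starRingEnd ℂ (v 1) * w 1 := by
  simp [PiLp.inner_apply, Fin.sum_univ_two, mul_comm]

/-- A trace-free skew-Hermitian `2 × 2` matrix is a real multiple of a unitary one. All vectors are
stretched by the same factor, the square root of the determinant. -/
theorem IsSu2.coords_norm {X : EndE} (hX : IsSu2 X) : ∃ (α : ℝ) (β : ℂ), (∀ v : E,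
    X v 0 = Complex.I * α * v 0 + β * v 1 ∧
    X v 1 = -(starRingEnd ℂ β) * v 0 - Complex.I * α * v 1) ∧
    ‖X‖ ^ 2 = α ^ 2 + Complex.normSq β := by
  obtain ⟨α, β, h⟩ := hX.coords
  refine ⟨α, β, h, ?_⟩
  have hn : ∀ v : E, ‖X v‖ ^ 2 = (α ^ 2 + Complex.normSq β) * ‖v‖ ^ 2 := by
    intro v
    rw [norm_sq_coords, norm_sq_coords, (h v).1, (h v).2]
    simp only [Complex.normSq_apply, Complex.add_re, Complex.mul_re, Complex.I_re,
      Complex.ofReal_re, Complex.I_im, Complex.ofReal_im, Complex.mul_im, Complex.add_im,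
      Complex.sub_re, Complex.sub_im, Complex.neg_re, Complex.neg_im, Complex.conj_re,
      Complex.conj_im]
    ring
  have hp : 0 ≤ α ^ 2 + Complex.normSq β := add_nonneg (sq_nonneg _) (Complex.normSq_nonneg _)
  have hn' : ∀ v : E, ‖X v‖ = Real.sqrt (α ^ 2 + Complex.normSq β) * ‖v‖ := by
    intro v
    rw [← Real.sqrt_sq (norm_nonneg (X v)), hn, Real.sqrt_mul hp, Real.sqrt_sq (norm_nonneg v)]
  have : ‖X‖ = Real.sqrt (α ^ 2 + Complex.normSq β) := by
    apply le_antisymm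
    · exact ContinuousLinearMap.opNorm_le_bound _ (Real.sqrt_nonneg _) fun v => (hn' v).le
    · have h1 := X.le_opNorm (EuclideanSpace.single 0 1)
      rw [hn'] at h1
      simpa using h1
  rw [this, Real.sq_sqrt hp]

/-- Cayley–Hamilton with trace zero and determinant `‖X‖²`. Consequently `i X` is Hermitian with
eigenvalues `±‖X‖`. -/
theorem IsSu2.apply_apply {X : EndE} (hX : IsSu2 X) (v : E) : X (X v) = -((‖X‖ ^ 2 : ℝ) : ℂ) • v := by
  obtain ⟨α, β, h, hn⟩ := hX.coords_norm
  rw [hn]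
  ext i
  fin_cases i
  · simp only [Fin.zero_eta, (h _).1, (h _).2, PiLp.smul_apply, smul_eq_mul]
    rw [Complex.ofReal_add, Complex.normSq_eq_conj_mul_self]
    push_cast
    linear_combination (α : ℂ) ^ 2 * v 0 * Complex.I_sq
  · simp only [Fin.mk_one, (h _).1, (h _).2, PiLp.smul_apply, smul_eq_mul]
    rw [Complex.ofReal_add, Complex.normSq_eq_conj_mul_self]
    push_cast
    linear_combination (α : ℂ) ^ 2 * v 1 * Complex.I_sq

/-- The quaternionic structure of `ℂ²`. -/
def J (v : E) : E := !₂[-(starRingEnd ℂ (v 1)), starRingEnd ℂ (v 0)]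

@[simp] theorem J_zero_coord (v : E) : J v 0 = -(starRingEnd ℂ (v 1)) := by simp [J]
@[simp] theorem J_one_coord (v : E) : J v 1 = starRingEnd ℂ (v 0) := by simp [J]

theorem J_add (v w : E) : J (v + w) = J v + J w := by
  ext i; fin_cases i <;> simp; ring

theorem J_smul (z : ℂ) (v : E) : J (z • v) = starRingEnd ℂ z • J v := by
  ext i; fin_cases i <;> simp

theorem J_J (v : E) : J (J v) = -v := by
  ext i; fin_cases i <;> simp

theorem norm_J (v : E) : ‖J v‖ = ‖v‖ := by
  have : ‖J v‖ ^ 2 = ‖v‖ ^ 2 := by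
    rw [norm_sq_coords, norm_sq_coords]; simp [Complex.normSq_neg, Complex.normSq_conj, add_comm]
  exact (pow_left_inj₀ (norm_nonneg _) (norm_nonneg _) two_ne_zero).1 this

theorem inner_J_self (v : E) : inner ℂ (J v) v = 0 := by
  rw [inner_coords]; simp; ring

theorem inner_J_J (v w : E) : inner ℂ (J v) (J w) = inner ℂ w v := by
  rw [inner_coords, inner_coords]; simp; ring

/-- This is the identification of `su(2)` with the imaginary quaternions. Since `J` anticommutes
with `i`, it reverses the sign of `i X`. -/
theorem IsSu2.J_apply {X : EndE} (hX : IsSu2 X) (v : E) : J (X v) = X (J v) := by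
  obtain ⟨α, β, h⟩ := hX.coords
  ext i
  fin_cases i
  · simp [(h _).1, (h _).2]
  · simp [(h _).1, (h _).2]; ring

/-- The decomposition of `w` in the orthogonal frame `v, J v`. -/
theorem norm_sq_smul_eq (v w : E) :
    ((‖v‖ ^ 2 : ℝ) : ℂ) • w = inner ℂ v w • v + inner ℂ (J v) w • J v := by
  ext i
  rw [norm_sq_coords, Complex.ofReal_add, Complex.normSq_eq_conj_mul_self,
    Complex.normSq_eq_conj_mul_self]
  fin_cases i
  · simp [inner_coords]; ring
  · simp [inner_coords]; ring

theorem norm_sq_mul_norm_sq (v w : E) :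
    ‖v‖ ^ 2 * ‖w‖ ^ 2 = ‖inner ℂ v w‖ ^ 2 + ‖inner ℂ (J v) w‖ ^ 2 := by
  simp only [← Complex.normSq_eq_norm_sq, inner_coords, norm_sq_coords, Complex.normSq_apply]
  simp
  ring

/-- `J` as a real continuous linear map. -/
def JCLM : E →L[ℝ] E :=
  LinearMap.toContinuousLinearMap
    { toFun := J
      map_add' := J_add
      map_smul' := fun r v => by
        have := J_smul (r : ℂ) v
        simpa using this }

theorem JCLM_apply (v : E) : JCLM v = J v := rfl

end

section

/-! ### Global solutions of linear differential equations -/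

open BoundedContinuousFunction in
/-- A linear differential equation with continuous coefficients has a global solution. -/
theorem exists_linear_ode_solution {F : Type*} [NormedAddCommGroup F] [NormedSpace ℝ F]
    [CompleteSpace F] (M : ℝ → F →L[ℝ] F) (hM : Continuous M) (t₀ : ℝ) (x₀ : F) :
    ∃ s : ℝ → F, s t₀ = x₀ ∧ ∀ t, HasDerivAt s (M t (s t)) t := by
  set k : ℝ → ℝ := fun t => ‖M t‖ with hk
  have hkc : Continuous k := hM.norm
  set K : ℝ → ℝ := fun t => ∫ τ in t₀..t, k τ with hK
  have hKd : ∀ t, HasDerivAt K (k t) t := fun t =>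
    intervalIntegral.integral_hasDerivAt_right (hkc.intervalIntegrable _ _)
      (hkc.stronglyMeasurableAtFilter _ _) hkc.continuousAt
  have hKc : Continuous K := continuous_iff_continuousAt.2 fun t => (hKd t).continuousAt
  -- A weight that makes the Picard operator a contraction on the whole line at once. Being even in
  -- `K`, it serves both directions of time, and `∫ k cosh (2 K) = sinh (2 K) / 2` is at most half
  -- of it in absolute value, which is the contraction factor.
  set wt : ℝ → ℝ := fun t => Real.cosh (2 * K t) with hwt
  have hwtc : Continuous wt := Real.continuous_cosh.comp (continuous_const.mul hKc)
  have hwtpos : ∀ t, 0 < wt t := fun t => Real.cosh_pos _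
  have hwt1 : ∀ t, 1 ≤ wt t := fun t => Real.one_le_cosh _
  have hint : ∀ t, ∫ τ in t₀..t, k τ * wt τ = Real.sinh (2 * K t) / 2 := by
    intro t
    have hd : ∀ τ ∈ Set.uIcc t₀ t, HasDerivAt (fun τ => Real.sinh (2 * K τ) / 2) (k τ * wt τ) τ := by
      intro τ _
      have := (((hKd τ).const_mul 2).sinh).div_const 2
      have h2 : Real.cosh (2 * K τ) * (2 * k τ) / 2 = k τ * wt τ := by
        change _ = k τ * Real.cosh (2 * K τ)
        ring
      exact h2 ▸ this
    rw [intervalIntegral.integral_eq_sub_of_hasDerivAt hd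
      ((hkc.mul hwtc).intervalIntegrable _ _)]
    simp [hK]
  have key : ∀ (z : ℝ → F) (c : ℝ), Continuous z → (∀ t, ‖z t‖ ≤ c) → ∀ t,
      ‖∫ τ in t₀..t, M τ (wt τ • z τ)‖ ≤ c / 2 * wt t := by
    intro z c hz hzc t
    have hc0 : 0 ≤ c := (norm_nonneg _).trans (hzc 0)
    have h1 : ‖∫ τ in t₀..t, M τ (wt τ • z τ)‖ ≤ |∫ τ in t₀..t, c * (k τ * wt τ)| := by
      apply intervalIntegral.norm_integral_le_abs_of_norm_le
      · refine ae_of_all _ fun τ => ?_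
        calc ‖M τ (wt τ • z τ)‖ ≤ ‖M τ‖ * ‖wt τ • z τ‖ := (M τ).le_opNorm _
          _ = k τ * (wt τ * ‖z τ‖) := by
            rw [norm_smul, Real.norm_of_nonneg (hwtpos τ).le]
          _ ≤ k τ * (wt τ * c) := by
            have := hzc τ
            have := (hwtpos τ).le
            have : 0 ≤ k τ := norm_nonneg _
            gcongr
          _ = c * (k τ * wt τ) := by ring
      · exact (continuous_const.mul (hkc.mul hwtc)).intervalIntegrable _ _
    refine h1.trans ?_
    rw [intervalIntegral.integral_const_mul, hint, abs_mul, abs_of_nonneg hc0, abs_div]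
    have : |Real.sinh (2 * K t)| ≤ wt t := by
      rw [abs_le]
      have h1 := Real.sinh_lt_cosh (2 * K t)
      have h2 := Real.sinh_lt_cosh (-(2 * K t))
      rw [Real.sinh_neg, Real.cosh_neg] at h2
      constructor <;> simp only [hwt] <;> linarith
    rw [abs_two]
    calc c * (|Real.sinh (2 * K t)| / 2) ≤ c * (wt t / 2) := by gcongr
      _ = c / 2 * wt t := by ring
  have hcont : ∀ z : ℝ → F, Continuous z → Continuous fun τ => M τ (wt τ • z τ) := fun z hz =>
    hM.clm_apply (hwtc.smul hz)
  -- The Picard operator for the rescaled unknown `z = s / wt`, which stays bounded.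
  set P : (ℝ →ᵇ F) → (ℝ →ᵇ F) := fun z => ofNormedAddCommGroup
    (fun t => (wt t)⁻¹ • (x₀ + ∫ τ in t₀..t, M τ (wt τ • z τ)))
    ((hwtc.inv₀ fun t => (hwtpos t).ne').smul (continuous_const.add
      (intervalIntegral.continuous_primitive
        (fun a b => (hcont z z.continuous).intervalIntegrable a b) t₀)))
    (‖x₀‖ + ‖z‖ / 2) (by
      intro t
      rw [norm_smul, norm_inv, Real.norm_of_nonneg (hwtpos t).le, inv_mul_le_iff₀ (hwtpos t)]
      refine (norm_add_le _ _).trans ?_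
      have h1 := key z ‖z‖ z.continuous z.norm_coe_le_norm t
      have h2 := mul_le_mul_of_nonneg_right (hwt1 t) (norm_nonneg x₀)
      linarith) with hP
  have hPc : ContractingWith (1 / 2) P := by
    refine ⟨by
      rw [div_lt_one (by norm_num)]; norm_num, LipschitzWith.of_dist_le_mul fun z w => ?_⟩
    rw [BoundedContinuousFunction.dist_le (by positivity)]
    intro t
    have h1 := key (fun τ => z τ - w τ) (dist z w) (z.continuous.sub w.continuous)
      (fun τ => by rw [← dist_eq_norm]; exact z.dist_coe_le_dist τ) t
    simp only [hP, coe_ofNormedAddCommGroup]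
    rw [dist_eq_norm, ← smul_sub, norm_smul, norm_inv, Real.norm_of_nonneg (hwtpos t).le,
      inv_mul_le_iff₀ (hwtpos t), add_sub_add_left_eq_sub,
      ← intervalIntegral.integral_sub ((hcont z z.continuous).intervalIntegrable _ _)
      ((hcont w w.continuous).intervalIntegrable _ _)]
    simp only [smul_sub, map_sub] at h1
    refine h1.trans (le_of_eq ?_)
    push_cast
    ring
  obtain ⟨z, hz⟩ : ∃ z, P z = z := ⟨_, hPc.fixedPoint_isFixedPt⟩
  have hs : ∀ t, wt t • z t = x₀ + ∫ τ in t₀..t, M τ (wt τ • z τ) := by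
    intro t
    conv_lhs => rw [← hz]
    simp only [hP, coe_ofNormedAddCommGroup]
    rw [smul_inv_smul₀ (hwtpos t).ne']
  refine ⟨fun t => wt t • z t, (hs t₀).trans (by rw [intervalIntegral.integral_same, add_zero]),
    fun t => ?_⟩
  have hc := hcont z z.continuous
  have := (intervalIntegral.integral_hasDerivAt_right (hc.intervalIntegrable t₀ t)
    (hc.stronglyMeasurableAtFilter _ _) hc.continuousAt).const_add x₀
  exact this.congr_of_eventuallyEq (Eventually.of_forall hs)

/-- Two solutions of a linear equation that agree at a time agree everywhere. -/
theorem linear_ode_unique {F : Type*} [NormedAddCommGroup F] [NormedSpace ℝ F]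
    (M : ℝ → F →L[ℝ] F) (hM : Continuous M) {s r : ℝ → F}
    (hs : ∀ t, HasDerivAt s (M t (s t)) t) (hr : ∀ t, HasDerivAt r (M t (r t)) t) {t₀ : ℝ}
    (h : s t₀ = r t₀) : s = r := by
  funext t
  obtain ⟨a, b, ha, hb, ha', hb'⟩ : ∃ a b, a < t ∧ t < b ∧ a < t₀ ∧ t₀ < b :=
    ⟨min t t₀ - 1, max t t₀ + 1, by have := min_le_left t t₀; linarith,
      by have := le_max_left t t₀; linarith, by have := min_le_right t t₀; linarith,
      by have := le_max_right t t₀; linarith⟩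
  obtain ⟨C, hC⟩ := isCompact_Icc.exists_bound_of_continuousOn (s := Set.Icc a b) hM.continuousOn
  refine ODE_solution_unique_of_mem_Ioo (v := fun t x => M t x) (s := fun _ => Set.univ)
    (K := C.toNNReal) (a := a) (b := b) (t₀ := t₀) (fun τ hτ => ?_) ⟨ha', hb'⟩
    (fun τ _ => ⟨hs τ, trivial⟩) (fun τ _ => ⟨hr τ, trivial⟩) h ⟨ha, hb⟩
  refine ((M τ).lipschitz.weaken ?_).lipschitzOnWith
  rw [← norm_toNNReal]
  exact Real.toNNReal_le_toNNReal (hC τ (Set.Ioo_subset_Icc_self hτ))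

end

section

/-! ### The scattering equation on a line -/

/-- The restriction of a monopole to a line: the connection coefficient `a` and the Higgs field `X`
with its derivative. -/
structure LineData where
  /-- the connection coefficient -/
  a : ℝ → EndE
  /-- the Higgs field -/
  X : ℝ → EndE
  /-- the derivative of the Higgs field -/
  X' : ℝ → EndE
  continuous_a : Continuous a
  hasDerivAt_X : ∀ t, HasDerivAt X (X' t) t
  su2_a : ∀ t, IsSu2 (a t)
  su2_X : ∀ t, IsSu2 (X t)

namespace LineData

variable (L : LineData)

/-- The covariant derivative of the Higgs field along the line. -/
def D (t : ℝ) : EndE := L.X' t + (L.a t * L.X t - L.X t * L.a t)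

/-- Solutions of `(∂_t^A - i Φ) s = 0`. -/
def SSol (s : ℝ → E) : Prop :=
  ∀ t, HasDerivAt s (-(L.a t (s t)) + Complex.I • L.X t (s t)) t

/-- Solutions of `(∂_t^A + i Φ) r = 0`. -/
def RSol (r : ℝ → E) : Prop :=
  ∀ t, HasDerivAt r (-(L.a t (r t)) - Complex.I • L.X t (r t)) t

theorem continuous_X : Continuous L.X :=
  continuous_iff_continuousAt.2 fun t => (L.hasDerivAt_X t).continuousAt

/-- The coefficient of the scattering equation. -/
def coeff (t : ℝ) : E →L[ℝ] E := (-(L.a t) + Complex.I • L.X t).restrictScalars ℝ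

theorem continuous_coeff : Continuous L.coeff :=
  (ContinuousLinearMap.restrictScalarsL ℂ E E ℝ ℝ).continuous.comp
    (L.continuous_a.neg.add (L.continuous_X.const_smul Complex.I))

theorem exists_sSol (t₀ : ℝ) (x₀ : E) : ∃ s, s t₀ = x₀ ∧ L.SSol s :=
  exists_linear_ode_solution L.coeff L.continuous_coeff t₀ x₀

theorem SSol.eq {L : LineData} {s r : ℝ → E} (hs : L.SSol s) (hr : L.SSol r) {t₀ : ℝ}
    (h : s t₀ = r t₀) : s = r :=
  linear_ode_unique L.coeff L.continuous_coeff hs hr h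

theorem sSol_zero : L.SSol 0 := fun t => by
  simp

theorem SSol.smul {L : LineData} {s : ℝ → E} (hs : L.SSol s) (z : ℂ) :
    L.SSol fun t => z • s t := fun t => by
  refine ((hs t).const_smul z).congr_deriv ?_
  simp only [map_smul, smul_add, smul_neg]
  rw [smul_comm z]

theorem SSol.sub {L : LineData} {s r : ℝ → E} (hs : L.SSol s) (hr : L.SSol r) :
    L.SSol fun t => s t - r t := fun t => by
  refine ((hs t).sub (hr t)).congr_deriv ?_
  simp only [map_sub, smul_sub]
  abel

theorem SSol.ne_zero {L : LineData} {s : ℝ → E} (hs : L.SSol s) {t₀ : ℝ} (h : s t₀ ≠ 0) (t : ℝ) :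
    s t ≠ 0 := fun h0 => h (by
  have := hs.eq L.sSol_zero (t₀ := t) (by simpa using h0)
  rw [this]; rfl)

/-- The connection commutes with `J`, while the scalar `i` in front of the Higgs field is
conjugated. -/
theorem SSol.J {L : LineData} {s : ℝ → E} (hs : L.SSol s) : L.RSol fun t => J (s t) := fun t => by
  refine (JCLM.hasFDerivAt.comp_hasDerivAt t (hs t)).congr_deriv ?_
  simp only [JCLM_apply, J_add, J_smul, (L.su2_X t).J_apply, Complex.conj_I]
  have : HypMonopole.J (-(L.a t (s t))) = -(L.a t (HypMonopole.J (s t))) := by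
    have := J_smul (-1) (L.a t (s t))
    simpa [(L.su2_a t).J_apply] using this
  rw [this, neg_smul, sub_eq_add_neg]

theorem RSol.J {L : LineData} {s : ℝ → E} (hs : L.RSol s) : L.SSol fun t => J (s t) := fun t => by
  refine (JCLM.hasFDerivAt.comp_hasDerivAt t (hs t)).congr_deriv ?_
  simp only [JCLM_apply, sub_eq_add_neg, J_add]
  have h1 : ∀ v, HypMonopole.J (-v) = -HypMonopole.J v := fun v => by
    have := J_smul (-1) v
    simpa using this
  rw [h1, h1, J_smul, (L.su2_a t).J_apply, (L.su2_X t).J_apply, Complex.conj_I, neg_smul, neg_neg]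

/-- The pairing of solutions of the two equations is constant. -/
theorem RSol.inner_const {L : LineData} {r s : ℝ → E} (hr : L.RSol r) (hs : L.SSol s) (t t' : ℝ) :
    inner ℂ (r t) (s t) = inner ℂ (r t') (s t') := by
  have hd : ∀ t, HasDerivAt (fun t => inner ℂ (r t) (s t)) 0 t := fun t => by
    refine ((hr t).inner ℂ (hs t)).congr_deriv ?_
    simp only [inner_add_right, inner_neg_right, inner_sub_left, inner_neg_left, inner_smul_left,
      inner_smul_right, (L.su2_a t).inner_apply_left, (L.su2_X t).inner_apply_left, Complex.conj_I]
    ring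
  exact is_const_of_deriv_eq_zero (fun t => (hd t).differentiableAt) (fun t => (hd t).deriv) t t'

/-- The Wronskian of two solutions is constant. -/
theorem SSol.wronskian_const {L : LineData} {s₁ s₂ : ℝ → E} (h₁ : L.SSol s₁) (h₂ : L.SSol s₂)
    (t t' : ℝ) :
    inner ℂ (HypMonopole.J (s₁ t)) (s₂ t) = inner ℂ (HypMonopole.J (s₁ t')) (s₂ t') :=
  h₁.J.inner_const h₂ t t'

/-- In dimension two, orthogonality to `J s₁` means being parallel to `s₁`. Uniqueness for the
equation propagates this from one time to all. -/
theorem SSol.eq_smul_of_wronskian_eq_zero {L : LineData} {s₁ s₂ : ℝ → E} (h₁ : L.SSol s₁)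
    (h₂ : L.SSol s₂) {t₀ : ℝ} (hne : s₁ t₀ ≠ 0)
    (hw : inner ℂ (HypMonopole.J (s₁ t₀)) (s₂ t₀) = 0) : ∃ z : ℂ, s₂ = fun t => z • s₁ t := by
  have h := norm_sq_smul_eq (s₁ t₀) (s₂ t₀)
  rw [hw, zero_smul, add_zero] at h
  have hn : ((‖s₁ t₀‖ ^ 2 : ℝ) : ℂ) ≠ 0 := by
    rw [Complex.ofReal_ne_zero]; positivity
  refine ⟨((‖s₁ t₀‖ ^ 2 : ℝ) : ℂ)⁻¹ * inner ℂ (s₁ t₀) (s₂ t₀), h₂.eq (h₁.smul _) (t₀ := t₀) ?_⟩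
  rw [mul_smul, ← h, inv_smul_smul₀ hn]

/-! ### Growing solutions -/

/-- The derivative of `i Φ σ` along a solution. -/
theorem SSol.hasDerivAt_higgs {L : LineData} {σ : ℝ → E} (h : L.SSol σ) (t : ℝ) :
    HasDerivAt (fun t => Complex.I • L.X t (σ t))
      (Complex.I • L.D t (σ t) - L.a t (Complex.I • L.X t (σ t))
        + ((‖L.X t‖ ^ 2 : ℝ) : ℂ) • σ t) t := by
  have h1 : HasDerivAt (fun t => L.X t (σ t))
      (L.X' t (σ t) + L.X t (-(L.a t (σ t)) + Complex.I • L.X t (σ t))) t := by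
    have hX : HasDerivAt (fun t => (L.X t).restrictScalars ℝ) ((L.X' t).restrictScalars ℝ) t :=
      (ContinuousLinearMap.restrictScalarsL ℂ E E ℝ ℝ).hasFDerivAt.comp_hasDerivAt t
        (L.hasDerivAt_X t)
    exact hX.clm_apply (h t)
  refine (h1.const_smul Complex.I).congr_deriv ?_
  simp only [D, map_add, map_neg, map_smul, (L.su2_X t).apply_apply, _root_.add_apply,
    _root_.sub_apply, mul_apply_eq_comp, smul_add, smul_sub, smul_smul,
    smul_neg, neg_smul]
  simp only [← mul_assoc, Complex.I_mul_I, neg_mul, one_mul]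
  module

theorem inner_higgs_left {X : EndE} (hX : IsSu2 X) (v w : E) :
    inner ℂ (Complex.I • X v) w = inner ℂ v (Complex.I • X w) := by
  simp [hX.inner_apply_left, mul_comm]

theorem higgs_higgs {X : EndE} (hX : IsSu2 X) (v : E) :
    Complex.I • X (Complex.I • X v) = ((‖X‖ ^ 2 : ℝ) : ℂ) • v := by
  rw [map_smul, hX.apply_apply, smul_smul, smul_smul, Complex.I_mul_I]; simp

theorem norm_higgs_sq {X : EndE} (hX : IsSu2 X) (v : E) :
    ‖Complex.I • X v‖ ^ 2 = ‖X‖ ^ 2 * ‖v‖ ^ 2 := by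
  have h := inner_higgs_left hX v (Complex.I • X v)
  rw [higgs_higgs hX, inner_smul_right (x := v) (y := v), inner_self_eq_norm_sq_to_K (𝕜 := ℂ) v,
    inner_self_eq_norm_sq_to_K (𝕜 := ℂ) (Complex.I • X v)] at h
  have h2 : ((‖Complex.I • X v‖ ^ 2 : ℝ) : ℂ) = ((‖X‖ ^ 2 * ‖v‖ ^ 2 : ℝ) : ℂ) := by
    push_cast at h ⊢
    exact h
  exact Complex.ofReal_injective h2

theorem SSol.hasDerivAt_normSq {L : LineData} {σ : ℝ → E} (h : L.SSol σ) (t : ℝ) :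
    HasDerivAt (fun t => ‖σ t‖ ^ 2) (2 * (inner ℂ (σ t) (Complex.I • L.X t (σ t))).re) t := by
  have h1 := (Complex.reCLM.hasFDerivAt.comp_hasDerivAt t ((h t).inner ℂ (h t)))
  have h2 : (fun t => ‖σ t‖ ^ 2) = Complex.reCLM ∘ fun t => inner ℂ (σ t) (σ t) := by
    funext τ
    simp only [Function.comp, inner_self_eq_norm_sq_to_K, Complex.reCLM_apply]
    norm_cast
  rw [h2]
  refine HasDerivAt.congr_deriv h1 ?_
  simp only [inner_add_right, inner_neg_right, inner_add_left, inner_neg_left,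
    (L.su2_a t).inner_apply_left, inner_higgs_left (L.su2_X t), Complex.reCLM_apply]
  simp only [Complex.add_re, Complex.neg_re]
  ring

theorem SSol.hasDerivAt_energy {L : LineData} {σ : ℝ → E} (h : L.SSol σ) (t : ℝ) :
    HasDerivAt (fun t => (inner ℂ (σ t) (Complex.I • L.X t (σ t))).re)
      (2 * ‖L.X t‖ ^ 2 * ‖σ t‖ ^ 2 + (inner ℂ (σ t) (Complex.I • L.D t (σ t))).re) t := by
  have h1 := (Complex.reCLM.hasFDerivAt.comp_hasDerivAt t ((h t).inner ℂ (h.hasDerivAt_higgs t)))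
  refine HasDerivAt.congr_deriv h1 ?_
  simp only [inner_add_right, inner_add_left, inner_neg_left, inner_sub_right,
    (L.su2_a t).inner_apply_left]
  rw [inner_higgs_left (L.su2_X t), higgs_higgs (L.su2_X t), inner_smul_right (x := σ t) (y := σ t),
    inner_self_eq_norm_sq_to_K (𝕜 := ℂ) (σ t)]
  simp only [Complex.reCLM_apply, Complex.add_re, Complex.sub_re, Complex.neg_re]
  have : ((((‖L.X t‖ ^ 2 : ℝ) : ℂ)) * ((‖σ t‖ : ℝ) : ℂ) ^ 2).re = ‖L.X t‖ ^ 2 * ‖σ t‖ ^ 2 := by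
    norm_cast
  simp only [Complex.coe_algebraMap] at *
  rw [this]
  ring

/-- `J σ` evolves with the opposite sign of the Higgs field, and `(i X)²` is scalar. The remaining
Higgs terms are thus multiples of `(J σ, σ) = 0`, and only the covariant derivative of the Higgs
field survives. -/
theorem SSol.hasDerivAt_offDiag {L : LineData} {σ : ℝ → E} (h : L.SSol σ) (t : ℝ) :
    HasDerivAt (fun t => inner ℂ (HypMonopole.J (σ t)) (Complex.I • L.X t (σ t)))
      (inner ℂ (HypMonopole.J (σ t)) (Complex.I • L.D t (σ t))) t := by
  refine ((h.J t).inner ℂ (h.hasDerivAt_higgs t)).congr_deriv ?_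
  simp only [inner_add_right, inner_sub_left, inner_neg_left, inner_sub_right,
    (L.su2_a t).inner_apply_left]
  rw [inner_higgs_left (L.su2_X t), higgs_higgs (L.su2_X t), inner_smul_right (y := σ t), inner_J_self]
  ring

/-- Pythagoras for `i X v` in the frame `v, J v`. The first entry is real because `i X` is
Hermitian, and `i X` stretches every vector by `‖X‖`. -/
theorem energy_sq_add {X : EndE} (hX : IsSu2 X) (v : E) :
    (inner ℂ v (Complex.I • X v)).re ^ 2 + ‖inner ℂ (HypMonopole.J v) (Complex.I • X v)‖ ^ 2
      = ‖X‖ ^ 2 * (‖v‖ ^ 2) ^ 2 := by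
  have h := norm_sq_mul_norm_sq v (Complex.I • X v)
  rw [norm_higgs_sq hX] at h
  have him : (inner ℂ v (Complex.I • X v)).im = 0 := by
    have h1 := inner_higgs_left hX v v
    rw [← inner_conj_symm, Complex.conj_eq_iff_im] at h1
    exact h1
  have h2 : ‖inner ℂ v (Complex.I • X v)‖ ^ 2 = (inner ℂ v (Complex.I • X v)).re ^ 2 := by
    rw [← Complex.normSq_eq_norm_sq, Complex.normSq_apply, him]; ring
  rw [← h2]
  linarith

/-- As `(i X)² = ‖X‖²`, the image of `i X + ‖X‖` consists of such eigenvectors. If that map kills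
`w`, then `w` belongs to `-‖X‖` and `J w` belongs to `+‖X‖`. -/
theorem exists_higgs_eigenvector {X : EndE} (hX : IsSu2 X) :
    ∃ v : E, v ≠ 0 ∧ Complex.I • X v = ((‖X‖ : ℝ) : ℂ) • v := by
  set w : E := EuclideanSpace.single 0 1 with hw
  have hw0 : w ≠ 0 := by simp [hw]
  by_cases h : Complex.I • X w + ((‖X‖ : ℝ) : ℂ) • w = 0
  · refine ⟨HypMonopole.J w, ?_, ?_⟩
    · rw [← norm_ne_zero_iff, norm_J]; exact norm_ne_zero_iff.2 hw0
    · have h1 := congrArg HypMonopole.J (eq_neg_of_add_eq_zero_left h)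
      rw [J_smul, hX.J_apply, ← neg_smul, J_smul] at h1
      simp only [Complex.conj_I, neg_smul, map_neg, Complex.conj_ofReal, neg_inj] at h1
      exact h1
  · refine ⟨_, h, ?_⟩
    rw [map_add, smul_add, higgs_higgs hX, map_smul, smul_comm Complex.I, smul_add,
      smul_smul (M := ℂ) (α := E) ((‖X‖ : ℝ) : ℂ) ((‖X‖ : ℝ) : ℂ), ← Complex.ofReal_mul, ← sq, add_comm]

end LineData
end

section

/-! ### Asymptotics of growing and decaying solutions -/

/-- A nonnegative function with `x' ≤ -m x + g` and `g → 0` tends to zero. -/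
theorem tendsto_zero_of_deriv_le {x x' g : ℝ → ℝ} {m T : ℝ} (hm : 0 < m)
    (hx : ∀ t ≥ T, HasDerivAt x (x' t) t) (hx0 : ∀ t, 0 ≤ x t)
    (hle : ∀ t ≥ T, x' t ≤ -m * x t + g t) (hg : Tendsto g atTop (𝓝 0)) :
    Tendsto x atTop (𝓝 0) := by
  rw [Metric.tendsto_atTop]
  intro ε hε
  have hev : ∀ᶠ t in atTop, g t < m * (ε / 2) := hg.eventually_lt_const (by positivity)
  obtain ⟨T₁, hT₁⟩ := eventually_atTop.1 (hev.and (eventually_ge_atTop T))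
  -- With this integrating factor, the excess of `x` over `ε / 2` decays exponentially once `g < m ε
  -- / 2`.
  set f : ℝ → ℝ := fun t => (x t - ε / 2) * Real.exp (m * t) with hf
  have hfd : ∀ t ≥ T₁, HasDerivAt f ((x' t + m * (x t - ε / 2)) * Real.exp (m * t)) t := by
    intro t ht
    have h1 := ((hx t (hT₁ t ht).2).sub_const (ε / 2)).mul (((hasDerivAt_id t).const_mul m).exp)
    refine h1.congr_deriv ?_
    simp only [id]; ring
  have hanti : AntitoneOn f (Set.Ici T₁) := by
    apply antitoneOn_of_deriv_nonpos (convex_Ici _)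
    · exact fun t ht => (hfd t ht).continuousAt.continuousWithinAt
    · exact fun t ht => (hfd t (interior_subset ht)).differentiableAt.differentiableWithinAt
    · intro t ht
      have ht' : T₁ ≤ t := interior_subset ht
      rw [(hfd t ht').deriv]
      have h1 := hle t (hT₁ t ht').2
      have h2 := (hT₁ t ht').1
      exact mul_nonpos_of_nonpos_of_nonneg (by linarith) (Real.exp_pos _).le
  have hexp : Tendsto (fun t => ε / 2 + f T₁ * Real.exp (-(m * t))) atTop (𝓝 (ε / 2 + f T₁ * 0)) :=
    ((Real.tendsto_exp_neg_atTop_nhds_zero.comp (tendsto_id.const_mul_atTop hm)).const_mul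
      _).const_add _
  have hev2 := hexp.eventually_lt_const (show ε / 2 + f T₁ * 0 < ε by linarith)
  obtain ⟨T₂, hT₂⟩ := eventually_atTop.1 (hev2.and (eventually_ge_atTop T₁))
  refine ⟨T₂, fun t ht => ?_⟩
  rw [Real.dist_0_eq_abs, abs_of_nonneg (hx0 t)]
  have h1 := hanti Set.self_mem_Ici (show t ∈ Set.Ici T₁ from (hT₂ t ht).2) (hT₂ t ht).2
  have h2 := (hT₂ t ht).1
  have h3 : x t - ε / 2 ≤ f T₁ * Real.exp (-(m * t)) := by
    have h4 := mul_le_mul_of_nonneg_right h1 (Real.exp_pos (-(m * t))).le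
    have h5 : Real.exp (m * t) * Real.exp (-(m * t)) = 1 := by
      rw [← Real.exp_add, add_neg_cancel, Real.exp_zero]
    simp only [hf] at h4 ⊢
    rw [mul_assoc, h5, mul_one] at h4
    exact h4
  linarith

/-- A solution bounded by a positive decreasing function of its derivative converges fast. -/
theorem exists_limit_of_deriv_le {f f' : ℝ → ℂ} {B B' : ℝ → ℝ} {T : ℝ}
    (hf : ∀ t ≥ T, HasDerivAt f (f' t) t) (hB : ∀ t ≥ T, HasDerivAt B (B' t) t)
    (hB0 : ∀ t ≥ T, 0 < B t) (hBlim : Tendsto B atTop (𝓝 0))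
    (hle : ∀ ε > 0, ∀ᶠ t in atTop, ‖f' t‖ ≤ ε * (-B' t)) :
    ∃ κ : ℂ, Tendsto (fun t => ‖f t - κ‖ / B t) atTop (𝓝 0) := by
  have key : ∀ ε > 0, ∃ T₁ ≥ T, ∀ t ≥ T₁, ∀ t' ≥ t, ‖f t' - f t‖ ≤ ε * B t := by
    intro ε hε
    obtain ⟨T₁, hT₁⟩ := eventually_atTop.1 ((hle ε hε).and (eventually_ge_atTop T))
    refine ⟨T₁, (hT₁ T₁ le_rfl).2, fun t ht t' ht' => ?_⟩
    have hge : ∀ τ ∈ Set.Icc t t', T ≤ τ := fun τ hτ => (hT₁ τ (ht.trans hτ.1)).2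
    -- The variation of `f` on `[t, t']` is at most `ε` times the drop of `B`. As `B → 0` this gives
    -- a limit, and sending `t'` to infinity gives an error `o(B)`.
    have h := image_norm_le_of_norm_deriv_right_le_deriv_boundary' (a := t) (b := t')
      (f := fun τ => f τ - f t) (f' := f') (B := fun τ => ε * (B t - B τ))
      (B' := fun τ => ε * (-B' τ))
      (fun τ hτ => ((hf τ (hge τ hτ)).sub_const _).continuousAt.continuousWithinAt)
      (fun τ hτ => ((hf τ (hge τ (Set.Ico_subset_Icc_self hτ))).sub_const _).hasDerivWithinAt)
      (by simp)
      (fun τ hτ =>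
        (((hB τ (hge τ hτ)).const_sub _).const_mul _).continuousAt.continuousWithinAt)
      (fun τ hτ =>
        (((hB τ (hge τ (Set.Ico_subset_Icc_self hτ))).const_sub _).const_mul _).hasDerivWithinAt)
      (fun τ hτ => (hT₁ τ (ht.trans hτ.1)).1) (Set.right_mem_Icc.2 ht')
    refine h.trans ?_
    have := hB0 t' (hge t' (Set.right_mem_Icc.2 ht'))
    nlinarith
  have hc : Cauchy (map f atTop) := by
    rw [Metric.cauchy_iff]
    refine ⟨inferInstance, fun ε hε => ?_⟩
    obtain ⟨T₁, hT₁, h⟩ := key 1 one_pos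
    obtain ⟨T₂, hT₂⟩ := eventually_atTop.1 ((hBlim.eventually_lt_const
      (show (0 : ℝ) < ε / 2 by positivity)).and (eventually_ge_atTop T₁))
    refine ⟨f '' Set.Ici T₂, image_mem_map (Ici_mem_atTop _), ?_⟩
    rintro _ ⟨t, ht, rfl⟩ _ ⟨t', ht', rfl⟩
    have h0 := hT₂ T₂ le_rfl
    have h1 := h T₂ h0.2 t ht
    have h2 := h T₂ h0.2 t' ht'
    calc dist (f t) (f t') ≤ dist (f t) (f T₂) + dist (f t') (f T₂) := dist_triangle_right _ _ _
      _ ≤ 1 * B T₂ + 1 * B T₂ := by rw [dist_eq_norm, dist_eq_norm]; exact add_le_add h1 h2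
      _ < ε := by linarith [h0.1]
  obtain ⟨κ, hκ⟩ := cauchy_map_iff_exists_tendsto.1 hc
  refine ⟨κ, ?_⟩
  rw [Metric.tendsto_atTop]
  intro ε hε
  obtain ⟨T₁, hT₁, h⟩ := key (ε / 2) (by positivity)
  refine ⟨T₁, fun t ht => ?_⟩
  have hBt := hB0 t (hT₁.le.trans ht)
  have h1 : ‖κ - f t‖ ≤ ε / 2 * B t := by
    refine le_of_tendsto ((hκ.sub_const (f t)).norm) ?_
    filter_upwards [eventually_ge_atTop t] with t' ht' using h t ht t' ht'
  rw [Real.dist_0_eq_abs, abs_of_nonneg (by positivity), div_lt_iff₀ hBt, norm_sub_rev]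
  nlinarith

namespace LineData

variable {L : LineData} {m K H : ℝ}

theorem norm_sq_pos {v : E} (h : v ≠ 0) : 0 < ‖v‖ ^ 2 := by positivity

theorem abs_re_inner_higgs_le {X : EndE} (v w : E) :
    ‖inner ℂ v (Complex.I • X w)‖ ≤ ‖X‖ * (‖v‖ * ‖w‖) := by
  refine (norm_inner_le_norm _ _).trans ?_
  rw [norm_smul, Complex.norm_I, one_mul]
  have := X.le_opNorm w
  have := norm_nonneg v
  nlinarith

/-- There is a solution that grows at a definite rate. -/
theorem exists_growing (L : LineData) (hm : 0 < m)
    (hd : ∀ t, ‖L.D t‖ ^ 2 ≤ K * (m ^ 2 - ‖L.X t‖ ^ 2))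
    (hlim : Tendsto (fun t => ‖L.X t‖) atTop (𝓝 m)) :
    ∃ T ≥ 0, ∃ σ, L.SSol σ ∧ (∀ t, σ t ≠ 0) ∧
      ∀ t ≥ T, m / 2 * ‖σ t‖ ^ 2 ≤ (inner ℂ (σ t) (Complex.I • L.X t (σ t))).re := by
  have hh : Tendsto (fun t => m ^ 2 - ‖L.X t‖ ^ 2) atTop (𝓝 0) := by
    have := (hlim.pow 2).const_sub (m ^ 2)
    simpa using this
  have hh2 : Tendsto (fun t => K * (m ^ 2 - ‖L.X t‖ ^ 2)) atTop (𝓝 0) := by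
    simpa using hh.const_mul K
  -- Beyond `T` one has `‖X‖² > 3 m² / 4` and `‖D‖ ≤ m² / 2`. These are the margins needed by the
  -- barrier argument below.
  obtain ⟨T, hT⟩ := eventually_atTop.1 (((hh.eventually_lt_const
    (show (0 : ℝ) < m ^ 2 / 4 by positivity)).and (hh2.eventually_lt_const
    (show (0 : ℝ) < (m ^ 2 / 2) ^ 2 by positivity))).and (eventually_ge_atTop 0))
  obtain ⟨v, hv, hvX⟩ := exists_higgs_eigenvector (L.su2_X T)
  obtain ⟨σ, hσT, hσ⟩ := L.exists_sSol T v
  have hne : ∀ t, σ t ≠ 0 := hσ.ne_zero (t₀ := T) (by rw [hσT]; exact hv)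
  refine ⟨T, (hT T le_rfl).2, σ, hσ, hne, fun t ht => ?_⟩
  have hN : ∀ t, 0 < ‖σ t‖ ^ 2 := fun t => norm_sq_pos (hne t)
  set n : ℝ → ℝ := fun t => (inner ℂ (σ t) (Complex.I • L.X t (σ t))).re with hn
  have hd' : ∀ t ≥ T, ‖L.D t‖ ≤ m ^ 2 / 2 := fun t ht =>
    (pow_le_pow_iff_left₀ (norm_nonneg _) (by positivity) two_ne_zero).1
      ((hd t).trans (hT t ht).1.2.le)
  have hder : ∀ t, HasDerivAt (fun t => -(n t / ‖σ t‖ ^ 2))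
      (-(((2 * ‖L.X t‖ ^ 2 * ‖σ t‖ ^ 2 + (inner ℂ (σ t) (Complex.I • L.D t (σ t))).re) * ‖σ t‖ ^ 2
        - n t * (2 * n t)) / (‖σ t‖ ^ 2) ^ 2)) t := fun t =>
    ((hσ.hasDerivAt_energy t).div (hσ.hasDerivAt_normSq t) (hN t).ne').neg
  -- A barrier for the Rayleigh quotient `n / ‖σ‖²`. It starts at `‖X T‖ ≥ m / 2`. Wherever it
  -- equals `m / 2`, its derivative is at least `2 ‖X‖² - ‖D‖ - m² / 2 > 0`, so it cannot cross
  -- downwards.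
  have h := image_le_of_deriv_right_lt_deriv_boundary' (a := T) (b := t)
    (f := fun t => -(n t / ‖σ t‖ ^ 2)) (B := fun _ => -(m / 2)) (B' := fun _ => 0)
    (fun τ _ => (hder τ).continuousAt.continuousWithinAt)
    (fun τ _ => (hder τ).hasDerivWithinAt) ?_ continuousOn_const
    (fun τ _ => (hasDerivAt_const τ _).hasDerivWithinAt) ?_ (Set.right_mem_Icc.2 ht)
  · have h1 : m / 2 ≤ n t / ‖σ t‖ ^ 2 := by linarith
    exact (le_div_iff₀ (hN t)).1 h1
  · have h1 : n T = ‖L.X T‖ * ‖σ T‖ ^ 2 := by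
      simp only [hn, hσT]
      rw [hvX, inner_smul_right, inner_self_eq_norm_sq_to_K]
      simp only [Complex.coe_algebraMap]
      rw [← Complex.ofReal_pow, ← Complex.ofReal_mul, Complex.ofReal_re]
    rw [h1, mul_div_assoc, div_self (hN T).ne', mul_one, neg_le_neg_iff]
    have h2 := (hT T le_rfl).1.1
    refine (pow_le_pow_iff_left₀ (by positivity) (norm_nonneg _) two_ne_zero).1 ?_
    nlinarith
  · intro τ hτ heq
    have h1 : n τ = m / 2 * ‖σ τ‖ ^ 2 := by
      have : n τ / ‖σ τ‖ ^ 2 = m / 2 := by linarith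
      rw [div_eq_iff (hN τ).ne'] at this
      exact this
    rw [neg_lt_zero]
    apply div_pos _ (pow_pos (hN τ) 2)
    have h2 := (Complex.abs_re_le_norm _).trans
      (abs_re_inner_higgs_le (X := L.D τ) (σ τ) (σ τ))
    have h3 := (abs_le.1 h2).1
    have h4 := hd' τ hτ.1
    have h5 := (hT τ hτ.1).1.1
    have h6 : (inner ℂ (σ τ) (Complex.I • L.D τ (σ τ))).re ≥ -(m ^ 2 / 2) * ‖σ τ‖ ^ 2 := by
      have := mul_le_mul_of_nonneg_right h4 (hN τ).le
      nlinarith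
    have h7 : 2 * ‖L.X τ‖ ^ 2 * ‖σ τ‖ ^ 2 + (inner ℂ (σ τ) (Complex.I • L.D τ (σ τ))).re
        > m ^ 2 / 2 * ‖σ τ‖ ^ 2 := by
      have h8 : ‖L.X τ‖ ^ 2 > 3 / 4 * m ^ 2 := by linarith
      have := mul_lt_mul_of_pos_right h8 (hN τ)
      nlinarith
    have h9 := mul_lt_mul_of_pos_right h7 (hN τ)
    rw [h1]
    nlinarith

/-- The square of the normalised off-diagonal part of the Higgs field in the direction `σ`. -/
def offDiag (L : LineData) (σ : ℝ → E) (t : ℝ) : ℝ :=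
  ‖inner ℂ (HypMonopole.J (σ t)) (Complex.I • L.X t (σ t))‖ ^ 2 / (‖σ t‖ ^ 2) ^ 2

theorem offDiag_nonneg (L : LineData) (σ : ℝ → E) (t : ℝ) : 0 ≤ L.offDiag σ t := by
  unfold offDiag; positivity

/-- The numerator changes only through `D`, while `‖σ‖²` grows at logarithmic rate at least `m`.
This gives `x' ≤ 2 √x ‖D‖ - 2 m x`, and the arithmetic–geometric inequality spends half of the
damping on the cross term. -/
theorem SSol.exists_hasDerivAt_offDiag {σ : ℝ → E} (hσ : L.SSol σ) (hm : 0 < m)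
    (hne : ∀ t, σ t ≠ 0) {t : ℝ}
    (ht : m / 2 * ‖σ t‖ ^ 2 ≤ (inner ℂ (σ t) (Complex.I • L.X t (σ t))).re) :
    ∃ x', HasDerivAt (L.offDiag σ) x' t ∧ x' ≤ -m * L.offDiag σ t + ‖L.D t‖ ^ 2 / m := by
  have hN : 0 < ‖σ t‖ ^ 2 := norm_sq_pos (hne t)
  have h1 := (hσ.hasDerivAt_offDiag t).norm_sq
  have h2 := h1.div ((hσ.hasDerivAt_normSq t).pow 2) (pow_pos hN 2).ne'
  refine ⟨_, h2, ?_⟩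
  set w := inner ℂ (HypMonopole.J (σ t)) (Complex.I • L.X t (σ t)) with hw
  set w' := inner ℂ (HypMonopole.J (σ t)) (Complex.I • L.D t (σ t)) with hw'
  set N := ‖σ t‖ ^ 2 with hNdef
  set n := (inner ℂ (σ t) (Complex.I • L.X t (σ t))).re with hn
  have h3 : ‖w'‖ ≤ ‖L.D t‖ * N := by
    have := abs_re_inner_higgs_le (X := L.D t) (HypMonopole.J (σ t)) (σ t)
    rw [norm_J, ← sq] at this
    exact this
  have h4 : inner ℝ w w' ≤ ‖w‖ * (‖L.D t‖ * N) :=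
    (real_inner_le_norm _ _).trans (mul_le_mul_of_nonneg_left h3 (norm_nonneg _))
  have h5 : L.offDiag σ t = (‖w‖ / N) ^ 2 := by
    rw [div_pow]; rfl
  have h6 : (2 * inner ℝ w w' * N ^ 2 - ‖w‖ ^ 2 * ((2 : ℕ) * N ^ (2 - 1) * (2 * n))) / (N ^ 2) ^ 2
      ≤ 2 * (‖w‖ / N) * ‖L.D t‖ - 2 * m * (‖w‖ / N) ^ 2 := by
    rw [div_le_iff₀ (by positivity)]
    have h7 : (2 * (‖w‖ / N) * ‖L.D t‖ - 2 * m * (‖w‖ / N) ^ 2) * (N ^ 2) ^ 2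
        = 2 * (‖w‖ * (‖L.D t‖ * N)) * N ^ 2 - ‖w‖ ^ 2 * (2 * N * (2 * (m / 2 * N))) := by
      field_simp
    rw [h7]
    have h8 : ‖w‖ ^ 2 * (2 * N * (2 * (m / 2 * N))) ≤ ‖w‖ ^ 2 * (2 * N * (2 * n)) := by gcongr
    have h9 : 2 * inner ℝ w w' * N ^ 2 ≤ 2 * (‖w‖ * (‖L.D t‖ * N)) * N ^ 2 := by gcongr
    rw [pow_one, Nat.cast_ofNat]
    linarith
  rw [h5]
  refine h6.trans ?_
  have h10 : 0 ≤ (m * (‖w‖ / N) - ‖L.D t‖) ^ 2 / m := by positivity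
  have h11 : (m * (‖w‖ / N) - ‖L.D t‖) ^ 2 / m
      = m * (‖w‖ / N) ^ 2 - 2 * (‖w‖ / N) * ‖L.D t‖ + ‖L.D t‖ ^ 2 / m := by
    field_simp
    ring
  linarith

end LineData
end

/-! ### Exact growth rate and the normalised decaying solution -/

section
namespace LineData

variable {L : LineData} {m K H : ℝ}

/-- The growth `‖σ‖² ~ ν e^{2mt}`. -/
theorem SSol.exists_growth_constant {σ : ℝ → E} (hσ : L.SSol σ) (hm : 0 < m) (hK : 0 ≤ K)
    (hle : ∀ t, ‖L.X t‖ ≤ m) (hd : ∀ t, ‖L.D t‖ ^ 2 ≤ K * (m ^ 2 - ‖L.X t‖ ^ 2))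
    (hint : ∀ t ≥ 0, ∫ τ in (0)..t, (m ^ 2 - ‖L.X τ‖ ^ 2) ≤ H) {T : ℝ} (hT : 0 ≤ T)
    (hne : ∀ t, σ t ≠ 0)
    (hy : ∀ t ≥ T, m / 2 * ‖σ t‖ ^ 2 ≤ (inner ℂ (σ t) (Complex.I • L.X t (σ t))).re) :
    ∃ ν > 0, Tendsto (fun t => Real.exp (-(2 * m * t)) * ‖σ t‖ ^ 2) atTop (𝓝 ν) := by
  have hN : ∀ t, 0 < ‖σ t‖ ^ 2 := fun t => norm_sq_pos (hne t)
  set N : ℝ → ℝ := fun t => ‖σ t‖ ^ 2 with hNdef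
  set n : ℝ → ℝ := fun t => (inner ℂ (σ t) (Complex.I • L.X t (σ t))).re with hn
  set h : ℝ → ℝ := fun t => m ^ 2 - ‖L.X t‖ ^ 2 with hh
  have hh0 : ∀ t, 0 ≤ h t := fun t => by
    have := pow_le_pow_left₀ (norm_nonneg _) (hle t) 2
    simp only [hh]; linarith
  have hhc : Continuous h := continuous_const.sub (L.continuous_X.norm.pow 2)
  set G : ℝ → ℝ := fun t => ∫ τ in (0)..t, h τ with hG
  have hGd : ∀ t, HasDerivAt G (h t) t := fun t =>
    intervalIntegral.integral_hasDerivAt_right (hhc.intervalIntegrable _ _)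
      (hhc.stronglyMeasurableAtFilter _ _) hhc.continuousAt
  have hid : ∀ t, (n t / N t) ^ 2 + L.offDiag σ t = m ^ 2 - h t := by
    intro t
    have h1 := energy_sq_add (L.su2_X t) (σ t)
    have h2 : (n t / N t) ^ 2 + L.offDiag σ t = (‖L.X t‖ ^ 2 * N t ^ 2) / N t ^ 2 := by
      rw [div_pow, offDiag, ← add_div, h1]
    rw [h2, mul_div_assoc, div_self (pow_pos (hN t) 2).ne']
    simp only [hh]; ring
  have hy' : ∀ t ≥ T, m / 2 ≤ n t / N t := fun t ht => (le_div_iff₀ (hN t)).2 (hy t ht)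
  have hym : ∀ t ≥ T, n t / N t ≤ m := by
    intro t ht
    have h1 := hid t
    have h2 := L.offDiag_nonneg σ t
    refine (pow_le_pow_iff_left₀ ((by positivity : 0 ≤ m / 2).trans (hy' t ht)) hm.le
      two_ne_zero).1 ?_
    linarith [hh0 t]
  -- The logarithm of `e^{-2mt} ‖σ‖²`. It is nonincreasing because the Rayleigh quotient is at most
  -- `m`, so only a lower bound is missing for convergence.
  set L1 : ℝ → ℝ := fun t => Real.log (N t) - 2 * m * t with hL1
  have hL1d : ∀ t, HasDerivAt L1 (2 * (n t / N t) - 2 * m) t := by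
    intro t
    refine (((hσ.hasDerivAt_normSq t).log (hN t).ne').sub
      ((hasDerivAt_id t).const_mul (2 * m))).congr_deriv ?_
    simp only [mul_one, mul_div_assoc]
    rfl
  have hanti : AntitoneOn L1 (Set.Ici T) := by
    apply antitoneOn_of_deriv_nonpos (convex_Ici _)
    · exact fun t _ => (hL1d t).continuousAt.continuousWithinAt
    · exact fun t _ => (hL1d t).differentiableAt.differentiableWithinAt
    · intro t ht
      rw [(hL1d t).deriv]
      linarith [hym t (interior_subset ht)]
  -- With `y = n / N` and `x` the off-diagonal term, `m (m - y) ≤ m² - y² = h + x`, so `L1' ≥ -2 (h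
  -- + x) / m`. The multiple `-2 / m²` of `x` cancels the `x` part through `x' ≤ -m x + K h / m`.
  -- What is left is exactly `-C h`, which `C * G` compensates.
  set C : ℝ := 2 / m + 2 * K / m ^ 3 with hC
  have hC0 : 0 ≤ C := by positivity
  set L2 : ℝ → ℝ := fun t => L1 t - 2 / m ^ 2 * L.offDiag σ t + C * G t with hL2
  have hL2d : ∀ t ≥ T, ∃ l, HasDerivAt L2 l t ∧ 0 ≤ l := by
    intro t ht
    obtain ⟨x', hx', hx'le⟩ := hσ.exists_hasDerivAt_offDiag hm hne (hy t ht)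
    refine ⟨_, ((hL1d t).sub (hx'.const_mul (2 / m ^ 2))).add ((hGd t).const_mul C), ?_⟩
    have h1 := hid t
    have h2 := hym t ht
    have h3 := hy' t ht
    have h4 : m * (m - n t / N t) ≤ h t + L.offDiag σ t := by nlinarith
    have h5 : m - n t / N t ≤ (h t + L.offDiag σ t) / m := by
      rw [le_div_iff₀ hm]; linarith
    have h6 : 2 / m ^ 2 * x' ≤ 2 / m ^ 2 * (-m * L.offDiag σ t + K * h t / m) := by
      apply mul_le_mul_of_nonneg_left _ (by positivity)
      refine hx'le.trans (add_le_add_right ?_ _)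
      exact div_le_div_of_nonneg_right (hd t) hm.le
    have h7 : 2 / m ^ 2 * (-m * L.offDiag σ t + K * h t / m)
        = -(2 * (h t + L.offDiag σ t) / m) + C * h t := by
      simp only [hC]; field_simp; ring
    have h8 : 2 * ((h t + L.offDiag σ t) / m) = 2 * (h t + L.offDiag σ t) / m := by ring
    linarith
  have hmono : MonotoneOn L2 (Set.Ici T) := by
    apply monotoneOn_of_deriv_nonneg (convex_Ici _)
    · exact fun t ht => (hL2d t ht).choose_spec.1.continuousAt.continuousWithinAt
    · exact fun t ht =>
        (hL2d t (interior_subset ht)).choose_spec.1.differentiableAt.differentiableWithinAt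
    · intro t ht
      obtain ⟨l, hl, hl0⟩ := hL2d t (interior_subset ht)
      rw [hl.deriv]; exact hl0
  have hbdd : ∀ t ≥ T, L2 T - C * H ≤ L1 t := by
    intro t ht
    have h1 := hmono Set.self_mem_Ici (show t ∈ Set.Ici T from ht) ht
    have h2 := mul_le_mul_of_nonneg_left (hint t (hT.trans ht)) hC0
    have h3 : 0 ≤ 2 / m ^ 2 * L.offDiag σ t := mul_nonneg (by positivity) (L.offDiag_nonneg σ t)
    have h4 : L2 t = L1 t - 2 / m ^ 2 * L.offDiag σ t + C * G t := rfl
    linarith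
  have hanti' : Antitone fun t => L1 (max t T) := fun t t' htt' =>
    hanti (show T ≤ _ from le_max_right _ _) (show T ≤ _ from le_max_right _ _)
      (max_le_max_right T htt')
  have hlim := tendsto_atTop_ciInf hanti' ⟨L2 T - C * H, by
    rintro _ ⟨t, rfl⟩
    exact hbdd _ (le_max_right _ _)⟩
  refine ⟨_, Real.exp_pos _, ((Real.continuous_exp.tendsto _).comp hlim).congr' ?_⟩
  filter_upwards [eventually_ge_atTop T] with t ht
  simp only [Function.comp, max_eq_left ht, hL1]
  rw [sub_eq_add_neg, Real.exp_add, Real.exp_log (hN t), mul_comm]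

/-- A normalised decaying solution exists. -/
theorem exists_decaying (L : LineData) (hm : 0 < m) (hK : 0 ≤ K)
    (hle : ∀ t, ‖L.X t‖ ≤ m) (hd : ∀ t, ‖L.D t‖ ^ 2 ≤ K * (m ^ 2 - ‖L.X t‖ ^ 2))
    (hlim : Tendsto (fun t => ‖L.X t‖) atTop (𝓝 m))
    (hint : ∀ t ≥ 0, ∫ τ in (0)..t, (m ^ 2 - ‖L.X τ‖ ^ 2) ≤ H) :
    ∃ s, L.SSol s ∧ Tendsto (fun t => Real.exp (m * t) * ‖s t‖) atTop (𝓝 1) := by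
  obtain ⟨T, hT, σ, hσ, hne, hy⟩ := L.exists_growing hm hd hlim
  obtain ⟨ν, hν, hνlim⟩ := hσ.exists_growth_constant hm hK hle hd hint hT hne hy
  have hN : ∀ t, 0 < ‖σ t‖ ^ 2 := fun t => norm_sq_pos (hne t)
  set N : ℝ → ℝ := fun t => ‖σ t‖ ^ 2 with hNdef
  set n : ℝ → ℝ := fun t => (inner ℂ (σ t) (Complex.I • L.X t (σ t))).re with hn
  set w : ℝ → ℂ := fun t => inner ℂ (HypMonopole.J (σ t)) (Complex.I • L.X t (σ t)) with hw
  have hx : Tendsto (L.offDiag σ) atTop (𝓝 0) := by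
    have hg : Tendsto (fun t => ‖L.D t‖ ^ 2 / m) atTop (𝓝 0) := by
      have h1 : Tendsto (fun t => K * (m ^ 2 - ‖L.X t‖ ^ 2) / m) atTop (𝓝 0) := by
        have := (((hlim.pow 2).const_sub (m ^ 2)).const_mul K).div_const m
        simpa using this
      exact squeeze_zero (fun t => by positivity)
        (fun t => div_le_div_of_nonneg_right (hd t) hm.le) h1
    refine tendsto_zero_of_deriv_le (x' := deriv (L.offDiag σ)) (T := T) hm (fun t ht => ?_)
      (L.offDiag_nonneg σ) (fun t ht => ?_) hg
    · obtain ⟨x', h1, h2⟩ := hσ.exists_hasDerivAt_offDiag hm hne (hy t ht)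
      exact h1.differentiableAt.hasDerivAt
    · obtain ⟨x', h1, h2⟩ := hσ.exists_hasDerivAt_offDiag hm hne (hy t ht)
      rw [h1.deriv]; exact h2
  -- Reduction of order: a second solution, chosen so that its Wronskian with `σ` is one.
  obtain ⟨s₀, hs₀T, hs₀⟩ := L.exists_sSol T (((N T : ℝ) : ℂ)⁻¹ • HypMonopole.J (σ T))
  have hwr : ∀ t, inner ℂ (HypMonopole.J (σ t)) (s₀ t) = 1 := by
    intro t
    rw [hσ.wronskian_const hs₀ t T, hs₀T, inner_smul_right, inner_J_J,
      inner_self_eq_norm_sq_to_K]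
    have : ((N T : ℝ) : ℂ) ≠ 0 := Complex.ofReal_ne_zero.2 (hN T).ne'
    have h2 : ((N T : ℝ) : ℂ) = ((‖σ T‖ : ℝ) : ℂ) ^ 2 := by simp only [hNdef, Complex.ofReal_pow]
    rw [h2] at this ⊢
    exact inv_mul_cancel₀ this
  have hNd : ∀ t, HasDerivAt N (2 * n t) t := hσ.hasDerivAt_normSq
  have hZd : ∀ t, HasDerivAt (fun t => inner ℂ (σ t) (s₀ t))
      (2 * inner ℂ (Complex.I • L.X t (σ t)) (s₀ t)) t := by
    intro t
    refine ((hσ t).inner ℂ (hs₀ t)).congr_deriv ?_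
    simp only [inner_add_right, inner_neg_right, inner_add_left, inner_neg_left,
      (L.su2_a t).inner_apply_left, inner_higgs_left (L.su2_X t)]
    ring
  -- Expand `i X σ` in the frame `σ, J σ` and pair with `s₀`. The coefficient on `J σ` appears alone
  -- because the Wronskian is one.
  have hdec : ∀ t, ((N t : ℝ) : ℂ) * inner ℂ (Complex.I • L.X t (σ t)) (s₀ t)
      = (n t : ℝ) * inner ℂ (σ t) (s₀ t) + starRingEnd ℂ (w t) := by
    intro t
    have h1 := congrArg (fun v => inner ℂ v (s₀ t))
      (norm_sq_smul_eq (σ t) (Complex.I • L.X t (σ t)))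
    simp only [inner_add_left, inner_smul_left, hwr, Complex.conj_ofReal, mul_one] at h1
    have h2 : starRingEnd ℂ (inner ℂ (σ t) (Complex.I • L.X t (σ t))) = ((n t : ℝ) : ℂ) := by
      have h3 := inner_higgs_left (L.su2_X t) (σ t) (σ t)
      rw [← inner_conj_symm] at h3
      rw [h3]
      exact ((Complex.conj_eq_iff_re).1 h3).symm
    rw [h2] at h1
    simp only [inner_smul_left]
    exact h1
  have hαd : ∀ t ≥ T, HasDerivAt (fun t => inner ℂ (σ t) (s₀ t) / ((N t : ℝ) : ℂ))
      (2 * starRingEnd ℂ (w t) / ((N t : ℝ) : ℂ) ^ 2) t := by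
    intro t _
    have hNc : ((N t : ℝ) : ℂ) ≠ 0 := Complex.ofReal_ne_zero.2 (hN t).ne'
    refine ((hZd t).div (hNd t).ofReal_comp hNc).congr_deriv ?_
    congr 1
    have := hdec t
    push_cast
    linear_combination 2 * this
  have hBd : ∀ t ≥ T, HasDerivAt (fun t => (N t)⁻¹) (-(2 * n t) / N t ^ 2) t := fun t _ =>
    (hNd t).inv (hN t).ne'
  have hBlim : Tendsto (fun t => (N t)⁻¹) atTop (𝓝 0) := by
    have h1 : Tendsto (fun t : ℝ => Real.exp (-(2 * m * t))) atTop (𝓝 0) :=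
      Real.tendsto_exp_neg_atTop_nhds_zero.comp
        (tendsto_id.const_mul_atTop (by positivity : (0 : ℝ) < 2 * m))
    have h2 := h1.mul (hνlim.inv₀ hν.ne')
    rw [zero_mul] at h2
    refine h2.congr fun t => ?_
    rw [mul_inv, ← mul_assoc, mul_inv_cancel₀ (Real.exp_pos _).ne', one_mul]
  -- The coefficient of `s₀` along `σ` has derivative of size `2 |w| / N²`. This is negligible
  -- against `-(1 / N)' = 2 n / N² ≥ m / N`, since `|w| / N → 0`. So the coefficient tends to some
  -- `κ` with error `o(1 / N)`, and subtracting `κ σ` removes the growing part.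
  obtain ⟨κ, hκ⟩ := exists_limit_of_deriv_le hαd hBd (fun t _ => inv_pos.2 (hN t)) hBlim (by
    intro ε hε
    filter_upwards [hx.eventually_lt_const (show (0 : ℝ) < (ε * m / 2) ^ 2 by positivity),
      eventually_ge_atTop T] with t ht htT
    have h1 : ‖w t‖ / N t ≤ ε * m / 2 := by
      refine (pow_le_pow_iff_left₀ (div_nonneg (norm_nonneg _) (hN t).le) (by positivity)
        two_ne_zero).1 ?_
      rw [div_pow]
      exact ht.le
    rw [div_le_iff₀ (hN t)] at h1
    have h2 := hy t htT
    rw [norm_div, norm_mul, RCLike.norm_conj, norm_pow, Complex.norm_real,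
      Real.norm_of_nonneg (hN t).le, neg_div, neg_neg, ← mul_div_assoc]
    apply div_le_div_of_nonneg_right _ (by positivity)
    rw [Complex.norm_two]
    have h3 : ε * (2 * n t) ≥ ε * (m * N t) := by
      apply mul_le_mul_of_nonneg_left _ hε.le
      simp only [hn, hNdef]
      linarith
    linarith)
  -- The two frame components of `s₀ - κ σ`: the one along `J σ` contributes exactly `1`, the one
  -- along `σ` tends to zero.
  have hsq : ∀ t, N t * ‖s₀ t - κ • σ t‖ ^ 2
      = (‖inner ℂ (σ t) (s₀ t) / ((N t : ℝ) : ℂ) - κ‖ / (N t)⁻¹) ^ 2 + 1 := by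
    intro t
    have hNc : ((N t : ℝ) : ℂ) ≠ 0 := Complex.ofReal_ne_zero.2 (hN t).ne'
    have h1 := norm_sq_mul_norm_sq (σ t) (s₀ t - κ • σ t)
    rw [inner_sub_right, inner_sub_right, inner_smul_right, inner_smul_right, hwr, inner_J_self,
      inner_self_eq_norm_sq_to_K, mul_zero, sub_zero, norm_one, one_pow] at h1
    rw [h1]
    congr 2
    rw [div_inv_eq_mul]
    have h2 : ‖((N t : ℝ) : ℂ)‖ = N t := by
      rw [Complex.norm_real, Real.norm_of_nonneg (hN t).le]
    have h3 : ∀ z : ℂ, ‖z‖ * N t = ‖z * ((N t : ℝ) : ℂ)‖ := fun z => by rw [norm_mul, h2]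
    rw [h3, sub_mul, div_mul_cancel₀ _ hNc]
    congr 2
    simp [hNdef]
  have hfin : Tendsto (fun t => N t * ‖s₀ t - κ • σ t‖ ^ 2) atTop (𝓝 1) := by
    simp only [hsq]
    simpa using (hκ.pow 2).add_const 1
  -- From `N ‖s₀ - κ σ‖² → 1` and `e^{-2mt} N → ν` it follows that `e^{2mt} ‖s₀ - κ σ‖² → 1 / ν`,
  -- whence the factor `√ν`.
  refine ⟨fun t => ((Real.sqrt ν : ℝ) : ℂ) • (s₀ t - κ • σ t),
    (hs₀.sub (hσ.smul κ)).smul _, ?_⟩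
  have h1 := ((hfin.div hνlim hν.ne').mul_const ν).sqrt
  rw [one_div, inv_mul_cancel₀ hν.ne', Real.sqrt_one] at h1
  refine h1.congr fun t => ?_
  rw [norm_smul, Complex.norm_real, Real.norm_of_nonneg (Real.sqrt_nonneg _)]
  have h2 : N t * ‖s₀ t - κ • σ t‖ ^ 2 / (Real.exp (-(2 * m * t)) * ‖σ t‖ ^ 2) * ν
      = (Real.exp (m * t) * (Real.sqrt ν * ‖s₀ t - κ • σ t‖)) ^ 2 := by
    have h3 : Real.exp (m * t) ^ 2 * Real.exp (-(2 * m * t)) = 1 := by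
      rw [← Real.exp_nat_mul, ← Real.exp_add, ← Real.exp_zero]
      congr 1
      push_cast
      ring
    have h4 := (hN t).ne'
    rw [mul_pow, mul_pow, Real.sq_sqrt hν.le, div_mul_eq_mul_div,
      div_eq_iff (mul_ne_zero (Real.exp_pos _).ne' h4)]
    simp only [hNdef]
    linear_combination (-(‖s₀ t - κ • σ t‖ ^ 2 * ν * ‖σ t‖ ^ 2)) * h3
  change Real.sqrt (N t * ‖s₀ t - κ • σ t‖ ^ 2 / (Real.exp (-(2 * m * t)) * ‖σ t‖ ^ 2) * ν) = _
  rw [h2, Real.sqrt_sq (by positivity)]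

end LineData
end

section

/-! ### Geodesics -/

/-- The denominator in the formula for the geodesic. -/
def geodesicDenom (a b : S2) (t : ℝ) : ℝ := ‖(a : V) - b‖ + Real.exp (-t) + Real.exp t

theorem norm_sub_pos {a b : S2} (h : a ≠ b) : 0 < ‖(a : V) - b‖ :=
  norm_pos_iff.2 (sub_ne_zero.2 fun h' => h (Subtype.ext h'))

theorem geodesicDenom_pos (a b : S2) (t : ℝ) : 0 < geodesicDenom a b t := by
  unfold geodesicDenom; positivity

theorem norm_S2 (a : S2) : ‖(a : V)‖ = 1 := by simp

theorem norm_sq_smul_add_smul (a b : S2) (x y : ℝ) :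
    ‖x • (a : V) + y • (b : V)‖ ^ 2 = (x + y) ^ 2 - x * y * ‖(a : V) - b‖ ^ 2 := by
  rw [norm_add_sq_real, norm_sub_sq_real, norm_smul, norm_smul, norm_S2, norm_S2, inner_smul_left,
    inner_smul_right, mul_one, mul_one, Real.norm_eq_abs, Real.norm_eq_abs, sq_abs, sq_abs]
  simp only [conj_trivial]
  ring

theorem exp_neg_mul_exp (t : ℝ) : Real.exp (-t) * Real.exp t = 1 := by
  rw [← Real.exp_add, neg_add_cancel, Real.exp_zero]

theorem one_sub_norm_geodesic_sq (a b : S2) (t : ℝ) :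
    1 - ‖geodesic a b t‖ ^ 2 = 2 * ‖(a : V) - b‖ / geodesicDenom a b t := by
  have h := geodesicDenom_pos a b t
  have h1 : ‖geodesic a b t‖ ^ 2
      = ((Real.exp (-t) + Real.exp t) ^ 2 - ‖(a : V) - b‖ ^ 2) / geodesicDenom a b t ^ 2 := by
    change ‖(geodesicDenom a b t)⁻¹ • _‖ ^ 2 = _
    rw [norm_smul, mul_pow, norm_sq_smul_add_smul, norm_inv, Real.norm_of_nonneg h.le, inv_pow,
      exp_neg_mul_exp, one_mul, inv_mul_eq_div]
  rw [h1]
  field_simp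
  unfold geodesicDenom
  ring

theorem geodesic_mem {a b : S2} (h : a ≠ b) (t : ℝ) : geodesic a b t ∈ H3 := by
  have h1 := one_sub_norm_geodesic_sq a b t
  have h2 : 0 < 2 * ‖(a : V) - b‖ / geodesicDenom a b t :=
    div_pos (mul_pos two_pos (norm_sub_pos h)) (geodesicDenom_pos a b t)
  rw [H3, mem_ball_zero_iff]
  have h3 : ‖geodesic a b t‖ ^ 2 < 1 := by linarith
  exact (sq_lt_one_iff₀ (norm_nonneg _)).1 h3

theorem conf_geodesic {a b : S2} (h : a ≠ b) (t : ℝ) :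
    conf (geodesic a b t) = geodesicDenom a b t / ‖(a : V) - b‖ := by
  have := norm_sub_pos h
  have := geodesicDenom_pos a b t
  rw [conf, one_sub_norm_geodesic_sq]
  field_simp

theorem hasDerivAt_geodesic (a b : S2) (t : ℝ) :
    HasDerivAt (geodesic a b) ((geodesicDenom a b t ^ 2)⁻¹ •
      ((-(‖(a : V) - b‖ * Real.exp (-t) + 2)) • (a : V)
        + (‖(a : V) - b‖ * Real.exp t + 2) • (b : V))) t := by
  have hS := geodesicDenom_pos a b t
  have he : HasDerivAt (fun t : ℝ => Real.exp (-t)) (-Real.exp (-t)) t := by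
    simpa using (hasDerivAt_neg t).exp
  have hd : HasDerivAt (geodesicDenom a b) (-Real.exp (-t) + Real.exp t) t := by
    refine ((he.const_add ‖(a : V) - b‖).add (Real.hasDerivAt_exp t))
  have h := (hd.inv hS.ne').smul ((he.smul_const (a : V)).add
    ((Real.hasDerivAt_exp t).smul_const (b : V)))
  refine HasDerivAt.congr_deriv h ?_
  have key : ∀ p q d S : ℝ, S ≠ 0 → p * q = 1 → S = d + p + q →
      S⁻¹ • (-p • (a : V) + q • (b : V)) + (-(-p + q) / S ^ 2) • (p • (a : V) + q • (b : V))
      = (S ^ 2)⁻¹ • ((-(d * p + 2)) • (a : V) + (d * q + 2) • (b : V)) := by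
    intro p q d S hS0 hpq hSd
    have h1 : S⁻¹ = (S ^ 2)⁻¹ * (d + p + q) := by rw [← hSd]; field_simp
    rw [h1, div_eq_inv_mul]
    match_scalars
    · linear_combination (-2 * (S ^ 2)⁻¹) * hpq
    · linear_combination (2 * (S ^ 2)⁻¹) * hpq
  exact key _ _ _ _ hS.ne' (exp_neg_mul_exp t) rfl

theorem deriv_geodesic (a b : S2) (t : ℝ) :
    deriv (geodesic a b) t = (geodesicDenom a b t ^ 2)⁻¹ •
      ((-(‖(a : V) - b‖ * Real.exp (-t) + 2)) • (a : V)
        + (‖(a : V) - b‖ * Real.exp t + 2) • (b : V)) :=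
  (hasDerivAt_geodesic a b t).deriv

theorem continuous_geodesic (a b : S2) : Continuous (geodesic a b) :=
  continuous_iff_continuousAt.2 fun t => (hasDerivAt_geodesic a b t).continuousAt

theorem continuous_deriv_geodesic (a b : S2) : Continuous (deriv (geodesic a b)) := by
  have h : deriv (geodesic a b) = _ := funext (deriv_geodesic a b)
  rw [h]
  have h1 : Continuous (geodesicDenom a b) := by unfold geodesicDenom; fun_prop
  refine ((h1.pow 2).inv₀ fun t => (pow_pos (geodesicDenom_pos a b t) 2).ne').smul ?_
  fun_prop

/-- Geodesics are parametrised by arc length. -/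
theorem conf_mul_norm_deriv_geodesic {a b : S2} (h : a ≠ b) (t : ℝ) :
    conf (geodesic a b t) * ‖deriv (geodesic a b) t‖ = 1 := by
  have hδ := norm_sub_pos h
  have hS := geodesicDenom_pos a b t
  have h1 : ‖deriv (geodesic a b) t‖ ^ 2 = (‖(a : V) - b‖ / geodesicDenom a b t) ^ 2 := by
    rw [deriv_geodesic, norm_smul, mul_pow, norm_sq_smul_add_smul, norm_inv, norm_pow,
      Real.norm_of_nonneg hS.le]
    field_simp
    unfold geodesicDenom
    linear_combination (‖(a : V) - b‖ ^ 4 - 4 * ‖(a : V) - b‖ ^ 2) * exp_neg_mul_exp t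
  have h2 : ‖deriv (geodesic a b) t‖ = ‖(a : V) - b‖ / geodesicDenom a b t :=
    (pow_left_inj₀ (norm_nonneg _) (by positivity) two_ne_zero).1 h1
  rw [h2, conf_geodesic h]
  field_simp

theorem geodesic_neg (a b : S2) (t : ℝ) : geodesic a b (-t) = geodesic b a t := by
  unfold geodesic
  rw [neg_neg, norm_sub_rev, add_right_comm, add_comm (Real.exp t • (a : V))]

theorem deriv_geodesic_neg (a b : S2) (t : ℝ) :
    deriv (geodesic a b) (-t) = -deriv (geodesic b a) t := by
  have h : geodesic b a = fun t => geodesic a b (-t) := funext fun t => (geodesic_neg a b t).symm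
  rw [h, deriv_comp_neg, neg_neg]

theorem tendsto_norm_geodesic {a b : S2} (h : a ≠ b) :
    Tendsto (geodesic a b) atTop (comap norm (𝓝[<] (1 : ℝ))) := by
  rw [tendsto_comap_iff, tendsto_nhdsWithin_iff]
  constructor
  · have h1 : Tendsto (geodesicDenom a b) atTop atTop := by
      refine tendsto_atTop_mono (fun t => ?_) Real.tendsto_exp_atTop
      unfold geodesicDenom
      have := Real.exp_pos (-t)
      have := norm_nonneg ((a : V) - b)
      linarith
    have h2 : Tendsto (fun t => ‖geodesic a b t‖ ^ 2) atTop (𝓝 1) := by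
      have h3 := (h1.const_div_atTop (2 * ‖(a : V) - b‖)).const_sub 1
      rw [sub_zero] at h3
      refine h3.congr fun t => ?_
      rw [← one_sub_norm_geodesic_sq]; ring
    have h4 := h2.sqrt
    rw [Real.sqrt_one] at h4
    exact h4.congr fun t => Real.sqrt_sq (norm_nonneg _)
  · exact Eventually.of_forall fun t => by simpa [H3] using geodesic_mem h t

/-! ### Restriction of a monopole to a geodesic -/

variable {m : ℝ} (M : HyperbolicMonopole m)

theorem isOpen_H3 : IsOpen H3 := Metric.isOpen_ball

theorem HyperbolicMonopole.differentiableAt_Φ {x : V} (hx : x ∈ H3) :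
    DifferentiableAt ℝ M.Φ x :=
  (M.smooth_Φ.contDiffAt (isOpen_H3.mem_nhds hx)).differentiableAt (by simp)

/-- The data of the scattering equation along a geodesic. -/
def lineData {a b : S2} (h : a ≠ b) : LineData where
  a t := M.A (geodesic a b t) (deriv (geodesic a b) t)
  X t := M.Φ (geodesic a b t)
  X' t := fderiv ℝ M.Φ (geodesic a b t) (deriv (geodesic a b) t)
  continuous_a :=
    (M.smooth_A.continuousOn.comp_continuous (continuous_geodesic a b) (geodesic_mem h)).clm_apply
      (continuous_deriv_geodesic a b)
  hasDerivAt_X t := (HyperbolicMonopole.differentiableAt_Φ M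
    (geodesic_mem h t)).hasFDerivAt.comp_hasDerivAt t
    (hasDerivAt_geodesic a b t).differentiableAt.hasDerivAt
  su2_a t := M.su2_A _ (geodesic_mem h t) _
  su2_X t := M.su2_Φ _ (geodesic_mem h t)

/-- Time reversal exchanges the two scattering equations. -/
theorem IsScatteringSol.reverse {a b : S2} {s : ℝ → E} (hs : IsScatteringSol M a b s) :
    IsOppositeScatteringSol M b a fun t => s (-t) := fun t => by
  have h := (hs (-t)).scomp t (hasDerivAt_neg t)
  refine HasDerivAt.congr_deriv h ?_
  rw [deriv_geodesic_neg, geodesic_neg, map_neg]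
  simp only [neg_smul, one_smul, _root_.neg_apply, neg_neg, neg_add]
  abel

/-- Real conformal factors must pass through products of complex endomorphisms in the covariant
Leibniz rules. -/
instance : IsScalarTower ℝ EndE EndE := ⟨fun r X Y => by ext v; simp⟩

instance : SMulCommClass ℝ EndE EndE := ⟨fun r X Y => by ext v; simp⟩

theorem covDeriv_eq_sum (A : V → V →L[ℝ] EndE) (Φ : V → EndE) (x v : V) :
    covDeriv A Φ x v = ∑ i, v i • covDeriv A Φ x (e i) := by
  have hv : v = ∑ i, v i • e i := by
    ext j
    simp [e, Pi.single_apply]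
  conv_lhs => rw [hv]
  simp only [covDeriv, map_sum, map_smul, Finset.sum_mul, Finset.mul_sum, smul_add, smul_sub,
    Finset.sum_add_distrib, Finset.sum_sub_distrib, smul_mul_assoc, mul_smul_comm]

theorem norm_covDeriv_sq_le (A : V → V →L[ℝ] EndE) (Φ : V → EndE) (x v : V) :
    ‖covDeriv A Φ x v‖ ^ 2 ≤ ‖v‖ ^ 2 * ∑ i, ‖covDeriv A Φ x (e i)‖ ^ 2 := by
  rw [covDeriv_eq_sum, EuclideanSpace.norm_sq_eq]
  calc ‖∑ i, v i • covDeriv A Φ x (e i)‖ ^ 2 ≤ (∑ i, ‖v i‖ * ‖covDeriv A Φ x (e i)‖) ^ 2 := by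
        refine pow_le_pow_left₀ (norm_nonneg _) ((norm_sum_le _ _).trans ?_) 2
        exact Finset.sum_le_sum fun i _ => (norm_smul _ _).le
    _ ≤ _ := Finset.sum_mul_sq_le_sq_mul_sq _ _ _

end

section

/-! ### Partial derivatives -/

section PartialDerivatives

variable {G : Type*} [NormedAddCommGroup G] [NormedSpace ℝ G]

/-- The partial derivative in the direction `e i`. -/
def pd (i : Fin 3) (f : V → G) (x : V) : G := fderiv ℝ f x (e i)

theorem pd_congr {i : Fin 3} {f g : V → G} {x : V} (h : f =ᶠ[𝓝 x] g) : pd i f x = pd i g x := by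
  rw [pd, pd, h.fderiv_eq]

theorem pd_const (i : Fin 3) (c : G) (x : V) : pd i (fun _ => c) x = 0 := by
  simp [pd]

theorem pd_add {i : Fin 3} {f g : V → G} {x : V} (hf : DifferentiableAt ℝ f x)
    (hg : DifferentiableAt ℝ g x) : pd i (fun y => f y + g y) x = pd i f x + pd i g x := by
  rw [pd, fderiv_fun_add hf hg]; rfl

theorem pd_sub {i : Fin 3} {f g : V → G} {x : V} (hf : DifferentiableAt ℝ f x)
    (hg : DifferentiableAt ℝ g x) : pd i (fun y => f y - g y) x = pd i f x - pd i g x := by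
  rw [pd, fderiv_fun_sub hf hg]; rfl

theorem pd_neg {i : Fin 3} {f : V → G} {x : V} : pd i (fun y => -f y) x = -pd i f x := by
  rw [pd, fderiv_fun_neg]; rfl

theorem pd_sum {ι : Type*} {s : Finset ι} {i : Fin 3} {f : ι → V → G} {x : V}
    (hf : ∀ j ∈ s, DifferentiableAt ℝ (f j) x) :
    pd i (fun y => ∑ j ∈ s, f j y) x = ∑ j ∈ s, pd i (f j) x := by
  rw [pd, fderiv_fun_sum hf]; simp [pd]

theorem pd_smul {i : Fin 3} {c : V → ℝ} {f : V → G} {x : V} (hc : DifferentiableAt ℝ c x)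
    (hf : DifferentiableAt ℝ f x) :
    pd i (fun y => c y • f y) x = c x • pd i f x + pd i c x • f x := by
  rw [pd, fderiv_fun_smul hc hf]; rfl

theorem pd_mul {i : Fin 3} {f g : V → ℝ} {x : V} (hf : DifferentiableAt ℝ f x)
    (hg : DifferentiableAt ℝ g x) : pd i (fun y => f y * g y) x = f x * pd i g x + g x * pd i f x := by
  rw [pd, fderiv_fun_mul hf hg]; rfl

theorem pd_mul_end {i : Fin 3} {f g : V → EndE} {x : V} (hf : DifferentiableAt ℝ f x)
    (hg : DifferentiableAt ℝ g x) : pd i (fun y => f y * g y) x = f x * pd i g x + pd i f x * g x := by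
  rw [pd, fderiv_fun_mul' hf hg]; rfl

theorem pd_clm {G' : Type*} [NormedAddCommGroup G'] [NormedSpace ℝ G'] {i : Fin 3} {f : V → G}
    {x : V} (T : G →L[ℝ] G') (hf : DifferentiableAt ℝ f x) :
    pd i (fun y => T (f y)) x = T (pd i f x) := by
  have h := (T.hasFDerivAt.comp x hf.hasFDerivAt).fderiv
  change fderiv ℝ (T ∘ f) x (e i) = _
  rw [h]; rfl

theorem pd_comm {i j : Fin 3} {f : V → G} {x : V} (hf : ContDiffAt ℝ 2 f x) :
    pd i (pd j f) x = pd j (pd i f) x := by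
  have hd : DifferentiableAt ℝ (fderiv ℝ f) x :=
    (hf.fderiv_right (m := 1) (by norm_num)).differentiableAt (by norm_num)
  have h : ∀ k l, pd k (pd l f) x = fderiv ℝ (fderiv ℝ f) x (e k) (e l) := by
    intro k l
    change fderiv ℝ (fun y => fderiv ℝ f y (e l)) x (e k) = _
    rw [fderiv_clm_apply hd (differentiableAt_const _)]
    simp
  rw [h, h]
  exact (hf.isSymmSndFDerivAt (by simp)).eq _ _

theorem _root_.ContDiffOn.pd {f : V → G} (hf : ContDiffOn ℝ ∞ f H3) (i : Fin 3) :
    ContDiffOn ℝ ∞ (pd i f) H3 :=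
  (hf.fderiv_of_isOpen isOpen_H3 (m := ∞) (by simp)).clm_apply contDiffOn_const

theorem _root_.ContDiffOn.differentiableAt_H3 {f : V → G} (hf : ContDiffOn ℝ ∞ f H3) {x : V}
    (hx : x ∈ H3) : DifferentiableAt ℝ f x :=
  (hf.contDiffAt (isOpen_H3.mem_nhds hx)).differentiableAt (by simp)

theorem _root_.ContDiffOn.contDiffAt_H3 {f : V → G} (hf : ContDiffOn ℝ ∞ f H3) {x : V}
    (hx : x ∈ H3) : ContDiffAt ℝ 2 f x :=
  (hf.contDiffAt (isOpen_H3.mem_nhds hx)).of_le ENat.LEInfty.out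

end PartialDerivatives

/-! ### The trace form -/

theorem abs_half_trace_le (X : EndE) :
    |-(1 / 2) * ∑ i : Fin 2, (X (EuclideanSpace.single i 1) i).re| ≤ 1 * ‖X‖ := by
  have h : ∀ i : Fin 2, |(X (EuclideanSpace.single i 1) i).re| ≤ ‖X‖ := fun i =>
    (Complex.abs_re_le_norm _).trans ((PiLp.norm_apply_le _ i).trans (by
      simpa using X.le_opNorm (EuclideanSpace.single i 1)))
  have h0 := abs_le.1 (h 0)
  have h1 := abs_le.1 (h 1)
  rw [Fin.sum_univ_two, abs_le]
  constructor <;> linarith [h0.1, h0.2, h1.1, h1.2]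

/-- `-1/2` of the real part of the trace. -/
def trL : EndE →L[ℝ] ℝ :=
  LinearMap.mkContinuous
    { toFun := fun X => -(1 / 2) * ∑ i : Fin 2, (X (EuclideanSpace.single i 1) i).re
      map_add' := fun X Y => by simp; ring
      map_smul' := fun r X => by simp; ring } 1 abs_half_trace_le

theorem trL_apply (X : EndE) :
    trL X = -(1 / 2) * ∑ i : Fin 2, (X (EuclideanSpace.single i 1) i).re := rfl

theorem trL_mul_comm (X Y : EndE) : trL (X * Y) = trL (Y * X) := by
  have h : ∀ X : EndE, trL X = -(1 / 2) * (LinearMap.trace ℂ E (X : E →ₗ[ℂ] E)).re := by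
    intro X
    rw [LinearMap.trace_eq_matrix_trace ℂ (EuclideanSpace.basisFun (Fin 2) ℂ).toBasis]
    simp [Matrix.trace, LinearMap.toMatrix_apply, trL_apply]
  rw [h, h, ContinuousLinearMap.toLinearMap_mul, ContinuousLinearMap.toLinearMap_mul, LinearMap.trace_mul_comm]

theorem abs_trL_le (X : EndE) : |trL X| ≤ ‖X‖ :=
  (abs_half_trace_le X).trans_eq (one_mul _)

theorem abs_trL_mul_le (X Y : EndE) : |trL (X * Y)| ≤ ‖X‖ * ‖Y‖ :=
  (abs_trL_le _).trans (norm_mul_le X Y)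

theorem IsSu2.trL_mul_self {X : EndE} (hX : IsSu2 X) : trL (X * X) = ‖X‖ ^ 2 := by
  rw [trL_apply]
  have h : ∀ i : Fin 2, ((X * X) (EuclideanSpace.single i 1) i).re = -‖X‖ ^ 2 := by
    intro i
    rw [mul_apply_eq_comp, hX.apply_apply, PiLp.smul_apply]
    simp
    norm_cast
  rw [Finset.sum_congr rfl fun i _ => h i]
  simp

theorem IsSu2.add {X Y : EndE} (hX : IsSu2 X) (hY : IsSu2 Y) : IsSu2 (X + Y) := by
  refine ⟨by rw [map_add, hX.1, hY.1, neg_add], ?_⟩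
  rw [ContinuousLinearMap.toLinearMap_add, map_add, hX.2, hY.2, add_zero]

theorem IsSu2.smul {X : EndE} (hX : IsSu2 X) (r : ℝ) : IsSu2 (r • X) := by
  have h : r • X = ((r : ℝ) : ℂ) • X := rfl
  rw [h]
  refine ⟨by rw [map_smulₛₗ, hX.1, Complex.conj_ofReal, smul_neg], ?_⟩
  rw [ContinuousLinearMap.toLinearMap_smul, map_smul, hX.2, smul_zero]

theorem IsSu2.commutator {X Y : EndE} (hX : IsSu2 X) (hY : IsSu2 Y) : IsSu2 (X * Y - Y * X) := by
  constructor
  · rw [map_sub]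
    have h : ∀ X Y : EndE, ContinuousLinearMap.adjoint (X * Y)
        = ContinuousLinearMap.adjoint Y * ContinuousLinearMap.adjoint X := fun X Y =>
      ContinuousLinearMap.adjoint_comp X Y
    rw [h, h, hX.1, hY.1, neg_mul_neg, neg_mul_neg, neg_sub]
  · rw [ContinuousLinearMap.toLinearMap_sub, map_sub, ContinuousLinearMap.toLinearMap_mul,
      ContinuousLinearMap.toLinearMap_mul, LinearMap.trace_mul_comm, sub_self]

theorem isClosed_isSu2 : IsClosed {X : EndE | IsSu2 X} := by
  refine IsClosed.inter (isClosed_eq (LinearIsometryEquiv.continuous _) continuous_neg)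
    (isClosed_eq ?_ continuous_const)
  exact ((LinearMap.trace ℂ E).comp
    (ContinuousLinearMap.coeLM ℂ : EndE →ₗ[ℂ] (E →ₗ[ℂ] E))).continuous_of_finiteDimensional

/-- Difference quotients lie in `su(2)`, which is a closed real subspace. -/
theorem IsSu2.pd {X : V → EndE} (hX : ∀ x ∈ H3, IsSu2 (X x)) {x : V} (hx : x ∈ H3)
    (hd : DifferentiableAt ℝ X x) (i : Fin 3) : IsSu2 (pd i X x) := by
  have h1 : HasDerivAt (fun t : ℝ => X (x + t • e i)) (HypMonopole.pd i X x) 0 := by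
    have h2 : HasDerivAt (fun t : ℝ => x + t • e i) (e i) 0 := by
      simpa using ((hasDerivAt_id (0 : ℝ)).smul_const (e i)).const_add x
    refine HasFDerivAt.comp_hasDerivAt (l := X) (l' := fderiv ℝ X x) 0 ?_ h2
    simpa using hd.hasFDerivAt
  have h3 := h1.tendsto_slope_zero
  have hc : Tendsto (fun t : ℝ => x + (0 + t) • e i) (𝓝[≠] 0) (𝓝 x) := by
    have : Continuous fun t : ℝ => x + (0 + t) • e i := by fun_prop
    have h4 := this.tendsto 0
    simp only [add_zero, zero_smul] at h4
    exact h4.mono_left nhdsWithin_le_nhds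
  refine isClosed_isSu2.mem_of_tendsto h3 ?_
  filter_upwards [hc.eventually (isOpen_H3.mem_nhds hx)] with t ht
  have h5 : IsSu2 (X (x + (0 : ℝ) • e i)) := by simpa using hX x hx
  rw [sub_eq_add_neg, ← neg_one_smul ℝ (X (x + (0 : ℝ) • e i))]
  exact ((hX _ ht).add (h5.smul _)).smul _

end

section

variable {m : ℝ} (M : HyperbolicMonopole m)

/-! ### Covariant calculus -/

/-- The components of the connection. -/
def conn (i : Fin 3) (x : V) : EndE := M.A x (e i)

/-- The covariant derivative in the direction `e i`. -/
def covD (i : Fin 3) (X : V → EndE) (x : V) : EndE :=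
  pd i X x + (conn M i x * X x - X x * conn M i x)

/-- The covariant derivative of the Higgs field. -/
def higgsD (i : Fin 3) : V → EndE := covD M i M.Φ

/-- The components of the curvature. -/
def curvF (i j : Fin 3) (x : V) : EndE := curv M.A x (e i) (e j)

theorem covDeriv_eq_higgsD (i : Fin 3) (x : V) : covDeriv M.A M.Φ x (e i) = higgsD M i x := rfl

theorem smooth_conn (i : Fin 3) : ContDiffOn ℝ ∞ (conn M i) H3 :=
  M.smooth_A.clm_apply contDiffOn_const

variable {M}

theorem _root_.ContDiffOn.covD {X : V → EndE} (hX : ContDiffOn ℝ ∞ X H3) (i : Fin 3) :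
    ContDiffOn ℝ ∞ (covD M i X) H3 :=
  (hX.pd i).add (((smooth_conn M i).mul hX).sub (hX.mul (smooth_conn M i)))

variable (M)

theorem smooth_higgsD (i : Fin 3) : ContDiffOn ℝ ∞ (higgsD M i) H3 :=
  ContDiffOn.covD M.smooth_Φ i

theorem curvF_eq (i j : Fin 3) {x : V} (hx : x ∈ H3) :
    curvF M i j x = pd i (conn M j) x - pd j (conn M i) x
      + (conn M i x * conn M j x - conn M j x * conn M i x) := by
  have h : ∀ k l, pd k (conn M l) x = fderiv ℝ M.A x (e k) (e l) := by
    intro k l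
    change fderiv ℝ (fun y => M.A y (e l)) x (e k) = _
    rw [fderiv_clm_apply (M.smooth_A.differentiableAt_H3 hx) (differentiableAt_const _)]
    simp
  rw [h, h]; rfl

theorem smooth_curvF (i j : Fin 3) : ContDiffOn ℝ ∞ (curvF M i j) H3 := by
  refine ContDiffOn.congr (f := fun x => pd i (conn M j) x - pd j (conn M i) x
      + (conn M i x * conn M j x - conn M j x * conn M i x)) ?_ fun x hx => curvF_eq M i j hx
  have hi := smooth_conn M i
  have hj := smooth_conn M j
  exact ((hj.pd i).sub (hi.pd j)).add ((hi.mul hj).sub (hj.mul hi))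

theorem covD_congr {i : Fin 3} {X Y : V → EndE} (h : ∀ y ∈ H3, X y = Y y) {x : V} (hx : x ∈ H3) :
    covD M i X x = covD M i Y x := by
  rw [covD, covD, h x hx, pd_congr (Filter.eventuallyEq_of_mem (isOpen_H3.mem_nhds hx) h)]

theorem covD_add {i : Fin 3} {X Y : V → EndE} {x : V} (hX : DifferentiableAt ℝ X x)
    (hY : DifferentiableAt ℝ Y x) :
    covD M i (fun y => X y + Y y) x = covD M i X x + covD M i Y x := by
  simp only [covD, pd_add hX hY, mul_add, add_mul]
  abel

theorem covD_sum {ι : Type*} {s : Finset ι} {i : Fin 3} {X : ι → V → EndE} {x : V}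
    (hX : ∀ j ∈ s, DifferentiableAt ℝ (X j) x) :
    covD M i (fun y => ∑ j ∈ s, X j y) x = ∑ j ∈ s, covD M i (X j) x := by
  simp only [covD, pd_sum hX, Finset.sum_add_distrib, Finset.sum_sub_distrib, Finset.sum_mul,
    Finset.mul_sum]

theorem covD_smul {i : Fin 3} {c : V → ℝ} {X : V → EndE} {x : V} (hc : DifferentiableAt ℝ c x)
    (hX : DifferentiableAt ℝ X x) :
    covD M i (fun y => c y • X y) x = c x • covD M i X x + pd i c x • X x := by
  simp only [covD, pd_smul hc hX, mul_smul_comm, smul_mul_assoc, smul_add, smul_sub]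
  abel

theorem covD_commutator {i : Fin 3} {X Y : V → EndE} {x : V} (hX : DifferentiableAt ℝ X x)
    (hY : DifferentiableAt ℝ Y x) :
    covD M i (fun y => X y * Y y - Y y * X y) x
      = (covD M i X x * Y x - Y x * covD M i X x) + (X x * covD M i Y x - covD M i Y x * X x) := by
  simp only [covD, pd_sub (hX.fun_mul hY) (hY.fun_mul hX), pd_mul_end hX hY, pd_mul_end hY hX, mul_add,
    add_mul, mul_sub, sub_mul, mul_assoc]
  abel

/-- The commutator of covariant derivatives is the curvature. -/
theorem covD_covD_sub {i j : Fin 3} {X : V → EndE} (hX : ContDiffOn ℝ ∞ X H3) {x : V}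
    (hx : x ∈ H3) : covD M i (covD M j X) x - covD M j (covD M i X) x
      = curvF M i j x * X x - X x * curvF M i j x := by
  have hXd := hX.differentiableAt_H3 hx
  have hc : ∀ k, DifferentiableAt ℝ (conn M k) x := fun k =>
    (smooth_conn M k).differentiableAt_H3 hx
  have h : ∀ k l, pd k (covD M l X) x = pd k (pd l X) x + ((conn M l x * pd k X x
      + pd k (conn M l) x * X x) - (X x * pd k (conn M l) x + pd k X x * conn M l x)) := by
    intro k l
    change pd k (fun y => pd l X y + (conn M l y * X y - X y * conn M l y)) x = _
    rw [pd_add ((hX.pd l).differentiableAt_H3 hx) (((hc l).fun_mul hXd).fun_sub (hXd.fun_mul (hc l))),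
      pd_sub ((hc l).fun_mul hXd) (hXd.fun_mul (hc l)), pd_mul_end (hc l) hXd, pd_mul_end hXd (hc l)]
  have h2 : ∀ k l, covD M k (covD M l X) x = pd k (covD M l X) x
      + (conn M k x * covD M l X x - covD M l X x * conn M k x) := fun _ _ => rfl
  rw [h2, h2, h, h, curvF_eq M i j hx, pd_comm (i := j) (j := i) (hX.contDiffAt_H3 hx)]
  simp only [covD, mul_add, add_mul, mul_sub, sub_mul, mul_assoc]
  abel

/-- The Bianchi identity. -/
theorem bianchi {x : V} (hx : x ∈ H3) :
    covD M 0 (curvF M 1 2) x + covD M 1 (curvF M 2 0) x + covD M 2 (curvF M 0 1) x = 0 := by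
  have hc : ∀ k, DifferentiableAt ℝ (conn M k) x := fun k =>
    (smooth_conn M k).differentiableAt_H3 hx
  have hp : ∀ k l, DifferentiableAt ℝ (pd k (conn M l)) x := fun k l =>
    ((smooth_conn M l).pd k).differentiableAt_H3 hx
  have h : ∀ k i j, pd k (curvF M i j) x = pd k (pd i (conn M j)) x - pd k (pd j (conn M i)) x
      + ((conn M i x * pd k (conn M j) x + pd k (conn M i) x * conn M j x)
        - (conn M j x * pd k (conn M i) x + pd k (conn M j) x * conn M i x)) := by
    intro k i j
    rw [pd_congr (Filter.eventuallyEq_of_mem (isOpen_H3.mem_nhds hx)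
      fun y hy => curvF_eq M i j hy),
      pd_add ((hp i j).fun_sub (hp j i)) (((hc i).fun_mul (hc j)).fun_sub ((hc j).fun_mul (hc i))),
      pd_sub (hp i j) (hp j i), pd_sub ((hc i).fun_mul (hc j)) ((hc j).fun_mul (hc i)),
      pd_mul_end (hc i) (hc j), pd_mul_end (hc j) (hc i)]
  have hcomm : ∀ k i j, pd k (pd i (conn M j)) x = pd i (pd k (conn M j)) x := fun k i j =>
    pd_comm ((smooth_conn M j).contDiffAt_H3 hx)
  simp only [covD, h, curvF_eq M _ _ hx]
  -- Once mixed second derivatives are identified they cancel in pairs; the triple products cancel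
  -- by the Jacobi identity.
  rw [hcomm 1 0, hcomm 2 0, hcomm 2 1]
  simp only [mul_add, add_mul, mul_sub, sub_mul, mul_assoc]
  abel

/-- The Leibniz rule for the trace form. -/
theorem pd_trL_mul {i : Fin 3} {X Y : V → EndE} {x : V} (hX : DifferentiableAt ℝ X x)
    (hY : DifferentiableAt ℝ Y x) :
    pd i (fun y => trL (X y * Y y)) x = trL (covD M i X x * Y x) + trL (X x * covD M i Y x) := by
  rw [pd_clm trL (hX.fun_mul hY), pd_mul_end hX hY]
  have h1 := trL_mul_comm (conn M i x) (X x * Y x)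
  simp only [covD, mul_add, add_mul, mul_sub, sub_mul, map_add, map_sub, mul_assoc] at h1 ⊢
  linarith

theorem IsSu2.covD {X : V → EndE} (hX : ContDiffOn ℝ ∞ X H3) (hs : ∀ x ∈ H3, IsSu2 (X x))
    (i : Fin 3) {x : V} (hx : x ∈ H3) : IsSu2 (covD M i X x) :=
  (IsSu2.pd hs hx (hX.differentiableAt_H3 hx) i).add ((M.su2_A x hx (e i)).commutator (hs x hx))

theorem isSu2_higgsD (i : Fin 3) {x : V} (hx : x ∈ H3) : IsSu2 (higgsD M i x) :=
  IsSu2.covD M M.smooth_Φ M.su2_Φ i hx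

/-! ### The conformal factor -/

theorem one_sub_norm_sq_pos {x : V} (hx : x ∈ H3) : 0 < 1 - ‖x‖ ^ 2 := by
  rw [H3, mem_ball_zero_iff] at hx
  have := norm_nonneg x
  nlinarith

theorem conf_pos {x : V} (hx : x ∈ H3) : 0 < conf x := div_pos two_pos (one_sub_norm_sq_pos hx)

theorem two_le_conf {x : V} (hx : x ∈ H3) : 2 ≤ conf x := by
  rw [conf, le_div_iff₀ (one_sub_norm_sq_pos hx)]
  nlinarith [sq_nonneg ‖x‖]

theorem inner_e (x : V) (i : Fin 3) : inner ℝ x (e i) = x i := by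
  simp [e, EuclideanSpace.inner_single_right]

theorem abs_coord_le (x : V) (i : Fin 3) : |x i| ≤ ‖x‖ := PiLp.norm_apply_le x i

theorem abs_coord_le_one {x : V} (hx : x ∈ H3) (i : Fin 3) : |x i| ≤ 1 :=
  (abs_coord_le x i).trans (mem_ball_zero_iff.1 hx).le

theorem norm_sq_eq_sum (x : V) : ‖x‖ ^ 2 = ∑ i, x i ^ 2 := by
  rw [EuclideanSpace.norm_sq_eq]; simp

theorem contDiff_coord (i : Fin 3) : ContDiff ℝ ∞ fun x : V => x i := by fun_prop

theorem pd_coord (i j : Fin 3) (x : V) : pd i (fun y : V => y j) x = if i = j then 1 else 0 := by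
  have h : (fun y : V => y j) = fun y => inner ℝ (e j) y := by
    funext y; rw [real_inner_comm, inner_e]
  have h2 : HasFDerivAt (fun y : V => inner ℝ (e j) y) (innerSL ℝ (e j)) x :=
    (innerSL ℝ (e j)).hasFDerivAt
  rw [pd, h, h2.fderiv, innerSL_apply_apply, inner_e]
  simp [e, PiLp.single_apply]

theorem pd_norm_sub_sq (i : Fin 3) (a x : V) : pd i (fun y => ‖y - a‖ ^ 2) x = 2 * (x i - a i) := by
  have h := ((hasFDerivAt_id x).sub_const a).norm_sq
  rw [pd]
  simp only [id] at h
  rw [h.fderiv]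
  simp [inner_e]

theorem pd_norm_sq (i : Fin 3) (x : V) : pd i (fun y => ‖y‖ ^ 2) x = 2 * x i := by
  simpa using pd_norm_sub_sq i 0 x

theorem contDiff_norm_sub_sq (a : V) : ContDiff ℝ ∞ fun y : V => ‖y - a‖ ^ 2 :=
  (contDiff_id.sub contDiff_const).norm_sq ℝ

theorem contDiff_one_sub_norm_sq : ContDiff ℝ ∞ fun y : V => 1 - ‖y‖ ^ 2 :=
  contDiff_const.sub (contDiff_id.norm_sq ℝ)

theorem smooth_conf : ContDiffOn ℝ ∞ conf H3 :=
  contDiffOn_const.div contDiff_one_sub_norm_sq.contDiffOn fun _ hx => (one_sub_norm_sq_pos hx).ne'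

theorem pd_inv {i : Fin 3} {f : V → ℝ} {x : V} (hf : DifferentiableAt ℝ f x) (h0 : f x ≠ 0) :
    pd i (fun y => (f y)⁻¹) x = -pd i f x / f x ^ 2 := by
  have h := (hasDerivAt_inv h0).comp_hasFDerivAt x hf.hasFDerivAt
  change fderiv ℝ (Inv.inv ∘ f) x (e i) = _
  rw [h.fderiv]
  simp [pd]
  ring

theorem pd_conf (i : Fin 3) {x : V} (hx : x ∈ H3) : pd i conf x = conf x ^ 2 * x i := by
  have hd : DifferentiableAt ℝ (fun y : V => 1 - ‖y‖ ^ 2) x :=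
    (contDiff_one_sub_norm_sq.differentiable (by simp)).differentiableAt
  have h0 := (one_sub_norm_sq_pos hx).ne'
  have h1 : pd i (fun y : V => 1 - ‖y‖ ^ 2) x = -(2 * x i) := by
    have h2 : DifferentiableAt ℝ (fun y : V => ‖y‖ ^ 2) x :=
      ((contDiff_id.norm_sq ℝ).differentiable (n := ∞) (by simp)).differentiableAt
    rw [pd_sub (differentiableAt_const _) h2, pd_const, zero_sub, pd_norm_sq]
  change pd i (fun y => 2 / (1 - ‖y‖ ^ 2)) x = _
  simp only [div_eq_mul_inv]
  rw [pd_mul (differentiableAt_const _) (hd.fun_inv h0), pd_const, pd_inv hd h0, h1, conf]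
  field_simp
  ring

/-- The drift coefficient `b i = ∂ i (log conf)`. -/
def drift (i : Fin 3) (x : V) : ℝ := conf x * x i

theorem smooth_drift (i : Fin 3) : ContDiffOn ℝ ∞ (drift i) H3 :=
  smooth_conf.mul (contDiff_coord i).contDiffOn

theorem pd_drift (i j : Fin 3) {x : V} (hx : x ∈ H3) :
    pd i (drift j) x = conf x * (if i = j then 1 else 0) + conf x ^ 2 * x i * x j := by
  change pd i (fun y => conf y * y j) x = _
  rw [pd_mul (smooth_conf.differentiableAt_H3 hx)
    ((contDiff_coord j).differentiable (by simp)).differentiableAt, pd_coord, pd_conf i hx]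
  ring

theorem abs_drift_le (i : Fin 3) {x : V} (hx : x ∈ H3) : |drift i x| ≤ conf x := by
  rw [drift, abs_mul, abs_of_pos (conf_pos hx)]
  exact mul_le_of_le_one_right (conf_pos hx).le (abs_coord_le_one hx i)

theorem abs_pd_conf_le (i : Fin 3) {x : V} (hx : x ∈ H3) : |pd i conf x| ≤ conf x ^ 2 := by
  rw [pd_conf i hx, abs_mul, abs_of_pos (pow_pos (conf_pos hx) 2)]
  exact mul_le_of_le_one_right (pow_pos (conf_pos hx) 2).le (abs_coord_le_one hx i)

theorem abs_pd_drift_le (i j : Fin 3) {x : V} (hx : x ∈ H3) :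
    |pd i (drift j) x| ≤ 2 * conf x ^ 2 := by
  rw [pd_drift i j hx]
  have h2 := two_le_conf hx
  have h3 : |x i * x j| ≤ 1 := by
    rw [abs_mul]
    exact mul_le_one₀ (abs_coord_le_one hx i) (abs_nonneg _) (abs_coord_le_one hx j)
  have h4 : |conf x * (if i = j then (1 : ℝ) else 0)| ≤ conf x ^ 2 := by
    split_ifs
    · rw [mul_one, abs_of_pos (conf_pos hx)]; nlinarith
    · rw [mul_zero, abs_zero]; positivity
  have h5 : |conf x ^ 2 * x i * x j| ≤ conf x ^ 2 := by
    rw [mul_assoc, abs_mul, abs_of_pos (pow_pos (conf_pos hx) 2)]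
    exact mul_le_of_le_one_right (by positivity) h3
  linarith [abs_add_le (conf x * (if i = j then (1 : ℝ) else 0)) (conf x ^ 2 * x i * x j)]

end

section

variable {m : ℝ} (M : HyperbolicMonopole m)

/-! ### The Bogomolny equation and its consequences -/

theorem end_neg_mul (X Y : EndE) : -X * Y = -(X * Y) := neg_mul X Y
theorem end_zero_smul (X : EndE) : (0 : ℝ) • X = 0 := zero_smul ℝ X
theorem end_neg_smul (r : ℝ) (X : EndE) : (-r) • X = -(r • X) := neg_smul r X
theorem end_smul_eq_zero {r : ℝ} {X : EndE} (hr : r ≠ 0) (h : r • X = 0) : X = 0 :=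
  (smul_eq_zero.1 h).resolve_left hr
theorem end_smul_add (r : ℝ) (X Y : EndE) : r • (X + Y) = r • X + r • Y := smul_add r X Y

theorem curvF_add_one_add_two (i : Fin 3) {x : V} (hx : x ∈ H3) :
    curvF M (i + 1) (i + 2) x = conf x • higgsD M i x := by
  have h := M.bogomolny x hx i
  rw [covDeriv_eq_higgsD, hodge] at h
  rw [h, smul_inv_smul₀ (conf_pos hx).ne']
  rfl

theorem curvF_antisymm (i j : Fin 3) (x : V) : curvF M i j x = -curvF M j i x := by
  simp only [curvF, curv]
  abel

/-- Only the size and the conformal weight of the curvature matter in the estimates, so sign and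
index are left unspecified. -/
theorem exists_curvF_eq (i j : Fin 3) : ∃ (ε : ℝ) (l : Fin 3), |ε| ≤ 1 ∧
    ∀ x ∈ H3, curvF M i j x = (ε * conf x) • higgsD M l x := by
  have h0 : ∀ i, ∃ (ε : ℝ) (l : Fin 3), |ε| ≤ 1 ∧
      ∀ x ∈ H3, curvF M i i x = (ε * conf x) • higgsD M l x := fun i =>
    ⟨0, 0, by simp, fun x hx => by
      rw [zero_mul, end_zero_smul]; simp only [curvF, curv]; abel⟩
  have h1 : ∀ i, ∃ (ε : ℝ) (l : Fin 3), |ε| ≤ 1 ∧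
      ∀ x ∈ H3, curvF M (i + 1) (i + 2) x = (ε * conf x) • higgsD M l x := fun i =>
    ⟨1, i, by simp, fun x hx => by rw [curvF_add_one_add_two M i hx, one_mul]⟩
  have h2 : ∀ i, ∃ (ε : ℝ) (l : Fin 3), |ε| ≤ 1 ∧
      ∀ x ∈ H3, curvF M (i + 2) (i + 1) x = (ε * conf x) • higgsD M l x := fun i =>
    ⟨-1, i, by simp, fun x hx => by
      rw [curvF_antisymm, curvF_add_one_add_two M i hx, neg_one_mul, end_neg_smul]⟩
  fin_cases i <;> fin_cases j
  · exact h0 0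
  · exact h1 2
  · exact h2 1
  · exact h2 2
  · exact h0 1
  · exact h1 0
  · exact h1 1
  · exact h2 0
  · exact h0 2

/-- This is the Bianchi identity with the curvature replaced by `conf • d_A Φ`; the derivative of
the conformal factor gives the drift. Geometrically it says `d_A^* d_A Φ = 0` for the hyperbolic
metric. -/
theorem sum_covD_higgsD {x : V} (hx : x ∈ H3) :
    ∑ i, covD M i (higgsD M i) x = -∑ i, drift i x • higgsD M i x := by
  have hb := bianchi M hx
  have h : ∀ i, covD M i (curvF M (i + 1) (i + 2)) x
      = conf x • (covD M i (higgsD M i) x + drift i x • higgsD M i x) := by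
    intro i
    rw [covD_congr M (fun y hy => curvF_add_one_add_two M i hy) hx,
      covD_smul M (smooth_conf.differentiableAt_H3 hx) ((smooth_higgsD M i).differentiableAt_H3 hx),
      pd_conf i hx, smul_add, smul_smul, drift]
    congr 2
    ring
  have h0 := h 0
  have h1 := h 1
  have h2 := h 2
  have e0 : covD M 0 (curvF M 1 2) x = covD M 0 (curvF M (0 + 1) (0 + 2)) x := rfl
  have e1 : covD M 1 (curvF M 2 0) x = covD M 1 (curvF M (1 + 1) (1 + 2)) x := rfl
  have e2 : covD M 2 (curvF M 0 1) x = covD M 2 (curvF M (2 + 1) (2 + 2)) x := rfl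
  rw [e0, e1, e2, h0, h1, h2, ← end_smul_add, ← end_smul_add] at hb
  rw [Fin.sum_univ_three, Fin.sum_univ_three, eq_neg_iff_add_eq_zero,
    ← end_smul_eq_zero (conf_pos hx).ne' hb]
  abel

/-- The hyperbolic Laplacian, up to the factor `conf ^ 2`. -/
def lapL (f : V → ℝ) (x : V) : ℝ := ∑ i, pd i (pd i f) x + ∑ i, drift i x * pd i f x

/-- The square of the norm of the Higgs field. -/
def higgsSq (x : V) : ℝ := trL (M.Φ x * M.Φ x)

/-- The Euclidean energy density of the Higgs field. -/
def gradSq (x : V) : ℝ := ∑ i, trL (higgsD M i x * higgsD M i x)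

/-- The square of the norm of the second covariant derivative. -/
def hessSq (x : V) : ℝ := ∑ k, ∑ i, ‖covD M i (higgsD M k) x‖ ^ 2

theorem higgsSq_eq {x : V} (hx : x ∈ H3) : higgsSq M x = ‖M.Φ x‖ ^ 2 := (M.su2_Φ x hx).trL_mul_self

theorem gradSq_eq {x : V} (hx : x ∈ H3) : gradSq M x = ∑ i, ‖higgsD M i x‖ ^ 2 :=
  Finset.sum_congr rfl fun i _ => (isSu2_higgsD M i hx).trL_mul_self

theorem smooth_trL_mul {X Y : V → EndE} (hX : ContDiffOn ℝ ∞ X H3) (hY : ContDiffOn ℝ ∞ Y H3) :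
    ContDiffOn ℝ ∞ (fun x => trL (X x * Y x)) H3 := trL.contDiff.comp_contDiffOn (hX.mul hY)

theorem smooth_higgsSq : ContDiffOn ℝ ∞ (higgsSq M) H3 := smooth_trL_mul M.smooth_Φ M.smooth_Φ

theorem smooth_gradSq : ContDiffOn ℝ ∞ (gradSq M) H3 :=
  ContDiffOn.sum fun i _ => smooth_trL_mul (smooth_higgsD M i) (smooth_higgsD M i)

theorem pd_trL_sq {X : V → EndE} (hX : ContDiffOn ℝ ∞ X H3) (i : Fin 3) {x : V} (hx : x ∈ H3) :
    pd i (fun y => trL (X y * X y)) x = 2 * trL (covD M i X x * X x) := by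
  have h := hX.differentiableAt_H3 hx
  rw [pd_trL_mul M h h, trL_mul_comm (X x)]
  ring

theorem pd_pd_trL_sq {X : V → EndE} (hX : ContDiffOn ℝ ∞ X H3) (i : Fin 3) {x : V} (hx : x ∈ H3) :
    pd i (pd i (fun y => trL (X y * X y))) x
      = 2 * (trL (covD M i (covD M i X) x * X x) + trL (covD M i X x * covD M i X x)) := by
  rw [pd_congr (Filter.eventuallyEq_of_mem (isOpen_H3.mem_nhds hx)
    fun y hy => pd_trL_sq M hX i hy),
    pd_mul (differentiableAt_const _)
      ((smooth_trL_mul (hX.covD i) hX).differentiableAt_H3 hx), pd_const,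
    pd_trL_mul M ((hX.covD i).differentiableAt_H3 hx) (hX.differentiableAt_H3 hx)]
  ring

theorem lapL_trL_sq {X : V → EndE} (hX : ContDiffOn ℝ ∞ X H3) {x : V} (hx : x ∈ H3) :
    lapL (fun y => trL (X y * X y)) x = 2 * (trL ((∑ i, covD M i (covD M i X) x) * X x)
      + ∑ i, trL (covD M i X x * covD M i X x) + ∑ i, drift i x * trL (covD M i X x * X x)) := by
  simp only [lapL, pd_pd_trL_sq M hX _ hx, pd_trL_sq M hX _ hx, Finset.sum_mul, map_sum]
  simp only [Fin.sum_univ_three]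
  ring

/-- The rough Laplacian of `Φ` cancels the drift term, leaving only the gradient; in particular
`|Φ|²` is subharmonic. -/
theorem lapL_higgsSq {x : V} (hx : x ∈ H3) : lapL (higgsSq M) x = 2 * gradSq M x := by
  change lapL (fun y => trL (M.Φ y * M.Φ y)) x = _
  rw [lapL_trL_sq M M.smooth_Φ hx]
  change 2 * (trL ((∑ i, covD M i (higgsD M i) x) * M.Φ x)
      + ∑ i, trL (higgsD M i x * higgsD M i x) + ∑ i, drift i x * trL (higgsD M i x * M.Φ x)) = _
  rw [sum_covD_higgsD M hx, end_neg_mul, map_neg, Finset.sum_mul, map_sum, gradSq]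
  simp only [smul_mul_assoc, map_smul, smul_eq_mul]
  ring

theorem norm_commutator_le (X Y : EndE) : ‖X * Y - Y * X‖ ≤ 2 * (‖X‖ * ‖Y‖) := by
  have h1 := norm_sub_le (X * Y) (Y * X)
  have h2 := norm_mul_le X Y
  have h3 := norm_mul_le Y X
  linarith

/-- A crude bound for the rough Laplacian of the derivative of the Higgs field. -/
theorem norm_roughLap_le (k : Fin 3) {x : V} (hx : x ∈ H3) {p q : ℝ}
    (hp : ∀ l, ‖higgsD M l x‖ ≤ p) (hq : ∀ i l, ‖covD M i (higgsD M l) x‖ ≤ q)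
    (hΦ : ‖M.Φ x‖ ≤ m) :
    ‖∑ j, covD M j (covD M j (higgsD M k)) x‖
      ≤ (12 + 6 * m) * (conf x ^ 2 * p + conf x * q + conf x * p ^ 2) := by
  have hc := (conf_pos hx).le
  have hp0 : 0 ≤ p := (norm_nonneg _).trans (hp 0)
  have hq0 : 0 ≤ q := (norm_nonneg _).trans (hq 0 0)
  have hm0 : 0 ≤ m := (norm_nonneg _).trans hΦ
  have hF : ∀ i j, ‖curvF M i j x‖ ≤ conf x * p := by
    intro i j
    obtain ⟨ε, l, hε, h⟩ := exists_curvF_eq M i j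
    rw [h x hx, norm_smul, norm_mul, Real.norm_eq_abs, Real.norm_of_nonneg hc]
    have := hp l
    calc |ε| * conf x * ‖higgsD M l x‖ ≤ 1 * conf x * p := by gcongr
      _ = _ := by ring
  have hDF : ∀ n i j, ‖covD M n (curvF M i j) x‖ ≤ conf x ^ 2 * p + conf x * q := by
    intro n i j
    obtain ⟨ε, l, hε, h⟩ := exists_curvF_eq M i j
    have h1 : covD M n (curvF M i j) x
        = (ε * conf x) • covD M n (higgsD M l) x + (ε * pd n conf x) • higgsD M l x := by
      rw [covD_congr M h hx, covD_smul M
        ((differentiableAt_const ε).fun_mul (smooth_conf.differentiableAt_H3 hx))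
        ((smooth_higgsD M l).differentiableAt_H3 hx),
        pd_mul (differentiableAt_const ε) (smooth_conf.differentiableAt_H3 hx), pd_const]
      simp
    rw [h1]
    refine (norm_add_le _ _).trans ?_
    rw [norm_smul, norm_smul, norm_mul, norm_mul, Real.norm_eq_abs, Real.norm_of_nonneg hc,
      Real.norm_eq_abs]
    have h2 := hp l
    have h3 := hq n l
    have h4 := abs_pd_conf_le n hx
    calc |ε| * conf x * ‖covD M n (higgsD M l) x‖ + |ε| * |pd n conf x| * ‖higgsD M l x‖
        ≤ 1 * conf x * q + 1 * conf x ^ 2 * p := by gcongr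
      _ = _ := by ring
  have hΨs : ∀ l, ContDiffOn ℝ ∞ (higgsD M l) H3 := smooth_higgsD M
  have hΨd : ∀ l, DifferentiableAt ℝ (higgsD M l) x := fun l => (hΨs l).differentiableAt_H3 hx
  have hFd : ∀ i j, DifferentiableAt ℝ (curvF M i j) x := fun i j =>
    (smooth_curvF M i j).differentiableAt_H3 hx
  have hΦd := M.smooth_Φ.differentiableAt_H3 hx
  -- A Weitzenböck argument. Exchanging `j` and `k` here, and the two outer derivatives in `hterm`,
  -- turns the rough Laplacian into the derivative of a divergence plus curvature terms. The
  -- divergence is then first order by `sum_covD_higgsD`.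
  have hswap : ∀ j, ∀ y ∈ H3, covD M j (higgsD M k) y
      = covD M k (higgsD M j) y + (curvF M j k y * M.Φ y - M.Φ y * curvF M j k y) := by
    intro j y hy
    rw [← covD_covD_sub M M.smooth_Φ hy]
    simp only [higgsD]
    abel
  have hterm : ∀ j, covD M j (covD M j (higgsD M k)) x
      = covD M k (covD M j (higgsD M j)) x
        + (curvF M j k x * higgsD M j x - higgsD M j x * curvF M j k x)
        + ((covD M j (curvF M j k) x * M.Φ x - M.Φ x * covD M j (curvF M j k) x)
        + (curvF M j k x * higgsD M j x - higgsD M j x * curvF M j k x)) := by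
    intro j
    rw [covD_congr M (hswap j) hx, covD_add M (((hΨs j).covD k).differentiableAt_H3 hx)
      (((hFd j k).fun_mul hΦd).fun_sub (hΦd.fun_mul (hFd j k))),
      covD_commutator M (hFd j k) hΦd, sub_eq_iff_eq_add'.1 (covD_covD_sub M (hΨs j) hx)]
    rfl
  have hdiv : ∑ j, covD M k (covD M j (higgsD M j)) x
      = -∑ j, (drift j x • covD M k (higgsD M j) x + pd k (drift j) x • higgsD M j x) := by
    rw [← covD_sum M fun j _ => ((hΨs j).covD j).differentiableAt_H3 hx,
      covD_congr M (Y := fun y => ∑ j, (-drift j y) • higgsD M j y)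
      (fun y hy => by 
        rw [sum_covD_higgsD M hy, ← Finset.sum_neg_distrib]
        exact Finset.sum_congr rfl fun j _ => (end_neg_smul _ _).symm) hx]
    have hb : ∀ j, DifferentiableAt ℝ (drift j) x := fun j => (smooth_drift j).differentiableAt_H3 hx
    rw [covD_sum M fun j _ => (hb j).fun_neg.fun_smul (hΨd j), ← Finset.sum_neg_distrib]
    refine Finset.sum_congr rfl fun j _ => ?_
    rw [covD_smul M (hb j).fun_neg (hΨd j), pd_neg]
    rw [end_neg_smul, end_neg_smul, neg_add]
  simp only [hterm, Finset.sum_add_distrib]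
  rw [hdiv]
  have hb1 : ‖-∑ j, (drift j x • covD M k (higgsD M j) x + pd k (drift j) x • higgsD M j x)‖
      ≤ ∑ _j : Fin 3, (conf x * q + 2 * conf x ^ 2 * p) := by
    rw [norm_neg]
    refine norm_sum_le_of_le _ fun j _ => (norm_add_le _ _).trans ?_
    rw [norm_smul, norm_smul, Real.norm_eq_abs, Real.norm_eq_abs]
    have h1 := abs_drift_le j hx
    have h2 := abs_pd_drift_le k j hx
    have h3 := hq k j
    have h4 := hp j
    gcongr
  have hb2 : ‖∑ j, (curvF M j k x * higgsD M j x - higgsD M j x * curvF M j k x)‖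
      ≤ ∑ _j : Fin 3, 2 * (conf x * p * p) := by
    refine norm_sum_le_of_le _ fun j _ => (norm_commutator_le _ _).trans ?_
    have h1 := hF j k
    have h2 := hp j
    gcongr
  have hb3 : ‖∑ j, (covD M j (curvF M j k) x * M.Φ x - M.Φ x * covD M j (curvF M j k) x)‖
      ≤ ∑ _j : Fin 3, 2 * ((conf x ^ 2 * p + conf x * q) * m) := by
    refine norm_sum_le_of_le _ fun j _ => (norm_commutator_le _ _).trans ?_
    have h1 := hDF j j k
    gcongr
  refine (norm_add_le _ _).trans ((add_le_add ((norm_add_le _ _).trans (add_le_add hb1 hb2))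
    ((norm_add_le _ _).trans (add_le_add hb3 hb2))).trans ?_)
  simp only [Fin.sum_univ_three]
  have t1 : 0 ≤ conf x ^ 2 * p := by positivity
  have t2 : 0 ≤ conf x * q := by positivity
  have t3 : 0 ≤ conf x * p ^ 2 := by positivity
  nlinarith [mul_nonneg hm0 t3]

end

section

/-! ### Calculus of the Laplacian -/

section Laplacian

variable {f g : V → ℝ} {x : V}

theorem pd_congr_H3 {G : Type*} [NormedAddCommGroup G] [NormedSpace ℝ G] {f g : V → G} {i : Fin 3}
    (h : ∀ y ∈ H3, f y = g y) (hx : x ∈ H3) : pd i f x = pd i g x :=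
  pd_congr (Filter.eventuallyEq_of_mem (isOpen_H3.mem_nhds hx) h)

theorem pd_pd_add (hf : ContDiffOn ℝ ∞ f H3) (hg : ContDiffOn ℝ ∞ g H3) (i : Fin 3) (hx : x ∈ H3) :
    pd i (pd i fun y => f y + g y) x = pd i (pd i f) x + pd i (pd i g) x := by
  rw [pd_congr_H3 (fun y hy => pd_add (hf.differentiableAt_H3 hy) (hg.differentiableAt_H3 hy)) hx,
    pd_add ((hf.pd i).differentiableAt_H3 hx) ((hg.pd i).differentiableAt_H3 hx)]

theorem pd_pd_mul (hf : ContDiffOn ℝ ∞ f H3) (hg : ContDiffOn ℝ ∞ g H3) (i : Fin 3) (hx : x ∈ H3) :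
    pd i (pd i fun y => f y * g y) x
      = pd i (pd i f) x * g x + 2 * (pd i f x * pd i g x) + f x * pd i (pd i g) x := by
  have hf1 := hf.differentiableAt_H3 hx
  have hg1 := hg.differentiableAt_H3 hx
  have hf2 := (hf.pd i).differentiableAt_H3 hx
  have hg2 := (hg.pd i).differentiableAt_H3 hx
  rw [pd_congr_H3 (fun y hy => pd_mul (hf.differentiableAt_H3 hy) (hg.differentiableAt_H3 hy)) hx,
    pd_add (hf1.fun_mul hg2) (hg1.fun_mul hf2), pd_mul hg1 hf2, pd_mul hf1 hg2]
  ring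

theorem lapL_add (hf : ContDiffOn ℝ ∞ f H3) (hg : ContDiffOn ℝ ∞ g H3) (hx : x ∈ H3) :
    lapL (fun y => f y + g y) x = lapL f x + lapL g x := by
  simp only [lapL, pd_pd_add hf hg _ hx,
    pd_add (hf.differentiableAt_H3 hx) (hg.differentiableAt_H3 hx), Fin.sum_univ_three]
  ring

theorem lapL_mul (hf : ContDiffOn ℝ ∞ f H3) (hg : ContDiffOn ℝ ∞ g H3) (hx : x ∈ H3) :
    lapL (fun y => f y * g y) x
      = lapL f x * g x + 2 * ∑ i, pd i f x * pd i g x + f x * lapL g x := by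
  simp only [lapL, pd_pd_mul hf hg _ hx,
    pd_mul (hf.differentiableAt_H3 hx) (hg.differentiableAt_H3 hx), Fin.sum_univ_three]
  ring

theorem lapL_const (r : ℝ) : lapL (fun _ => r) x = 0 := by
  have h : ∀ i, pd i (fun _ : V => r) = fun _ => 0 := fun i => funext fun y => pd_const i r y
  simp [lapL, h, pd_const]

theorem lapL_const_mul (hf : ContDiffOn ℝ ∞ f H3) (r : ℝ) (hx : x ∈ H3) :
    lapL (fun y => r * f y) x = r * lapL f x := by
  rw [lapL_mul contDiffOn_const hf hx, lapL_const]
  simp [pd_const]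

theorem pd_pd_norm_sub_sq (i : Fin 3) (a x : V) : pd i (pd i fun y => ‖y - a‖ ^ 2) x = 2 := by
  have h : (pd i fun y => ‖y - a‖ ^ 2) = fun y => 2 * (y i - a i) :=
    funext fun y => pd_norm_sub_sq i a y
  have h1 : DifferentiableAt ℝ (fun y : V => y i) x :=
    ((contDiff_coord i).differentiable (by simp)).differentiableAt
  rw [h, pd_mul (differentiableAt_const _) (h1.fun_sub (differentiableAt_const _)),
    pd_sub h1 (differentiableAt_const _), pd_const, pd_const, pd_coord]
  simp

theorem lapL_norm_sub_sq (a x : V) :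
    lapL (fun y => ‖y - a‖ ^ 2) x = 6 + 2 * ∑ i, drift i x * (x i - a i) := by
  simp only [lapL, pd_pd_norm_sub_sq, pd_norm_sub_sq, Fin.sum_univ_three]
  ring

theorem lapL_norm_sq (x : V) : lapL (fun y => ‖y‖ ^ 2) x = 6 + 2 * conf x * ‖x‖ ^ 2 := by
  have h := lapL_norm_sub_sq 0 x
  simp only [sub_zero] at h
  rw [h, norm_sq_eq_sum]
  simp only [drift, Fin.sum_univ_three, PiLp.zero_apply]
  ring

/-! ### The maximum principle -/

theorem hasDerivAt_line {f : V → ℝ} {x : V} {i : Fin 3} {t : ℝ}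
    (hf : DifferentiableAt ℝ f (x + t • e i)) :
    HasDerivAt (fun s : ℝ => f (x + s • e i)) (pd i f (x + t • e i)) t := by
  have h1 : HasDerivAt (fun s : ℝ => x + s • e i) (e i) t := by
    simpa using ((hasDerivAt_id t).smul_const (e i)).const_add x
  exact hf.hasFDerivAt.comp_hasDerivAt t h1

theorem _root_.IsLocalMax.pd_eq_zero {f : V → ℝ} {x : V} (h : IsLocalMax f x) (i : Fin 3) :
    pd i f x = 0 := by
  rw [pd, h.fderiv_eq_zero]
  rfl

/-- A positive second derivative would make the point a local minimum along the line as well. The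
function would then be locally constant on it, with vanishing second derivative. -/
theorem _root_.IsLocalMax.pd_pd_nonpos {f : V → ℝ} {x : V} (h : IsLocalMax f x) (i : Fin 3)
    (hf : ∀ᶠ y in 𝓝 x, DifferentiableAt ℝ f y) (hf' : DifferentiableAt ℝ (pd i f) x) :
    pd i (pd i f) x ≤ 0 := by
  have hline : Tendsto (fun s : ℝ => x + s • e i) (𝓝 0) (𝓝 x) := by
    have : Continuous fun s : ℝ => x + s • e i := by fun_prop
    simpa using this.tendsto 0
  have hd : deriv (fun s : ℝ => f (x + s • e i)) =ᶠ[𝓝 0] fun s => pd i f (x + s • e i) := by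
    filter_upwards [hline.eventually hf] with s hs
    exact (hasDerivAt_line hs).deriv
  have hdd : deriv (deriv fun s : ℝ => f (x + s • e i)) 0 = pd i (pd i f) x := by
    rw [hd.deriv_eq]
    have := hasDerivAt_line (f := pd i f) (x := x) (i := i) (t := 0) (by simpa using hf')
    simpa using this.deriv
  by_contra! hpos
  have hmax : IsLocalMax (fun s : ℝ => f (x + s • e i)) 0 := by
    have := hline.eventually h
    simpa [IsLocalMax, IsMaxFilter] using this
  have hcont : ContinuousAt (fun s : ℝ => f (x + s • e i)) 0 := by
    have := hf.self_of_nhds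
    exact (hasDerivAt_line (t := 0) (by simpa using this)).continuousAt
  have hmin := isLocalMin_of_deriv_deriv_pos (hdd ▸ hpos) hmax.deriv_eq_zero hcont
  have hconst : (fun s : ℝ => f (x + s • e i)) =ᶠ[𝓝 0] fun _ => f (x + (0 : ℝ) • e i) := by
    filter_upwards [hmin, hmax] with s h1 h2 using le_antisymm h2 h1
  have h0 : deriv (deriv fun s : ℝ => f (x + s • e i)) 0 = 0 := by
    rw [hconst.deriv.deriv_eq]
    simp
  rw [← hdd, h0] at hpos
  exact hpos.false

theorem _root_.IsLocalMax.lapL_nonpos {f : V → ℝ} {x : V} (h : IsLocalMax f x) (hx : x ∈ H3)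
    (hf : ContDiffOn ℝ ∞ f H3) : lapL f x ≤ 0 := by
  have h1 : ∀ i, pd i f x = 0 := h.pd_eq_zero
  have h2 : ∀ i, pd i (pd i f) x ≤ 0 := fun i => h.pd_pd_nonpos i
    (Filter.eventually_of_mem (isOpen_H3.mem_nhds hx) fun y hy => hf.differentiableAt_H3 hy)
    ((hf.pd i).differentiableAt_H3 hx)
  simp only [lapL, h1, mul_zero, Finset.sum_const_zero, add_zero]
  exact Finset.sum_nonpos fun i _ => h2 i

theorem contDiff_normSq : ContDiff ℝ ∞ fun y : V => ‖y‖ ^ 2 := contDiff_norm_sq ℝ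

/-- The weak maximum principle on balls. -/
theorem le_of_lapL_nonneg {f : V → ℝ} {x₀ : V} {r B : ℝ} (hr : Metric.closedBall x₀ r ⊆ H3)
    (hf : ContDiffOn ℝ ∞ f H3) (hL : ∀ x ∈ Metric.ball x₀ r, 0 ≤ lapL f x)
    (hB : ∀ x ∈ Metric.sphere x₀ r, f x ≤ B) {x : V} (hx : x ∈ Metric.closedBall x₀ r) :
    f x ≤ B := by
  refine le_of_forall_pos_le_add fun ε hε => ?_
  have hs : ContDiffOn ℝ ∞ (fun y => ε * ‖y‖ ^ 2) H3 :=
    contDiffOn_const.mul contDiff_normSq.contDiffOn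
  -- The small multiple of `‖y‖²` makes the function strictly subharmonic, so its maximum cannot be
  -- interior.
  have hg : ContDiffOn ℝ ∞ (fun y => f y + ε * ‖y‖ ^ 2) H3 := hf.add hs
  obtain ⟨y, hy, hmax⟩ := (isCompact_closedBall x₀ r).exists_isMaxOn ⟨x, hx⟩
    (hg.continuousOn.mono hr)
  have hyH := hr hy
  have hyS : y ∈ Metric.sphere x₀ r := by
    by_contra hyS
    have hyb : y ∈ Metric.ball x₀ r := by
      rw [Metric.mem_ball]
      exact lt_of_le_of_ne hy hyS
    have hloc := (hmax.on_subset Metric.ball_subset_closedBall).isLocalMax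
      (Metric.isOpen_ball.mem_nhds hyb)
    have h1 := hloc.lapL_nonpos hyH hg
    rw [lapL_add hf hs hyH, lapL_const_mul contDiff_normSq.contDiffOn ε hyH, lapL_norm_sq] at h1
    have h2 := hL y hyb
    have h3 := (conf_pos hyH).le
    have h4 : 0 < ε * (6 + 2 * conf y * ‖y‖ ^ 2) := by positivity
    linarith
  have h1 : f x + ε * ‖x‖ ^ 2 ≤ f y + ε * ‖y‖ ^ 2 := hmax hx
  have h2 := hB y hyS
  have h3 := one_sub_norm_sq_pos hyH
  have h4 : 0 ≤ ε * ‖x‖ ^ 2 := by positivity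
  nlinarith

end Laplacian

/-! ### The bound on the Higgs field and the Bochner inequality -/

section

variable {m : ℝ} (M : HyperbolicMonopole m)

theorem gradSq_nonneg {x : V} (hx : x ∈ H3) : 0 ≤ gradSq M x := by
  rw [gradSq_eq M hx]
  positivity

/-- The maximum principle for `|Φ|²` on a ball so large that `|Φ| < m + ε` on its boundary. -/
theorem norm_higgs_le (hm : 0 < m) {x : V} (hx : x ∈ H3) : ‖M.Φ x‖ ≤ m := by
  refine le_of_forall_pos_le_add fun ε hε => ?_
  have hev := M.mass.eventually (eventually_lt_nhds (lt_add_of_pos_right m hε))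
  rw [eventually_comap] at hev
  have hx1 : ‖x‖ < 1 := by simpa [H3] using hx
  obtain ⟨R, hR, hR1⟩ := (hev.and (Ioo_mem_nhdsLT hx1)).exists
  have hsub : Metric.closedBall (0 : V) R ⊆ H3 := Metric.closedBall_subset_ball hR1.2
  have h := le_of_lapL_nonneg hsub (smooth_higgsSq M) (B := (m + ε) ^ 2)
    (fun y hy => by
      have hyH := hsub (Metric.ball_subset_closedBall hy)
      rw [lapL_higgsSq M hyH]
      linarith [gradSq_nonneg M hyH])
    (fun y hy => by
      have hyH := hsub (Metric.sphere_subset_closedBall hy)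
      rw [higgsSq_eq M hyH]
      exact pow_le_pow_left₀ (norm_nonneg _) (hR y (by simpa using hy)).le 2)
    (x := x) (by simpa using hR1.1.le)
  rw [higgsSq_eq M hx] at h
  exact (pow_le_pow_iff_left₀ (norm_nonneg _) (by positivity) two_ne_zero).1 h

/-- The constant of the Bochner inequality for the energy density. -/
def bochnerConst (m : ℝ) : ℝ := 6 * (12 + 6 * m) + (3 * (12 + 6 * m) + 9) ^ 2

theorem norm_higgsD_le (i : Fin 3) {x : V} (hx : x ∈ H3) : ‖higgsD M i x‖ ≤ √(gradSq M x) := by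
  refine Real.le_sqrt_of_sq_le ?_
  rw [gradSq_eq M hx]
  exact Finset.single_le_sum (f := fun i => ‖higgsD M i x‖ ^ 2) (fun j _ => by positivity)
    (Finset.mem_univ i)

theorem norm_covD_higgsD_le (i k : Fin 3) (x : V) :
    ‖covD M i (higgsD M k) x‖ ≤ √(hessSq M x) := by
  refine Real.le_sqrt_of_sq_le ?_
  have h1 := Finset.single_le_sum (f := fun k => ∑ i, ‖covD M i (higgsD M k) x‖ ^ 2)
    (fun j _ => by positivity) (Finset.mem_univ k)
  exact (Finset.single_le_sum (f := fun i => ‖covD M i (higgsD M k) x‖ ^ 2)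
    (fun j _ => by positivity) (Finset.mem_univ i)).trans h1

theorem pd_gradSq (i : Fin 3) {x : V} (hx : x ∈ H3) :
    pd i (gradSq M) x = ∑ k, 2 * trL (covD M i (higgsD M k) x * higgsD M k x) := by
  rw [show gradSq M = fun y => ∑ k, trL (higgsD M k y * higgsD M k y) from rfl, pd_sum fun k _ =>
    (smooth_trL_mul (smooth_higgsD M k) (smooth_higgsD M k)).differentiableAt_H3 hx]
  exact Finset.sum_congr rfl fun k _ => pd_trL_sq M (smooth_higgsD M k) i hx

theorem abs_pd_gradSq_le (i : Fin 3) {x : V} (hx : x ∈ H3) :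
    |pd i (gradSq M) x| ≤ 6 * (√(hessSq M x) * √(gradSq M x)) := by
  have h : ∀ k ∈ Finset.univ, |2 * trL (covD M i (higgsD M k) x * higgsD M k x)|
      ≤ 2 * (√(hessSq M x) * √(gradSq M x)) := fun k _ => by
    rw [abs_mul, abs_two]
    have h1 := norm_covD_higgsD_le M i k x
    have h2 := norm_higgsD_le M k hx
    have h3 := abs_trL_mul_le (covD M i (higgsD M k) x) (higgsD M k x)
    have h4 := mul_le_mul h1 h2 (norm_nonneg _) (Real.sqrt_nonneg _)
    linarith
  rw [pd_gradSq M i hx]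
  refine (Finset.abs_sum_le_sum_abs _ _).trans ((Finset.sum_le_sum h).trans ?_)
  simp only [Fin.sum_univ_three]
  linarith

theorem lapL_gradSq {x : V} (hx : x ∈ H3) : lapL (gradSq M) x
    = ∑ k, lapL (fun y => trL (higgsD M k y * higgsD M k y)) x := by
  have hs : ∀ k, ContDiffOn ℝ ∞ (fun y => trL (higgsD M k y * higgsD M k y)) H3 := fun k =>
    smooth_trL_mul (smooth_higgsD M k) (smooth_higgsD M k)
  have h : gradSq M = fun y => (trL (higgsD M 0 y * higgsD M 0 y)
      + trL (higgsD M 1 y * higgsD M 1 y)) + trL (higgsD M 2 y * higgsD M 2 y) :=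
    funext fun y => Fin.sum_univ_three _
  rw [h, lapL_add ((hs 0).add (hs 1)) (hs 2) hx, lapL_add (hs 0) (hs 1) hx, Fin.sum_univ_three]

/-- The Bochner formula produces twice the squared Hessian. Half of it absorbs the terms linear in
the second derivatives that come from the rough Laplacian and the drift. -/
theorem le_lapL_gradSq (hm : 0 < m) {x : V} (hx : x ∈ H3) :
    hessSq M x - bochnerConst m *
      (conf x ^ 2 * √(gradSq M x) ^ 2 + conf x * √(gradSq M x) ^ 3) ≤ lapL (gradSq M) x := by
  set p := √(gradSq M x) with hp
  set q := √(hessSq M x) with hq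
  have hq2 : q ^ 2 = hessSq M x := by
    refine Real.sq_sqrt ?_
    rw [hessSq]
    positivity
  have hp0 : 0 ≤ p := Real.sqrt_nonneg _
  have hq0 : 0 ≤ q := Real.sqrt_nonneg _
  have hc := (conf_pos hx).le
  have hk : ∀ k, 2 * (∑ i, ‖covD M i (higgsD M k) x‖ ^ 2
      - (12 + 6 * m) * (conf x ^ 2 * p + conf x * q + conf x * p ^ 2) * p - 3 * conf x * (q * p))
      ≤ lapL (fun y => trL (higgsD M k y * higgsD M k y)) x := by
    intro k
    rw [lapL_trL_sq M (smooth_higgsD M k) hx]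
    have h1 := abs_trL_mul_le (∑ j, covD M j (covD M j (higgsD M k)) x) (higgsD M k x)
    have h2 := norm_roughLap_le M k hx (fun l => norm_higgsD_le M l hx)
      (fun i l => norm_covD_higgsD_le M i l x) (norm_higgs_le M hm hx)
    have h3 := norm_higgsD_le M k hx
    have h4 := h1.trans (mul_le_mul h2 h3 (norm_nonneg _) (by positivity))
    have h5 : ∀ i, trL (covD M i (higgsD M k) x * covD M i (higgsD M k) x)
        = ‖covD M i (higgsD M k) x‖ ^ 2 := fun i =>
      (IsSu2.covD M (smooth_higgsD M k) (fun y hy => isSu2_higgsD M k hy) i hx).trL_mul_self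
    have h6 : ∀ i, |drift i x * trL (covD M i (higgsD M k) x * higgsD M k x)|
        ≤ conf x * (q * p) := fun i => by
      rw [abs_mul]
      refine mul_le_mul (abs_drift_le i hx) ((abs_trL_mul_le _ _).trans ?_) (abs_nonneg _) hc
      exact mul_le_mul (norm_covD_higgsD_le M i k x) h3 (norm_nonneg _) hq0
    simp only [h5, Fin.sum_univ_three] at h4 ⊢
    have e0 := (abs_le.1 (h6 0)).1
    have e1 := (abs_le.1 (h6 1)).1
    have e2 := (abs_le.1 (h6 2)).1
    have e3 := (abs_le.1 h4).1
    linarith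
  rw [lapL_gradSq M hx]
  refine le_trans ?_ (Finset.sum_le_sum fun k _ => hk k)
  have h7 : hessSq M x = ∑ k, ∑ i, ‖covD M i (higgsD M k) x‖ ^ 2 := rfl
  simp only [← Finset.mul_sum, Finset.sum_sub_distrib, ← h7, ← hq2]
  simp only [Fin.sum_univ_three, bochnerConst]
  -- Summed over `k`, the terms linear in `q` have coefficient `2 (3 (12 + 6 m) + 9) conf p`.
  -- Completing the square accounts for the squared summand of `bochnerConst`, and the rough
  -- Laplacian for `6 (12 + 6 m)`.
  nlinarith [sq_nonneg (q - (3 * (12 + 6 * m) + 9) * (conf x * p)),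
    mul_nonneg (sq_nonneg (3 * (12 + 6 * m) + 9)) (mul_nonneg hc (pow_nonneg hp0 3))]

end

end

section

/-! ### The interior gradient estimate -/

/-- A cutoff function for the ball with centre `x₀` and radius `r`. -/
def bump (x₀ : V) (r : ℝ) (x : V) : ℝ := 1 + -(r ^ 2)⁻¹ * ‖x - x₀‖ ^ 2

section Bump

variable {x₀ x : V} {r : ℝ}

theorem contDiff_bump (x₀ : V) (r : ℝ) : ContDiff ℝ ∞ (bump x₀ r) :=
  contDiff_const.add (contDiff_const.mul (contDiff_norm_sub_sq x₀))

theorem bump_self : bump x₀ r x₀ = 1 := by simp [bump]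

theorem bump_eq_zero (hr : 0 < r) (hx : x ∈ Metric.sphere x₀ r) : bump x₀ r x = 0 := by
  have h : ‖x - x₀‖ = r := by simpa [dist_eq_norm] using hx
  rw [bump, h]
  field_simp
  ring

theorem bump_mem (hr : 0 < r) (hx : x ∈ Metric.closedBall x₀ r) : bump x₀ r x ∈ Set.Icc 0 1 := by
  have h : ‖x - x₀‖ ≤ r := by simpa [dist_eq_norm] using hx
  have h1 : (r ^ 2)⁻¹ * ‖x - x₀‖ ^ 2 ≤ 1 := by
    rw [inv_mul_le_iff₀ (by positivity), mul_one]
    gcongr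
  have h2 : 0 ≤ (r ^ 2)⁻¹ * ‖x - x₀‖ ^ 2 := by positivity
  constructor <;> simp only [bump, neg_mul] <;> linarith

theorem abs_pd_bump_le (hr : 0 < r) (hx : x ∈ Metric.closedBall x₀ r) (i : Fin 3) :
    |pd i (bump x₀ r) x| ≤ 2 / r := by
  have h : ‖x - x₀‖ ≤ r := by simpa [dist_eq_norm] using hx
  have h1 : DifferentiableAt ℝ (fun y => ‖y - x₀‖ ^ 2) x :=
    ((contDiff_norm_sub_sq x₀).differentiable (by simp)).differentiableAt
  have h2 : pd i (bump x₀ r) x = -(r ^ 2)⁻¹ * (2 * (x i - x₀ i)) := by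
    rw [show bump x₀ r = fun y => 1 + -(r ^ 2)⁻¹ * ‖y - x₀‖ ^ 2 from rfl,
      pd_add (differentiableAt_const _) ((differentiableAt_const _).fun_mul h1), pd_const,
      pd_mul (differentiableAt_const _) h1, pd_const, pd_norm_sub_sq]
    ring
  have h3 : |x i - x₀ i| ≤ r := (abs_coord_le (x - x₀) i).trans h
  rw [h2, abs_mul, abs_neg, abs_mul, abs_two, abs_of_pos (by positivity)]
  calc (r ^ 2)⁻¹ * (2 * |x i - x₀ i|) ≤ (r ^ 2)⁻¹ * (2 * r) := by gcongr
    _ = 2 / r := by field_simp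

theorem le_lapL_bump (hr : 0 < r) (hx : x ∈ Metric.closedBall x₀ r) (hxH : x ∈ H3)
    (hc : conf x ≤ 2 / r) : -(18 / r ^ 2) ≤ lapL (bump x₀ r) x := by
  have h : ‖x - x₀‖ ≤ r := by simpa [dist_eq_norm] using hx
  have h2 : lapL (bump x₀ r) x = -(r ^ 2)⁻¹ * (6 + 2 * ∑ i, drift i x * (x i - x₀ i)) := by
    rw [show bump x₀ r = fun y => 1 + -(r ^ 2)⁻¹ * ‖y - x₀‖ ^ 2 from rfl,
      lapL_add contDiffOn_const (contDiffOn_const.mul (contDiff_norm_sub_sq x₀).contDiffOn) hxH,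
      lapL_const, lapL_const_mul (contDiff_norm_sub_sq x₀).contDiffOn _ hxH, lapL_norm_sub_sq]
    ring
  have h3 : ∀ i, drift i x * (x i - x₀ i) ≤ 2 := fun i => by
    have h4 : |x i - x₀ i| ≤ r := (abs_coord_le (x - x₀) i).trans h
    calc drift i x * (x i - x₀ i) ≤ |drift i x * (x i - x₀ i)| := le_abs_self _
      _ = |drift i x| * |x i - x₀ i| := abs_mul _ _
      _ ≤ 2 / r * r := mul_le_mul ((abs_drift_le i hxH).trans hc) h4 (abs_nonneg _) (by positivity)
      _ = 2 := by field_simp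
  have h4 := Finset.sum_le_sum fun i (_ : i ∈ Finset.univ) => h3 i
  simp only [Finset.sum_const, Finset.card_univ, Fintype.card_fin, nsmul_eq_mul] at h4
  push_cast at h4
  have h5 : (r ^ 2)⁻¹ * (6 + 2 * ∑ i, drift i x * (x i - x₀ i)) ≤ (r ^ 2)⁻¹ * 18 := by
    gcongr
    linarith
  rw [h2, div_eq_inv_mul]
  linarith

end Bump

variable {m : ℝ} (M : HyperbolicMonopole m)

theorem bochnerConst_nonneg (hm : 0 < m) : 0 ≤ bochnerConst m := by
  rw [bochnerConst]
  positivity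

/-- The computation behind the Bernstein method. The cross term between cutoff and gradient is
absorbed by `η²` times the Hessian term. The cubic term of the Bochner inequality becomes quadratic
through `η p ≤ s`. -/
theorem le_lapL_bump_sq_mul_gradSq (hm : 0 < m) {x₀ x : V} {r s : ℝ} (hr : 0 < r)
    (hx : x ∈ Metric.closedBall x₀ r) (hxH : x ∈ H3) (hc : conf x ≤ 2 / r)
    (hs : bump x₀ r x * √(gradSq M x) ≤ s) :
    -((5220 + 4 * bochnerConst m) / r ^ 2 * (r * s + 1) * gradSq M x)
      ≤ lapL (fun y => bump x₀ r y * bump x₀ r y * gradSq M y) x := by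
  have hη := (contDiff_bump x₀ r).contDiffOn (s := H3)
  have hηd := hη.differentiableAt_H3 hxH
  have hP := smooth_gradSq M
  obtain ⟨hη0, hη1⟩ := bump_mem hr hx
  have hLη := le_lapL_bump hr hx hxH hc
  have hLP := le_lapL_gradSq M hm hxH
  have hC := bochnerConst_nonneg hm
  have hc0 := (conf_pos hxH).le
  set η := bump x₀ r x with hηdef
  set p := √(gradSq M x) with hp
  set q := √(hessSq M x) with hq
  set C := bochnerConst m
  have hp0 : 0 ≤ p := Real.sqrt_nonneg _
  have hq0 : 0 ≤ q := Real.sqrt_nonneg _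
  have hp2 : gradSq M x = p ^ 2 := (Real.sq_sqrt (gradSq_nonneg M hxH)).symm
  have hq2 : hessSq M x = q ^ 2 := by
    refine (Real.sq_sqrt ?_).symm
    rw [hessSq]
    positivity
  rw [lapL_mul (hη.mul hη) hP hxH, lapL_mul hη hη hxH]
  simp only [pd_mul hηd hηd, ← hηdef]
  have hsum1 : 0 ≤ ∑ i, pd i (bump x₀ r) x * pd i (bump x₀ r) x :=
    Finset.sum_nonneg fun i _ => mul_self_nonneg _
  have hsum2 : -(72 * (η * q) * (p / r))
      ≤ ∑ i, (η * pd i (bump x₀ r) x + η * pd i (bump x₀ r) x) * pd i (gradSq M) x := by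
    have h : ∀ i, -(24 * (η * q) * (p / r))
        ≤ (η * pd i (bump x₀ r) x + η * pd i (bump x₀ r) x) * pd i (gradSq M) x := fun i => by
      have h1 := abs_pd_bump_le hr hx i
      have h2 := abs_pd_gradSq_le M i hxH
      have h3 : |pd i (bump x₀ r) x * pd i (gradSq M) x| ≤ 2 / r * (6 * (q * p)) := by
        rw [abs_mul]
        exact mul_le_mul h1 h2 (abs_nonneg _) (by positivity)
      have h4 := mul_le_mul_of_nonneg_left (abs_le.1 h3).1 hη0
      calc -(24 * (η * q) * (p / r)) = 2 * (η * -(2 / r * (6 * (q * p)))) := by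
            field_simp
            ring
        _ ≤ 2 * (η * (pd i (bump x₀ r) x * pd i (gradSq M) x)) := by linarith
        _ = _ := by ring
    have := Finset.sum_le_sum fun i (_ : i ∈ Finset.univ) => h i
    simp only [Fin.sum_univ_three] at this ⊢
    linarith
  have hηη : η * η ≤ 1 := mul_le_one₀ hη1 hη0 hη1
  have hs0 : 0 ≤ s := (mul_nonneg hη0 hp0).trans hs
  have h1 : -(36 / r ^ 2) ≤ lapL (bump x₀ r) x * η + η * lapL (bump x₀ r) x := by
    have h18 : 0 ≤ 18 / r ^ 2 := by positivity
    have h2 : η * -(18 / r ^ 2) ≤ η * lapL (bump x₀ r) x := by gcongr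
    have h3 : η * (18 / r ^ 2) ≤ 18 / r ^ 2 := mul_le_of_le_one_left h18 hη1
    have h4 : 36 / r ^ 2 = 2 * (18 / r ^ 2) := by ring
    linarith
  have h2 : η * η * (C * (conf x ^ 2 * p ^ 2 + conf x * p ^ 3))
      ≤ C * (4 / r ^ 2 * p ^ 2 + 2 * s / r * p ^ 2) := by
    have e1 : η * η * (conf x ^ 2 * p ^ 2) ≤ 1 * ((2 / r) ^ 2 * p ^ 2) := by gcongr
    have e2 : (η * p) * η * (conf x * p ^ 2) ≤ s * 1 * (2 / r * p ^ 2) := by gcongr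
    calc η * η * (C * (conf x ^ 2 * p ^ 2 + conf x * p ^ 3))
        = C * (η * η * (conf x ^ 2 * p ^ 2) + (η * p) * η * (conf x * p ^ 2)) := by ring
      _ ≤ C * (1 * ((2 / r) ^ 2 * p ^ 2) + s * 1 * (2 / r * p ^ 2)) := by gcongr
      _ = _ := by ring
  rw [hq2] at hLP
  have h3 := mul_le_mul_of_nonneg_left hLP (mul_self_nonneg η)
  have h4 := mul_le_mul_of_nonneg_right h1 (sq_nonneg p)
  have h5 := mul_nonneg hsum1 (sq_nonneg p)
  -- Here `5220 = 36 + 72²`: the `36` is twice the bound for the Laplacian of the cutoff, and `72²`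
  -- comes from completing the square in `h8`.
  have h6 : -((5220 + 4 * C) / r ^ 2 * (r * s + 1) * p ^ 2)
      = -(36 / r ^ 2) * p ^ 2 - 5184 * (p / r) ^ 2 - C * (4 / r ^ 2 * p ^ 2 + 2 * s / r * p ^ 2)
        - (5220 + 2 * C) * s / r * p ^ 2 := by
    field_simp
    ring
  have h7 : 0 ≤ (5220 + 2 * C) * s / r * p ^ 2 := by positivity
  have h8 := sq_nonneg (η * q - 72 * (p / r))
  rw [hp2, h6]
  nlinarith

theorem le_one_add_of_sq_le {s D : ℝ} (hD : 0 ≤ D) (h : s ^ 2 ≤ D * (s + 1)) : s ≤ D + 1 := by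
  by_contra! hs
  nlinarith

/-- For suitable `Λ` the function `η² |d_A Φ|² + Λ |Φ|²` is subharmonic on a ball of radius
comparable to the distance to the boundary. The cutoff `η` vanishes on the sphere, so the function
is at most `Λ m²`, and at the centre this is the claim. The value of `Λ` involves the maximum `s` of
`η |d_A Φ|`, which the same inequality bounds. -/
theorem exists_gradient_bound (hm : 0 < m) : ∃ K, 0 ≤ K ∧ ∀ x ∈ H3,
    gradSq M x ≤ K * conf x ^ 2 * (m ^ 2 - higgsSq M x) := by
  have hC := bochnerConst_nonneg hm
  set C₃ := 5220 + 4 * bochnerConst m with hC₃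
  set D := C₃ * m ^ 2 / 2 with hD
  have hC₃0 : 0 ≤ C₃ := by positivity
  have hD0 : 0 ≤ D := by positivity
  refine ⟨2 * C₃ * (D + 2), by positivity, fun x₀ hx₀ => ?_⟩
  have hx₀1 : ‖x₀‖ < 1 := by simpa [H3] using hx₀
  have hx₀0 := norm_nonneg x₀
  set r := (1 - ‖x₀‖) / 2 with hrdef
  have hr : 0 < r := by rw [hrdef]; linarith
  have hnorm : ∀ x ∈ Metric.closedBall x₀ r, ‖x‖ ≤ 1 - r := fun x hx => by
    have h : ‖x - x₀‖ ≤ r := by simpa [dist_eq_norm] using hx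
    have := norm_le_norm_add_norm_sub' x x₀
    rw [hrdef] at h ⊢
    linarith
  have hsub : Metric.closedBall x₀ r ⊆ H3 := fun x hx => by
    have := hnorm x hx
    simp only [H3, mem_ball_zero_iff]
    linarith
  have hconf : ∀ x ∈ Metric.closedBall x₀ r, conf x ≤ 2 / r := fun x hx => by
    have h := hnorm x hx
    have h0 := norm_nonneg x
    rw [conf]
    gcongr
    nlinarith
  have hη := (contDiff_bump x₀ r).contDiffOn (s := H3)
  have hζ : ContDiffOn ℝ ∞ (fun y => bump x₀ r y * bump x₀ r y * gradSq M y) H3 :=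
    (hη.mul hη).mul (smooth_gradSq M)
  obtain ⟨y, hy, hmax⟩ := (isCompact_closedBall x₀ r).exists_isMaxOn
    ⟨x₀, Metric.mem_closedBall_self hr.le⟩ (hζ.continuousOn.mono hsub)
  set s := bump x₀ r y * √(gradSq M y) with hsdef
  have hs0 : 0 ≤ s := mul_nonneg (bump_mem hr hy).1 (Real.sqrt_nonneg _)
  have hsq : ∀ x ∈ H3, (bump x₀ r x * √(gradSq M x)) ^ 2
      = bump x₀ r x * bump x₀ r x * gradSq M x := fun x hx => by
    rw [mul_pow, Real.sq_sqrt (gradSq_nonneg M hx)]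
    ring
  have hs : ∀ x ∈ Metric.closedBall x₀ r, bump x₀ r x * √(gradSq M x) ≤ s := fun x hx => by
    refine le_of_sq_le_sq ?_ hs0
    rw [hsdef, hsq x (hsub hx), hsq y (hsub hy)]
    exact hmax hx
  -- The division by two uses that the Laplacian of `|Φ|²` is twice the energy density.
  set Λ := C₃ / r ^ 2 * (r * s + 1) / 2 with hΛ
  have hΛ0 : 0 ≤ Λ := by positivity
  have hkey : ∀ x ∈ Metric.closedBall x₀ r,
      bump x₀ r x * bump x₀ r x * gradSq M x + Λ * higgsSq M x ≤ Λ * m ^ 2 := fun x hx => by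
    refine le_of_lapL_nonneg (f := fun y => bump x₀ r y * bump x₀ r y * gradSq M y
      + Λ * higgsSq M y) hsub (hζ.add (contDiffOn_const.mul (smooth_higgsSq M))) ?_ ?_ hx
    · intro z hz
      have hz' := Metric.ball_subset_closedBall hz
      have hzH := hsub hz'
      rw [lapL_add hζ (contDiffOn_const.mul (smooth_higgsSq M)) hzH,
        lapL_const_mul (smooth_higgsSq M) Λ hzH, lapL_higgsSq M hzH]
      have h := le_lapL_bump_sq_mul_gradSq M hm hr hz' hzH (hconf z hz') (hs z hz')
      rw [hΛ]
      linarith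
    · intro z hz
      have hzH := hsub (Metric.sphere_subset_closedBall hz)
      rw [bump_eq_zero hr hz, higgsSq_eq M hzH]
      have h := pow_le_pow_left₀ (norm_nonneg _) (norm_higgs_le M hm hzH) 2
      have := mul_le_mul_of_nonneg_left h hΛ0
      linarith
  -- At the point where `s` is attained the estimate becomes a quadratic inequality for `r s`, with
  -- constants independent of the centre.
  have hrs : r * s ≤ D + 1 := by
    refine le_one_add_of_sq_le hD0 ?_
    have h1 := hkey y hy
    have h2 : 0 ≤ higgsSq M y := by
      rw [higgsSq_eq M (hsub hy)]
      positivity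
    rw [← hsq y (hsub hy), ← hsdef] at h1
    have h3 : s ^ 2 ≤ Λ * m ^ 2 := by nlinarith
    calc (r * s) ^ 2 = r ^ 2 * s ^ 2 := by ring
      _ ≤ r ^ 2 * (Λ * m ^ 2) := by gcongr
      _ = D * (r * s + 1) := by
        rw [hΛ, hD]
        field_simp
  have hr2 : (r ^ 2)⁻¹ ≤ 4 * conf x₀ ^ 2 := by
    have h1 : r⁻¹ ≤ 2 * conf x₀ := by
      rw [conf, inv_le_iff_one_le_mul₀ hr, hrdef]
      have h2 : 1 - ‖x₀‖ ^ 2 = (1 - ‖x₀‖) * (1 + ‖x₀‖) := by ring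
      have h3 : 0 < 1 - ‖x₀‖ := by linarith
      rw [h2]
      have h4 : 2 * (2 / ((1 - ‖x₀‖) * (1 + ‖x₀‖))) * ((1 - ‖x₀‖) / 2) = 2 / (1 + ‖x₀‖) := by
        field_simp
      rw [h4, le_div_iff₀ (by linarith)]
      linarith
    calc (r ^ 2)⁻¹ = r⁻¹ ^ 2 := by rw [inv_pow]
      _ ≤ (2 * conf x₀) ^ 2 := by gcongr
      _ = _ := by ring
  have hΛle : Λ ≤ 2 * C₃ * (D + 2) * conf x₀ ^ 2 := by
    calc Λ = C₃ * (r ^ 2)⁻¹ * (r * s + 1) / 2 := by rw [hΛ, div_eq_mul_inv C₃]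
      _ ≤ C₃ * (4 * conf x₀ ^ 2) * ((D + 1) + 1) / 2 := by gcongr
      _ = _ := by ring
  have h1 := hkey x₀ (Metric.mem_closedBall_self hr.le)
  have h2 : 0 ≤ m ^ 2 - higgsSq M x₀ := by
    rw [higgsSq_eq M hx₀]
    have h := pow_le_pow_left₀ (norm_nonneg _) (norm_higgs_le M hm hx₀) 2
    linarith
  rw [bump_self] at h1
  have h3 := mul_le_mul_of_nonneg_right hΛle h2
  linarith

end

section

/-! ### A test function concentrated along a geodesic -/

/-- A function equal to one on the geodesic from `a` to `b` which decays away from it. -/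
def tube (a b : S2) (x : V) : ℝ :=
  ‖(a : V) - b‖ ^ 2 / 4 * ((1 - ‖x‖ ^ 2) ^ 2 * (‖x - a‖ ^ 2 * ‖x - b‖ ^ 2)⁻¹)

section Tube

variable {a b : S2} {x : V}

theorem norm_lt_one (hx : x ∈ H3) : ‖x‖ < 1 := by simpa [H3] using hx

theorem one_sub_norm_le (a : S2) (x : V) : 1 - ‖x‖ ≤ ‖x - a‖ := by
  have h := norm_le_norm_add_norm_sub x (a : V)
  rw [norm_S2] at h
  linarith

theorem norm_sub_S2_pos (a : S2) (hx : x ∈ H3) : 0 < ‖x - a‖ := by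
  have := one_sub_norm_le a x
  have := norm_lt_one hx
  linarith

theorem norm_sub_S2_sq_ne_zero (a : S2) (hx : x ∈ H3) : ‖x - a‖ ^ 2 ≠ 0 :=
  (pow_pos (norm_sub_S2_pos a hx) 2).ne'

theorem smooth_tube (a b : S2) : ContDiffOn ℝ ∞ (tube a b) H3 := by
  refine contDiffOn_const.mul ((contDiff_one_sub_norm_sq.contDiffOn.pow 2).mul (ContDiffOn.inv
    (((contDiff_norm_sub_sq _).mul (contDiff_norm_sub_sq _)).contDiffOn) fun y hy => ?_))
  exact mul_ne_zero (norm_sub_S2_sq_ne_zero a hy) (norm_sub_S2_sq_ne_zero b hy)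

theorem tube_nonneg (a b : S2) (x : V) : 0 ≤ tube a b x := by
  rw [tube]
  positivity

/-- The logarithmic derivative of `tube`. -/
def tubeLog (a b : S2) (i : Fin 3) (x : V) : ℝ :=
  -2 * drift i x + -2 * ((x i - (a : V) i) * (‖x - a‖ ^ 2)⁻¹)
    + -2 * ((x i - (b : V) i) * (‖x - b‖ ^ 2)⁻¹)

theorem differentiableAt_norm_sub_sq (a : V) (x : V) : DifferentiableAt ℝ (fun y => ‖y - a‖ ^ 2) x :=
  ((contDiff_norm_sub_sq a).differentiable (by simp)).differentiableAt

theorem differentiableAt_coord_sub (i : Fin 3) (r : ℝ) (x : V) :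
    DifferentiableAt ℝ (fun y : V => y i - r) x :=
  ((contDiff_coord i).differentiable (by simp)).differentiableAt.sub_const r

theorem pd_tube (a b : S2) (i : Fin 3) (hx : x ∈ H3) :
    pd i (tube a b) x = tube a b x * tubeLog a b i x := by
  have hσ : DifferentiableAt ℝ (fun y : V => ‖y‖ ^ 2) x :=
    (contDiff_normSq.differentiable (by simp)).differentiableAt
  have hσ1 : DifferentiableAt ℝ (fun y : V => 1 - ‖y‖ ^ 2) x := (differentiableAt_const _).fun_sub hσ
  have ha := differentiableAt_norm_sub_sq a x
  have hb := differentiableAt_norm_sub_sq b x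
  have ha0 := norm_sub_S2_sq_ne_zero a hx
  have hb0 := norm_sub_S2_sq_ne_zero b hx
  have h0 := (one_sub_norm_sq_pos hx).ne'
  have hab := ha.fun_mul hb
  have hab0 := mul_ne_zero ha0 hb0
  have e : tube a b = fun y => ‖(a : V) - b‖ ^ 2 / 4 * ((1 - ‖y‖ ^ 2) * (1 - ‖y‖ ^ 2)
      * (‖y - (a : V)‖ ^ 2 * ‖y - (b : V)‖ ^ 2)⁻¹) := by
    funext y
    rw [tube, sq (1 - ‖y‖ ^ 2)]
  rw [e, pd_mul (differentiableAt_const _) ((hσ1.fun_mul hσ1).fun_mul (hab.fun_inv hab0)), pd_const,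
    pd_mul (hσ1.fun_mul hσ1) (hab.fun_inv hab0), pd_mul hσ1 hσ1, pd_inv hab hab0, pd_mul ha hb,
    pd_sub (differentiableAt_const _) hσ, pd_const, pd_norm_sq, pd_norm_sub_sq, pd_norm_sub_sq,
    tubeLog, drift, conf]
  beta_reduce
  generalize ‖x - a‖ ^ 2 = α at *
  generalize ‖x - b‖ ^ 2 = β at *
  generalize hτ : 1 - ‖x‖ ^ 2 = τ at *
  field_simp
  ring

theorem pd_coord_mul_inv (a : S2) (i : Fin 3) (hx : x ∈ H3) :
    pd i (fun y => (y i - (a : V) i) * (‖y - (a : V)‖ ^ 2)⁻¹) x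
      = (‖x - a‖ ^ 2)⁻¹ - 2 * (x i - (a : V) i) ^ 2 * ((‖x - a‖ ^ 2)⁻¹) ^ 2 := by
  have ha := differentiableAt_norm_sub_sq a x
  have ha0 := norm_sub_S2_sq_ne_zero a hx
  have hi : DifferentiableAt ℝ (fun y : V => y i) x :=
    ((contDiff_coord i).differentiable (by simp)).differentiableAt
  rw [pd_mul (differentiableAt_coord_sub i _ x) (ha.fun_inv ha0), pd_inv ha ha0, pd_norm_sub_sq,
    pd_sub hi (differentiableAt_const _), pd_const, pd_coord, if_pos rfl]
  field_simp
  ring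

theorem smooth_coord_mul_inv (a : S2) (i : Fin 3) :
    ContDiffOn ℝ ∞ (fun y => (y i - (a : V) i) * (‖y - (a : V)‖ ^ 2)⁻¹) H3 :=
  ((contDiff_coord i).sub contDiff_const).contDiffOn.mul
    ((contDiff_norm_sub_sq _).contDiffOn.inv fun _ hy => norm_sub_S2_sq_ne_zero a hy)

theorem pd_tubeLog (a b : S2) (i : Fin 3) (hx : x ∈ H3) : pd i (tubeLog a b i) x
    = -2 * pd i (drift i) x
      - 2 * ((‖x - a‖ ^ 2)⁻¹ - 2 * (x i - (a : V) i) ^ 2 * ((‖x - a‖ ^ 2)⁻¹) ^ 2)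
      - 2 * ((‖x - b‖ ^ 2)⁻¹ - 2 * (x i - (b : V) i) ^ 2 * ((‖x - b‖ ^ 2)⁻¹) ^ 2) := by
  have h1 := (smooth_drift i).differentiableAt_H3 hx
  have h2 := (smooth_coord_mul_inv a i).differentiableAt_H3 hx
  have h3 := (smooth_coord_mul_inv b i).differentiableAt_H3 hx
  have hc : DifferentiableAt ℝ (fun _ : V => (-2 : ℝ)) x := differentiableAt_const _
  rw [show tubeLog a b i = fun y => -2 * drift i y + -2 * ((y i - (a : V) i) * (‖y - (a : V)‖ ^ 2)⁻¹)
      + -2 * ((y i - (b : V) i) * (‖y - (b : V)‖ ^ 2)⁻¹) from rfl,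
    pd_add ((hc.fun_mul h1).fun_add (hc.fun_mul h2)) (hc.fun_mul h3),
    pd_add (hc.fun_mul h1) (hc.fun_mul h2), pd_mul hc h1, pd_mul hc h2, pd_mul hc h3, pd_const,
    pd_coord_mul_inv a i hx, pd_coord_mul_inv b i hx]
  ring

theorem lapL_eq_of_pd_eq {f : V → ℝ} {g : Fin 3 → V → ℝ} (hf : ContDiffOn ℝ ∞ f H3)
    (hg : ∀ i, ContDiffOn ℝ ∞ (g i) H3) (h : ∀ i, ∀ y ∈ H3, pd i f y = f y * g i y) (hx : x ∈ H3) :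
    lapL f x = f x * ∑ i, (pd i (g i) x + g i x ^ 2 + drift i x * g i x) := by
  have h2 : ∀ i, pd i (pd i f) x = f x * g i x * g i x + f x * pd i (g i) x := fun i => by
    rw [pd_congr_H3 (h i) hx, pd_mul (hf.differentiableAt_H3 hx) ((hg i).differentiableAt_H3 hx),
      h i x hx]
    ring
  simp only [lapL, h2, h _ x hx, Fin.sum_univ_three]
  ring

theorem smooth_tubeLog (a b : S2) (i : Fin 3) : ContDiffOn ℝ ∞ (tubeLog a b i) H3 :=
  ((contDiffOn_const.mul (smooth_drift i)).add (contDiffOn_const.mul (smooth_coord_mul_inv a i))).add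
    (contDiffOn_const.mul (smooth_coord_mul_inv b i))

/-- `tube` is `1 / cosh² d` with `d` the hyperbolic distance to the geodesic, and in `ℍ³` the
Laplacian of this function is `-4 / cosh⁴ d`. The verification uses logarithmic derivatives. -/
theorem lapL_tube (a b : S2) (hx : x ∈ H3) :
    lapL (tube a b) x = -4 * conf x ^ 2 * tube a b x ^ 2 := by
  rw [lapL_eq_of_pd_eq (smooth_tube a b) (smooth_tubeLog a b) (fun i y hy => pd_tube a b i hy) hx]
  have hA := norm_sub_S2_sq_ne_zero a hx
  have hB := norm_sub_S2_sq_ne_zero b hx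
  have hS := (one_sub_norm_sq_pos hx).ne'
  have hc : conf x * (1 - ‖x‖ ^ 2) = 2 := by
    rw [conf]
    field_simp
  have ha1 := norm_sq_eq_sum (a : V)
  have hb1 := norm_sq_eq_sum (b : V)
  have hD := norm_sq_eq_sum ((a : V) - b)
  have ha2 := norm_sq_eq_sum (x - a)
  have hb2 := norm_sq_eq_sum (x - b)
  have hx2 := norm_sq_eq_sum x
  rw [norm_S2] at ha1 hb1
  have hW : tube a b x = ‖(a : V) - b‖ ^ 2 / 4 * ((1 - ‖x‖ ^ 2) ^ 2 *
    ((‖x - a‖ ^ 2)⁻¹ * (‖x - b‖ ^ 2)⁻¹)) := by rw [tube, mul_inv]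
  suffices h : ∑ i, (pd i (tubeLog a b i) x + tubeLog a b i x ^ 2 + drift i x * tubeLog a b i x)
      = -4 * ‖(a : V) - b‖ ^ 2 * ((‖x - a‖ ^ 2)⁻¹ * (‖x - b‖ ^ 2)⁻¹) by
    have h4 : conf x ^ 2 * tube a b x = ‖(a : V) - b‖ ^ 2 * ((‖x - a‖ ^ 2)⁻¹ * (‖x - b‖ ^ 2)⁻¹) := by
      rw [hW]
      linear_combination (conf x * (1 - ‖x‖ ^ 2) + 2) * (‖(a : V) - b‖ ^ 2 / 4 *
        ((‖x - a‖ ^ 2)⁻¹ * (‖x - b‖ ^ 2)⁻¹)) * hc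
    rw [h]
    linear_combination 4 * tube a b x * h4
  have hA' : (‖x - a‖ ^ 2)⁻¹ * ‖x - a‖ ^ 2 = 1 := inv_mul_cancel₀ hA
  have hB' : (‖x - b‖ ^ 2)⁻¹ * ‖x - b‖ ^ 2 = 1 := inv_mul_cancel₀ hB
  simp only [pd_tubeLog a b _ hx, pd_drift _ _ hx, tubeLog, drift]
  -- From here on this is a polynomial identity: the inverses are variables tied to the squared
  -- distances by `hA'` and `hB'`, and the inner products are expressed through those distances.
  generalize (‖x - a‖ ^ 2)⁻¹ = A at *
  generalize (‖x - b‖ ^ 2)⁻¹ = B at *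
  generalize conf x = c at *
  generalize ‖x - a‖ ^ 2 = α at *
  generalize ‖x - b‖ ^ 2 = β at *
  generalize ‖x‖ ^ 2 = n at *
  generalize ‖(a : V) - b‖ ^ 2 = D at *
  simp only [Fin.sum_univ_three, PiLp.sub_apply] at *
  simp only [if_true]
  have hPa : x 0 * (x 0 - (a : V) 0) + x 1 * (x 1 - (a : V) 1) + x 2 * (x 2 - (a : V) 2)
      = (α - (1 - n)) / 2 := by
    linear_combination (-1 / 2) * ha2 - 1 / 2 * hx2 + 1 / 2 * ha1
  have hPb : x 0 * (x 0 - (b : V) 0) + x 1 * (x 1 - (b : V) 1) + x 2 * (x 2 - (b : V) 2)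
      = (β - (1 - n)) / 2 := by
    linear_combination (-1 / 2) * hb2 - 1 / 2 * hx2 + 1 / 2 * hb1
  have hQ : (x 0 - (a : V) 0) * (x 0 - (b : V) 0) + (x 1 - (a : V) 1) * (x 1 - (b : V) 1)
      + (x 2 - (a : V) 2) * (x 2 - (b : V) 2) = (α + β - D) / 2 := by
    linear_combination (-1 / 2) * ha2 - 1 / 2 * hb2 + 1 / 2 * hD
  linear_combination -8 * A ^ 2 * ha2 - 8 * B ^ 2 * hb2 + (8 * A + 3 * c + 4 * B) * hA'
    + (8 * B + 3 * c + 4 * A) * hB' + 6 * c * A * hPa + 6 * c * B * hPb + 8 * A * B * hQ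
    - (3 * A + 3 * B) * hc

/-- A crude consequence of the triangle inequality; any uniform bound suffices for the energy
estimate. -/
theorem tube_le (a b : S2) (hx : x ∈ H3) : tube a b x ≤ 4 := by
  have ha := norm_sub_S2_pos a hx
  have hb := norm_sub_S2_pos b hx
  have ha1 := one_sub_norm_le a x
  have hb1 := one_sub_norm_le b x
  have hx1 := norm_lt_one hx
  have hx0 := norm_nonneg x
  have hσ : 0 ≤ 1 - ‖x‖ ^ 2 := (one_sub_norm_sq_pos hx).le
  have hσa : 1 - ‖x‖ ^ 2 ≤ 2 * ‖x - a‖ := by nlinarith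
  have hσb : 1 - ‖x‖ ^ 2 ≤ 2 * ‖x - b‖ := by nlinarith
  have hD : ‖(a : V) - b‖ ≤ ‖x - a‖ + ‖x - b‖ := by
    have := norm_sub_le (x - (b : V)) (x - a)
    rw [sub_sub_sub_cancel_left] at this
    linarith
  have key : ‖(a : V) - b‖ * (1 - ‖x‖ ^ 2) ≤ 4 * (‖x - a‖ * ‖x - b‖) := by
    have h1 := mul_le_mul_of_nonneg_right hD hσ
    nlinarith
  have h2 : tube a b x = (‖(a : V) - b‖ * (1 - ‖x‖ ^ 2) / (‖x - a‖ * ‖x - b‖)) ^ 2 / 4 := by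
    rw [tube]
    field_simp
  have h3 : ‖(a : V) - b‖ * (1 - ‖x‖ ^ 2) / (‖x - a‖ * ‖x - b‖) ≤ 4 := by
    rw [div_le_iff₀ (by positivity)]
    exact key
  have h4 : 0 ≤ ‖(a : V) - b‖ * (1 - ‖x‖ ^ 2) / (‖x - a‖ * ‖x - b‖) := by positivity
  rw [h2]
  nlinarith

end Tube

end

section

/-! ### Integration by parts -/

theorem integrable_pd {f : V → ℝ} (hf : ContDiff ℝ ∞ f) (hc : HasCompactSupport f) (i : Fin 3) :
    Integrable (pd i f) :=
  ((hf.continuous_fderiv (by simp)).clm_apply continuous_const).integrable_of_hasCompactSupport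
    (hc.fderiv_apply ℝ (e i))

theorem integral_mul_pd {f g : V → ℝ} (hf : ContDiff ℝ ∞ f) (hg : ContDiff ℝ ∞ g)
    (hc : HasCompactSupport g) (i : Fin 3) : ∫ x, f x * pd i g x = -∫ x, pd i f x * g x := by
  refine integral_mul_fderiv_eq_neg_fderiv_mul_of_integrable ?_ ?_ ?_
    (fun x _ => (hf.differentiable (by simp)).differentiableAt)
    (fun x _ => (hg.differentiable (by simp)).differentiableAt)
  · exact (((hf.continuous_fderiv (by simp)).clm_apply continuous_const).mul
      hg.continuous).integrable_of_hasCompactSupport hc.mul_left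
  · exact (hf.continuous.mul ((hg.continuous_fderiv (by simp)).clm_apply
      continuous_const)).integrable_of_hasCompactSupport (hc.fderiv_apply ℝ (e i)).mul_left
  · exact (hf.continuous.mul hg.continuous).integrable_of_hasCompactSupport hc.mul_left

theorem integral_pd_eq_zero {f : V → ℝ} (hf : ContDiff ℝ ∞ f) (hc : HasCompactSupport f)
    (i : Fin 3) : ∫ x, pd i f x = 0 := by
  have h := integral_mul_pd (f := fun _ => 1) contDiff_const hf hc i
  simpa [pd_const] using h

section Compact

variable {K : Set V} {f g : V → ℝ}

theorem contDiff_indicator (hK : IsCompact K) (hKH : K ⊆ H3) (hf : ContDiffOn ℝ ∞ f H3)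
    (h0 : ∀ x ∈ H3, x ∉ K → f x = 0) : ContDiff ℝ ∞ (H3.indicator f) := by
  rw [contDiff_iff_contDiffAt]
  intro x
  by_cases hx : x ∈ H3
  · refine (hf.contDiffAt (isOpen_H3.mem_nhds hx)).congr_of_eventuallyEq ?_
    filter_upwards [isOpen_H3.mem_nhds hx] with y hy using Set.indicator_of_mem hy f
  · have hxK : x ∈ Kᶜ := fun h => hx (hKH h)
    refine (contDiffAt_const (c := (0 : ℝ))).congr_of_eventuallyEq ?_
    filter_upwards [hK.isClosed.isOpen_compl.mem_nhds hxK] with y hy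
    by_cases hyH : y ∈ H3
    · rw [Set.indicator_of_mem hyH, h0 y hyH hy]
    · exact Set.indicator_of_notMem hyH f

theorem hasCompactSupport_indicator (hK : IsCompact K) (h0 : ∀ x ∈ H3, x ∉ K → f x = 0) :
    HasCompactSupport (H3.indicator f) := by
  refine HasCompactSupport.intro hK fun x hx => ?_
  by_cases hxH : x ∈ H3
  · rw [Set.indicator_of_mem hxH, h0 x hxH hx]
  · exact Set.indicator_of_notMem hxH f

theorem integrableOn_H3 (hK : IsCompact K) (hKH : K ⊆ H3) (hf : ContDiffOn ℝ ∞ f H3)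
    (h0 : ∀ x ∈ H3, x ∉ K → f x = 0) : IntegrableOn f H3 := by
  rw [← integrable_indicator_iff isOpen_H3.measurableSet]
  exact (contDiff_indicator hK hKH hf h0).continuous.integrable_of_hasCompactSupport
    (hasCompactSupport_indicator hK h0)

theorem pd_eq_zero_of_notMem (hK : IsCompact K) (h0 : ∀ x ∈ H3, x ∉ K → f x = 0) (i : Fin 3) {x : V}
    (hx : x ∈ H3) (hxK : x ∉ K) : pd i f x = 0 := by
  have h : f =ᶠ[𝓝 x] fun _ => (0 : ℝ) := by
    filter_upwards [isOpen_H3.mem_nhds hx, hK.isClosed.isOpen_compl.mem_nhds hxK] with y h1 h2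
      using h0 y h1 h2
  rw [pd_congr h, pd_const]

theorem setIntegral_pd_eq_zero (hK : IsCompact K) (hKH : K ⊆ H3) (hf : ContDiffOn ℝ ∞ f H3)
    (h0 : ∀ x ∈ H3, x ∉ K → f x = 0) (i : Fin 3) :
    IntegrableOn (pd i f) H3 ∧ ∫ x in H3, pd i f x = 0 := by
  have hs := contDiff_indicator hK hKH hf h0
  have hc := hasCompactSupport_indicator hK h0
  have h : pd i (H3.indicator f) = H3.indicator (pd i f) := by
    funext x
    by_cases hx : x ∈ H3
    · rw [Set.indicator_of_mem hx]
      exact pd_congr_H3 (fun y hy => Set.indicator_of_mem hy f) hx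
    · have hxK : x ∈ Kᶜ := fun h => hx (hKH h)
      have h : H3.indicator f =ᶠ[𝓝 x] fun _ => (0 : ℝ) := by
        filter_upwards [hK.isClosed.isOpen_compl.mem_nhds hxK] with y hy
        by_cases hyH : y ∈ H3
        · rw [Set.indicator_of_mem hyH, h0 y hyH hy]
        · exact Set.indicator_of_notMem hyH f
      rw [Set.indicator_of_notMem hx, pd_congr h, pd_const]
  have h1 := integrable_pd hs hc i
  have h2 := integral_pd_eq_zero hs hc i
  rw [h] at h1
  simp only [h] at h2
  rw [integral_indicator isOpen_H3.measurableSet] at h2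
  exact ⟨(integrable_indicator_iff isOpen_H3.measurableSet).1 h1, h2⟩

/-- The integrand is the divergence of `conf • (f ∇g - g ∇f)`, because the drift is the logarithmic
gradient of `conf`. Compact support is needed for `g` only. -/
theorem green (hK : IsCompact K) (hKH : K ⊆ H3) (hf : ContDiffOn ℝ ∞ f H3)
    (hg : ContDiffOn ℝ ∞ g H3) (h0 : ∀ x ∈ H3, x ∉ K → g x = 0) :
    IntegrableOn (fun x => conf x * (f x * lapL g x - g x * lapL f x)) H3 ∧
      ∫ x in H3, conf x * (f x * lapL g x - g x * lapL f x) = 0 := by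
  have hX : ∀ i, ContDiffOn ℝ ∞ (fun x => conf x * (f x * pd i g x - g x * pd i f x)) H3 := fun i =>
    smooth_conf.mul ((hf.mul (hg.pd i)).sub (hg.mul (hf.pd i)))
  have hX0 : ∀ i, ∀ x ∈ H3, x ∉ K → conf x * (f x * pd i g x - g x * pd i f x) = 0 :=
    fun i x hx hxK => by rw [pd_eq_zero_of_notMem hK h0 i hx hxK, h0 x hx hxK]; ring
  have h := fun i => setIntegral_pd_eq_zero hK hKH (hX i) (hX0 i) i
  have hpd : ∀ i, ∀ x ∈ H3, pd i (fun x => conf x * (f x * pd i g x - g x * pd i f x)) x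
      = conf x * (f x * (pd i (pd i g) x + drift i x * pd i g x)
        - g x * (pd i (pd i f) x + drift i x * pd i f x)) := fun i x hx => by
    have hf1 := hf.differentiableAt_H3 hx
    have hg1 := hg.differentiableAt_H3 hx
    have hf2 := (hf.pd i).differentiableAt_H3 hx
    have hg2 := (hg.pd i).differentiableAt_H3 hx
    rw [pd_mul (smooth_conf.differentiableAt_H3 hx)
      ((hf1.fun_mul hg2).fun_sub (hg1.fun_mul hf2)), pd_conf i hx,
      pd_sub (hf1.fun_mul hg2) (hg1.fun_mul hf2), pd_mul hf1 hg2, pd_mul hg1 hf2, drift]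
    ring
  have hsum : ∀ x ∈ H3, ∑ i, pd i (fun x => conf x * (f x * pd i g x - g x * pd i f x)) x
      = conf x * (f x * lapL g x - g x * lapL f x) := fun x hx => by
    simp only [hpd _ x hx, lapL, Fin.sum_univ_three]
    ring
  have h1 : IntegrableOn
      (fun x => ∑ i, pd i (fun x => conf x * (f x * pd i g x - g x * pd i f x)) x) H3 :=
    integrable_finsetSum _ fun i _ => (h i).1
  refine ⟨h1.congr_fun hsum isOpen_H3.measurableSet, ?_⟩
  rw [← setIntegral_congr_fun isOpen_H3.measurableSet hsum, integral_finsetSum _ fun i _ => (h i).1]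
  exact Finset.sum_eq_zero fun i _ => (h i).2

end Compact

/-! ### A convex cutoff function -/

/-- A smooth convex function that vanishes for `s ≤ ε` and has slope one for `s ≥ 2 * ε`. -/
def ramp (ε s : ℝ) : ℝ := ∫ u in (0)..s, Real.smoothTransition (u / ε - 1)

section Ramp

variable {ε s : ℝ}

theorem continuous_ramp_integrand (ε : ℝ) :
    Continuous fun u : ℝ => Real.smoothTransition (u / ε - 1) :=
  Real.smoothTransition.continuous.comp (by fun_prop)

theorem hasDerivAt_ramp (ε s : ℝ) : HasDerivAt (ramp ε) (Real.smoothTransition (s / ε - 1)) s :=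
  intervalIntegral.integral_hasDerivAt_right ((continuous_ramp_integrand ε).intervalIntegrable _ _)
    ((continuous_ramp_integrand ε).stronglyMeasurableAtFilter _ _)
    (continuous_ramp_integrand ε).continuousAt

theorem deriv_ramp (ε : ℝ) : deriv (ramp ε) = fun s => Real.smoothTransition (s / ε - 1) :=
  funext fun s => (hasDerivAt_ramp ε s).deriv

theorem contDiff_ramp (ε : ℝ) : ContDiff ℝ ∞ (ramp ε) := by
  rw [contDiff_infty_iff_deriv]
  refine ⟨fun s => (hasDerivAt_ramp ε s).differentiableAt, ?_⟩
  rw [deriv_ramp]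
  exact Real.smoothTransition.contDiff.comp (by fun_prop)

theorem deriv_deriv_ramp_nonneg (hε : 0 < ε) (s : ℝ) : 0 ≤ deriv (deriv (ramp ε)) s := by
  rw [deriv_ramp]
  refine Monotone.deriv_nonneg fun u v huv => Real.smoothTransition.monotone ?_
  gcongr

theorem ramp_eq_zero (hε : 0 < ε) (hs : s ≤ ε) : ramp ε s = 0 := by
  refine (intervalIntegral.integral_congr (g := fun _ => (0 : ℝ)) fun u hu =>
    Real.smoothTransition.zero_of_nonpos ?_).trans intervalIntegral.integral_zero
  have h : u ≤ ε := hu.2.trans (max_le hε.le hs)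
  rw [sub_nonpos, div_le_one hε]
  exact h

theorem monotone_ramp (ε : ℝ) : Monotone (ramp ε) :=
  monotone_of_deriv_nonneg (fun s => (hasDerivAt_ramp ε s).differentiableAt) fun s => by
    rw [deriv_ramp]
    exact Real.smoothTransition.nonneg _

theorem ramp_nonneg (hε : 0 < ε) (s : ℝ) : 0 ≤ ramp ε s := by
  rcases le_total s ε with h | h
  · rw [ramp_eq_zero hε h]
  · rw [← ramp_eq_zero hε le_rfl]
    exact monotone_ramp ε h

theorem sub_le_ramp (hε : 0 < ε) (s : ℝ) : s - 2 * ε ≤ ramp ε s := by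
  rcases le_total s (2 * ε) with h | h
  · linarith [ramp_nonneg hε s]
  · have hi := fun x y => (continuous_ramp_integrand ε).intervalIntegrable (μ := volume) x y
    have h1 : ramp ε s - ramp ε (2 * ε) = ∫ u in (2 * ε)..s, Real.smoothTransition (u / ε - 1) :=
      intervalIntegral.integral_interval_sub_left (hi _ _) (hi _ _)
    have h2 : ∫ u in (2 * ε)..s, Real.smoothTransition (u / ε - 1) = ∫ _u in (2 * ε)..s, (1 : ℝ) := by
      refine intervalIntegral.integral_congr fun u hu => Real.smoothTransition.one_of_one_le ?_
      rw [Set.uIcc_of_le h] at hu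
      rw [le_sub_iff_add_le, le_div_iff₀ hε]
      linarith [hu.1]
    rw [h2, intervalIntegral.integral_const] at h1
    have := ramp_nonneg hε (2 * ε)
    simp only [smul_eq_mul, mul_one] at h1
    linarith

end Ramp

theorem pd_comp {k : ℝ → ℝ} {f : V → ℝ} {x : V} (hk : DifferentiableAt ℝ k (f x))
    (hf : DifferentiableAt ℝ f x) (i : Fin 3) :
    pd i (fun y => k (f y)) x = deriv k (f x) * pd i f x := by
  have h : HasFDerivAt (fun y => k (f y)) (deriv k (f x) • fderiv ℝ f x) x :=
    hk.hasDerivAt.comp_hasFDerivAt x hf.hasFDerivAt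
  rw [pd, h.fderiv]
  rfl

theorem lapL_comp {k : ℝ → ℝ} {f : V → ℝ} (hk : ContDiff ℝ ∞ k) (hf : ContDiffOn ℝ ∞ f H3) {x : V}
    (hx : x ∈ H3) : lapL (fun y => k (f y)) x
      = deriv k (f x) * lapL f x + deriv (deriv k) (f x) * ∑ i, pd i f x ^ 2 := by
  have hk1 : Differentiable ℝ k := hk.differentiable (by simp)
  have hk2 : Differentiable ℝ (deriv k) :=
    (contDiff_infty_iff_deriv.1 hk).2.differentiable (by simp)
  have hf1 := hf.differentiableAt_H3 hx
  have h2 : ∀ i, pd i (pd i fun y => k (f y)) x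
      = deriv k (f x) * pd i (pd i f) x + deriv (deriv k) (f x) * pd i f x ^ 2 := fun i => by
    rw [pd_congr_H3 (fun y hy => pd_comp hk1.differentiableAt (hf.differentiableAt_H3 hy) i) hx,
      pd_mul (f := fun y => deriv k (f y)) (hk2.differentiableAt.comp x hf1) ((hf.pd i).differentiableAt_H3 hx),
      pd_comp hk2.differentiableAt hf1]
    ring
  simp only [lapL, h2, pd_comp hk1.differentiableAt hf1, Fin.sum_univ_three]
  ring

end

section

variable {m : ℝ} (M : HyperbolicMonopole m)

/-! ### A weighted integral bound for the mass defect -/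

/-- The difference between the square of the mass and the square of the norm of the Higgs field. -/
def defect (x : V) : ℝ := m ^ 2 + -1 * higgsSq M x

theorem smooth_defect : ContDiffOn ℝ ∞ (defect M) H3 :=
  contDiffOn_const.add (contDiffOn_const.mul (smooth_higgsSq M))

theorem defect_eq {x : V} (hx : x ∈ H3) : defect M x = m ^ 2 - ‖M.Φ x‖ ^ 2 := by
  rw [defect, higgsSq_eq M hx]
  ring

theorem defect_nonneg (hm : 0 < m) {x : V} (hx : x ∈ H3) : 0 ≤ defect M x := by
  rw [defect_eq M hx, sub_nonneg]
  exact pow_le_pow_left₀ (norm_nonneg _) (norm_higgs_le M hm hx) 2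

theorem lapL_defect {x : V} (hx : x ∈ H3) : lapL (defect M) x = -2 * gradSq M x := by
  change lapL (fun y => m ^ 2 + -1 * higgsSq M y) x = _
  rw [lapL_add contDiffOn_const (contDiffOn_const.mul (smooth_higgsSq M)) hx, lapL_const,
    lapL_const_mul (smooth_higgsSq M) _ hx, lapL_higgsSq M hx]
  ring

theorem exists_defect_le {ε : ℝ} (hε : 0 < ε) :
    ∃ R < 1, ∀ x ∈ H3, x ∉ Metric.closedBall (0 : V) R → defect M x ≤ ε := by
  have h := (M.mass.pow 2).eventually (lt_mem_nhds (sub_lt_self (m ^ 2) hε))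
  rw [eventually_comap, eventually_iff, mem_nhdsLT_iff_exists_Ioo_subset] at h
  obtain ⟨R, hR1, hR⟩ := h
  refine ⟨R, hR1, fun x hx hxR => ?_⟩
  have h1 : R < ‖x‖ := by simpa using hxR
  have h2 := hR ⟨h1, norm_lt_one hx⟩ x rfl
  rw [defect_eq M hx]
  linarith

theorem conf_mul_gradSq {x : V} (hx : x ∈ H3) : conf x * gradSq M x = curvDensity M.A x := by
  have hc := (conf_pos hx).ne'
  rw [gradSq_eq M hx, curvDensity]
  have h : ∀ i : Fin 3, curv M.A x (e (i + 1)) (e (i + 2)) = conf x • higgsD M i x :=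
    fun i => curvF_add_one_add_two M i hx
  simp only [h, norm_smul, Real.norm_of_nonneg (conf_pos hx).le, mul_pow, ← Finset.mul_sum]
  field_simp

/-- Composition with the ramp makes the defect compactly supported in the ball. Convexity and slope
at most one keep its Laplacian above `-2 |d_A Φ|²`. Green's formula against `tube` then produces the
weight `4 conf³ tube²` on one side and, as `tube ≤ 4`, at most `8` times the energy on the other. -/
theorem setIntegral_ramp_le {a b : S2} {ε : ℝ} (hε : 0 < ε) :
    IntegrableOn (fun x => conf x ^ 3 * tube a b x ^ 2 * ramp ε (defect M x)) H3 ∧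
      ∫ x in H3, conf x ^ 3 * tube a b x ^ 2 * ramp ε (defect M x)
        ≤ 2 * ∫ x in H3, curvDensity M.A x := by
  obtain ⟨R, hR, hRε⟩ := exists_defect_le M hε
  have hK := isCompact_closedBall (0 : V) R
  have hKH : Metric.closedBall (0 : V) R ⊆ H3 := Metric.closedBall_subset_ball hR
  have hκ : ContDiffOn ℝ ∞ (fun x => ramp ε (defect M x)) H3 :=
    (contDiff_ramp ε).comp_contDiffOn (smooth_defect M)
  have hκ0 : ∀ x ∈ H3, x ∉ Metric.closedBall (0 : V) R → ramp ε (defect M x) = 0 :=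
    fun x hx hxR => ramp_eq_zero hε (hRε x hx hxR)
  obtain ⟨hi, h0⟩ := green hK hKH (smooth_tube a b) hκ hκ0
  have hI : IntegrableOn (fun x => conf x ^ 3 * tube a b x ^ 2 * ramp ε (defect M x)) H3 :=
    integrableOn_H3 hK hKH (((smooth_conf.pow 3).mul ((smooth_tube a b).pow 2)).mul hκ)
      fun x hx hxR => by rw [hκ0 x hx hxR, mul_zero]
  refine ⟨hI, ?_⟩
  have hle : ∀ x ∈ H3, 4 * (conf x ^ 3 * tube a b x ^ 2 * ramp ε (defect M x))
      - 8 * curvDensity M.A x ≤ conf x * (tube a b x * lapL (fun x => ramp ε (defect M x)) x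
        - ramp ε (defect M x) * lapL (tube a b) x) := fun x hx => by
    have hc := (conf_pos hx).le
    have hW0 := tube_nonneg a b x
    have hW := tube_le a b hx
    have hP := gradSq_nonneg M hx
    have h1 : -2 * gradSq M x ≤ lapL (fun x => ramp ε (defect M x)) x := by
      rw [lapL_comp (contDiff_ramp ε) (smooth_defect M) hx, lapL_defect M hx]
      have h2 : deriv (ramp ε) (defect M x) ≤ 1 := by
        rw [deriv_ramp]
        exact Real.smoothTransition.le_one _
      have h3 := mul_nonneg (deriv_deriv_ramp_nonneg hε (defect M x))
        (Finset.sum_nonneg fun i (_ : i ∈ Finset.univ) => sq_nonneg (pd i (defect M) x))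
      nlinarith
    rw [lapL_tube a b hx, ← conf_mul_gradSq M hx]
    have h4 : -8 * gradSq M x ≤ tube a b x * lapL (fun x => ramp ε (defect M x)) x := by
      have := mul_le_mul_of_nonneg_left h1 hW0
      nlinarith
    have h5 := mul_le_mul_of_nonneg_left h4 hc
    linarith
  have h1 := setIntegral_mono_on ((hI.const_mul 4).sub (M.curv_L2.const_mul 8)) hi
    isOpen_H3.measurableSet hle
  rw [h0] at h1
  have h2 : ∫ x in H3, (4 * (conf x ^ 3 * tube a b x ^ 2 * ramp ε (defect M x))
      - 8 * curvDensity M.A x) = 4 * (∫ x in H3, conf x ^ 3 * tube a b x ^ 2 * ramp ε (defect M x))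
        - 8 * ∫ x in H3, curvDensity M.A x := by
    rw [integral_sub (hI.const_mul 4) (M.curv_L2.const_mul 8), integral_const_mul,
      integral_const_mul]
  have h3 : (4 * (∫ x in H3, conf x ^ 3 * tube a b x ^ 2 * ramp ε (defect M x))
        - 8 * ∫ x in H3, curvDensity M.A x) ≤ 0 := h2 ▸ h1
  linarith

theorem continuousOn_weighted_defect (a b : S2) :
    ContinuousOn (fun x => conf x ^ 3 * tube a b x ^ 2 * defect M x) H3 :=
  (((smooth_conf.pow 3).mul ((smooth_tube a b).pow 2)).mul (smooth_defect M)).continuousOn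

/-- Let `ε → 0` in the ramp. The loss is at most `2 ε` times the integral of the weight, which is
finite on a compact ball, and the final bound does not depend on `R`. -/
theorem setIntegral_weighted_defect_le {a b : S2} {R : ℝ} (hR : R < 1) :
    ∫ x in Metric.closedBall (0 : V) R, conf x ^ 3 * tube a b x ^ 2 * defect M x
      ≤ 2 * ∫ x in H3, curvDensity M.A x := by
  have hK := isCompact_closedBall (0 : V) R
  have hKH : Metric.closedBall (0 : V) R ⊆ H3 := Metric.closedBall_subset_ball hR
  have hwc : ContinuousOn (fun x => conf x ^ 3 * tube a b x ^ 2) (Metric.closedBall (0 : V) R) :=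
    ((smooth_conf.pow 3).mul ((smooth_tube a b).pow 2)).continuousOn.mono hKH
  have hw := hwc.integrableOn_compact hK (μ := volume)
  have hd := ((continuousOn_weighted_defect M a b).mono hKH).integrableOn_compact hK (μ := volume)
  have hw0 : ∀ x ∈ H3, 0 ≤ conf x ^ 3 * tube a b x ^ 2 := fun x hx =>
    mul_nonneg (pow_nonneg (conf_pos hx).le 3) (sq_nonneg _)
  set I := ∫ x in Metric.closedBall (0 : V) R, conf x ^ 3 * tube a b x ^ 2 with hIdef
  have key : ∀ ε > 0, ∫ x in Metric.closedBall (0 : V) R, conf x ^ 3 * tube a b x ^ 2 * defect M x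
      ≤ 2 * (∫ x in H3, curvDensity M.A x) + 2 * I * ε := fun ε hε => by
    obtain ⟨hi, hle⟩ := setIntegral_ramp_le M (a := a) (b := b) hε
    have h1 : ∫ x in Metric.closedBall (0 : V) R, conf x ^ 3 * tube a b x ^ 2 * defect M x
        ≤ ∫ x in Metric.closedBall (0 : V) R, (conf x ^ 3 * tube a b x ^ 2 * ramp ε (defect M x)
          + 2 * ε * (conf x ^ 3 * tube a b x ^ 2)) := by
      refine setIntegral_mono_on hd ((hi.mono_set hKH).add (hw.const_mul _))
        hK.measurableSet fun x hx => ?_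
      have h2 := mul_le_mul_of_nonneg_left (sub_le_ramp hε (defect M x)) (hw0 x (hKH hx))
      linarith
    have h3 : ∫ x in Metric.closedBall (0 : V) R, conf x ^ 3 * tube a b x ^ 2 * ramp ε (defect M x)
        ≤ ∫ x in H3, conf x ^ 3 * tube a b x ^ 2 * ramp ε (defect M x) := by
      refine setIntegral_mono_set hi ?_ (Filter.Eventually.of_forall hKH)
      filter_upwards [ae_restrict_mem isOpen_H3.measurableSet] with x hx
        using mul_nonneg (hw0 x hx) (ramp_nonneg hε _)
    rw [integral_add (hi.mono_set hKH) (hw.const_mul _), integral_const_mul, ← hIdef] at h1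
    linarith
  have hlim : Tendsto (fun ε : ℝ => 2 * (∫ x in H3, curvDensity M.A x) + 2 * I * ε) (𝓝[>] 0)
      (𝓝 (2 * (∫ x in H3, curvDensity M.A x) + 2 * I * 0)) :=
    (Continuous.tendsto (by fun_prop) 0).mono_left nhdsWithin_le_nhds
  rw [mul_zero, add_zero] at hlim
  exact ge_of_tendsto hlim (eventually_mem_nhdsWithin.mono fun ε hε => key ε hε)

end

section

/-! ### A mean value inequality -/

theorem hasDerivAt_expNegInvGlue (s : ℝ) :
    HasDerivAt expNegInvGlue (s⁻¹ ^ 2 * expNegInvGlue s) s := by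
  simpa using expNegInvGlue.hasDerivAt_polynomial_eval_inv_mul 1 s

theorem deriv_expNegInvGlue_nonneg (s : ℝ) : 0 ≤ deriv expNegInvGlue s :=
  expNegInvGlue.monotone.deriv_nonneg

theorem deriv_expNegInvGlue_eq_zero {s : ℝ} (hs : s ≤ 0) : deriv expNegInvGlue s = 0 := by
  rw [(hasDerivAt_expNegInvGlue s).deriv, expNegInvGlue.zero_of_nonpos hs, mul_zero]

theorem deriv_expNegInvGlue_le (s : ℝ) : deriv expNegInvGlue s ≤ 2 := by
  rcases le_or_gt s 0 with hs | hs
  · rw [deriv_expNegInvGlue_eq_zero hs]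
    norm_num
  · have h := Real.quadratic_le_exp_of_nonneg (inv_nonneg.2 hs.le)
    have hinv : 0 < s⁻¹ := inv_pos.2 hs
    rw [(hasDerivAt_expNegInvGlue s).deriv, expNegInvGlue, if_neg hs.not_ge, Real.exp_neg,
      mul_inv_le_iff₀ (Real.exp_pos _)]
    linarith

/-- The derivative carries the factor `s⁻²`, which is at least one on `(0, 1]`. This lets the
potential be dominated by the weight. -/
theorem expNegInvGlue_le_deriv {s : ℝ} (hs : s ≤ 1) : expNegInvGlue s ≤ deriv expNegInvGlue s := by
  rcases le_or_gt s 0 with h | h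
  · rw [deriv_expNegInvGlue_eq_zero h, expNegInvGlue.zero_of_nonpos h]
  · rw [(hasDerivAt_expNegInvGlue s).deriv]
    exact le_mul_of_one_le_left (expNegInvGlue.nonneg s) (one_le_pow₀ ((one_le_inv₀ h).2 hs))

/-- A smooth radial weight on the unit ball. -/
def weight (y : V) : ℝ := deriv expNegInvGlue (1 - ‖y‖ ^ 2)

/-- A potential for the vector field `-2 * weight y * y`. -/
def weightPot (y : V) : ℝ := expNegInvGlue (1 - ‖y‖ ^ 2)

theorem continuous_weight : Continuous weight :=
  ((contDiff_infty_iff_deriv.1 (expNegInvGlue.contDiff (n := ⊤))).2.continuous).comp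
    (by fun_prop)

theorem contDiff_weightPot : ContDiff ℝ ∞ weightPot :=
  (expNegInvGlue.contDiff (n := ⊤)).comp contDiff_one_sub_norm_sq

theorem pd_weightPot (i : Fin 3) (y : V) : pd i weightPot y = -2 * (y i * weight y) := by
  have hσ : DifferentiableAt ℝ (fun y : V => ‖y‖ ^ 2) y :=
    (contDiff_normSq.differentiable (by simp)).differentiableAt
  have h1 := pd_comp (f := fun y : V => 1 - ‖y‖ ^ 2)
    (hasDerivAt_expNegInvGlue (1 - ‖y‖ ^ 2)).differentiableAt ((differentiableAt_const (1 : ℝ)).fun_sub hσ) i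
  rw [pd_sub (differentiableAt_const _) hσ, pd_const, pd_norm_sq] at h1
  change pd i weightPot y = weight y * (0 - 2 * y i) at h1
  rw [h1]
  ring

theorem weight_eq_zero {y : V} (hy : 1 ≤ ‖y‖) : weight y = 0 :=
  deriv_expNegInvGlue_eq_zero (by nlinarith)

theorem weightPot_eq_zero {y : V} (hy : 1 ≤ ‖y‖) : weightPot y = 0 :=
  expNegInvGlue.zero_of_nonpos (by nlinarith)

theorem hasCompactSupport_weight : HasCompactSupport weight :=
  HasCompactSupport.intro (isCompact_closedBall (0 : V) 1) fun y hy =>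
    weight_eq_zero (by simpa using (not_le.1 fun h => hy (by simpa using h)).le)

theorem hasCompactSupport_weightPot : HasCompactSupport weightPot :=
  HasCompactSupport.intro (isCompact_closedBall (0 : V) 1) fun y hy =>
    weightPot_eq_zero (by simpa using (not_le.1 fun h => hy (by simpa using h)).le)

theorem weight_nonneg (y : V) : 0 ≤ weight y := deriv_expNegInvGlue_nonneg _

theorem weightPot_le (y : V) : weightPot y ≤ weight y :=
  expNegInvGlue_le_deriv (by nlinarith [sq_nonneg ‖y‖])

theorem integral_weight_pos : 0 < ∫ y, weight y := by
  refine continuous_weight.integral_pos_of_hasCompactSupport_nonneg_nonzero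
    hasCompactSupport_weight weight_nonneg (x := 0) ?_
  have h : 0 < expNegInvGlue 1 := expNegInvGlue.pos_of_pos one_pos
  rw [weight, (hasDerivAt_expNegInvGlue _).deriv]
  simp [h.ne']

theorem fderiv_apply_eq_sum (f : V → ℝ) (x y : V) : fderiv ℝ f x y = ∑ i, y i * pd i f x := by
  have h : y = ∑ i, y i • e i := by
    ext j
    simp [e, Fin.sum_univ_three]
    fin_cases j <;> simp
  conv_lhs => rw [h]
  simp [pd]

section MeanValue

variable {v : V → ℝ}

/-- A weighted average of `v` over the ball with centre `x₀` and radius `ρ`. -/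
def ballAverage (v : V → ℝ) (x₀ : V) (ρ : ℝ) : ℝ := ∫ y, v (x₀ + ρ • y) * weight y

theorem integrable_mul_weight (hv : Continuous v) (x₀ : V) (ρ : ℝ) :
    Integrable fun y => v (x₀ + ρ • y) * weight y :=
  ((hv.comp (by fun_prop)).mul continuous_weight).integrable_of_hasCompactSupport
    hasCompactSupport_weight.mul_left

theorem hasDerivAt_ballAverage (hv : ContDiff ℝ ∞ v) (x₀ : V) (ρ : ℝ) :
    HasDerivAt (ballAverage v x₀) (∫ y, fderiv ℝ v (x₀ + ρ • y) y * weight y) ρ := by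
  have hcont : Continuous fun p : ℝ × V => fderiv ℝ v (x₀ + p.1 • p.2) p.2 :=
    ((hv.continuous_fderiv (by simp)).comp (by fun_prop)).clm_apply continuous_snd
  obtain ⟨C, hC⟩ := ((isCompact_closedBall ρ 1).prod
    (isCompact_closedBall (0 : V) 1)).exists_bound_of_continuousOn hcont.continuousOn
  refine (hasDerivAt_integral_of_dominated_loc_of_deriv_le (Metric.closedBall_mem_nhds ρ one_pos)
    (F' := fun ρ y => fderiv ℝ v (x₀ + ρ • y) y * weight y) (bound := fun y => C * weight y)
    (Filter.Eventually.of_forall fun ρ' => ?_) (integrable_mul_weight hv.continuous x₀ ρ) ?_ ?_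
    ?_ ?_).2
  · exact (integrable_mul_weight hv.continuous x₀ ρ').aestronglyMeasurable
  · exact ((hcont.comp (Continuous.prodMk_right ρ)).mul continuous_weight).aestronglyMeasurable
  · refine Filter.Eventually.of_forall fun y ρ' hρ' => ?_
    rw [norm_mul, Real.norm_of_nonneg (weight_nonneg y)]
    rcases le_or_gt 1 ‖y‖ with hy | hy
    · rw [weight_eq_zero hy, mul_zero, mul_zero]
    · exact mul_le_mul_of_nonneg_right (hC (ρ', y) ⟨hρ', by simpa using hy.le⟩) (weight_nonneg y)
  · exact (continuous_weight.integrable_of_hasCompactSupport hasCompactSupport_weight).const_mul C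
  · refine Filter.Eventually.of_forall fun y ρ' _ => ?_
    have h1 : HasDerivAt (fun s : ℝ => x₀ + s • y) y ρ' := by
      simpa using ((hasDerivAt_id ρ').smul_const y).const_add x₀
    exact ((hv.differentiable (by simp)).differentiableAt.hasFDerivAt.comp_hasDerivAt ρ'
      h1).mul_const _

theorem pd_comp_affine {f : V → ℝ} (hf : Differentiable ℝ f) (x₀ : V) (ρ : ℝ) (i : Fin 3) (y : V) :
    pd i (fun y => f (x₀ + ρ • y)) y = ρ * pd i f (x₀ + ρ • y) := by
  have h1 : HasFDerivAt (fun y : V => x₀ + ρ • y) (ρ • ContinuousLinearMap.id ℝ V) y :=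
    ((hasFDerivAt_id y).const_smul ρ).const_add x₀
  have h2 := hf.differentiableAt.hasFDerivAt.comp y h1
  rw [pd, show (fun y => f (x₀ + ρ • y)) = f ∘ fun y => x₀ + ρ • y from rfl, h2.fderiv]
  simp [pd]

theorem _root_.ContDiff.pd {f : V → ℝ} (hf : ContDiff ℝ ∞ f) (i : Fin 3) : ContDiff ℝ ∞ (pd i f) :=
  (hf.fderiv_right (m := ∞) (by simp)).clm_apply contDiff_const

/-- Since `weight y • y` is `-1/2` of the gradient of `weightPot`, an integration by parts turns the
radial derivative into the Laplacian. -/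
theorem integral_fderiv_mul_weight (hv : ContDiff ℝ ∞ v) (x₀ : V) (ρ : ℝ) :
    ∫ y, fderiv ℝ v (x₀ + ρ • y) y * weight y
      = ρ / 2 * ∫ y, (∑ i, pd i (pd i v) (x₀ + ρ • y)) * weightPot y := by
  have hc : ∀ i, ContDiff ℝ ∞ fun y => pd i v (x₀ + ρ • y) := fun i =>
    (hv.pd i).comp (contDiff_const.add (contDiff_id.const_smul ρ))
  have hi : ∀ i, Integrable fun y => pd i v (x₀ + ρ • y) * pd i weightPot y := fun i =>
    ((hc i).continuous.mul (contDiff_weightPot.pd i).continuous).integrable_of_hasCompactSupport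
      (hasCompactSupport_weightPot.fderiv_apply ℝ (e i)).mul_left
  have hi2 : ∀ i, Integrable fun y => ρ * pd i (pd i v) (x₀ + ρ • y) * weightPot y := fun i =>
    ((continuous_const.mul (((hv.pd i).pd i).continuous.comp (by fun_prop))).mul
      contDiff_weightPot.continuous).integrable_of_hasCompactSupport
      hasCompactSupport_weightPot.mul_left
  have h1 : ∀ y, fderiv ℝ v (x₀ + ρ • y) y * weight y
      = -(1 / 2) * ∑ i, pd i v (x₀ + ρ • y) * pd i weightPot y := fun y => by
    simp only [fderiv_apply_eq_sum, pd_weightPot, Fin.sum_univ_three]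
    ring
  have h2 : ∀ i, ∫ y, pd i v (x₀ + ρ • y) * pd i weightPot y
      = -∫ y, ρ * pd i (pd i v) (x₀ + ρ • y) * weightPot y := fun i => by
    rw [integral_mul_pd (hc i) contDiff_weightPot hasCompactSupport_weightPot i]
    simp only [pd_comp_affine ((hv.pd i).differentiable (by simp))]
  simp only [h1]
  rw [integral_const_mul, integral_finsetSum _ fun i _ => hi i]
  simp only [h2]
  rw [Finset.sum_neg_distrib, ← integral_finsetSum _ fun i _ => hi2 i, ← integral_const_mul,
    neg_mul_neg, ← integral_const_mul]
  refine integral_congr_ae (Filter.Eventually.of_forall fun y => ?_)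
  simp only [Fin.sum_univ_three]
  ring

/-- The average `A(ρ)` satisfies `A' ≥ -(κ ρ / 2) A`, so `e^{κ ρ² / 4} A(ρ)` is nondecreasing; at `ρ
= 0` it is the left side. -/
theorem mul_integral_weight_le_ballAverage (hv : ContDiff ℝ ∞ v) {x₀ : V} {r κ : ℝ} (hr : 0 ≤ r)
    (hκ : 0 ≤ κ) (hv0 : ∀ x ∈ Metric.ball x₀ r, 0 ≤ v x)
    (hΔ : ∀ x ∈ Metric.ball x₀ r, -κ * v x ≤ ∑ i, pd i (pd i v) x) :
    v x₀ * ∫ y, weight y ≤ Real.exp (κ * r ^ 2 / 4) * ballAverage v x₀ r := by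
  have hd : ∀ ρ, HasDerivAt (fun ρ => Real.exp (κ * ρ ^ 2 / 4) * ballAverage v x₀ ρ)
      (Real.exp (κ * ρ ^ 2 / 4) * (κ * ρ / 2) * ballAverage v x₀ ρ + Real.exp (κ * ρ ^ 2 / 4)
        * (ρ / 2 * ∫ y, (∑ i, pd i (pd i v) (x₀ + ρ • y)) * weightPot y)) ρ := fun ρ => by
    rw [← integral_fderiv_mul_weight hv]
    refine HasDerivAt.fun_mul (HasDerivAt.exp ?_) (hasDerivAt_ballAverage hv x₀ ρ)
    refine (((hasDerivAt_pow 2 ρ).const_mul κ).div_const 4).congr_deriv ?_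
    ring
  have hmono : MonotoneOn (fun ρ => Real.exp (κ * ρ ^ 2 / 4) * ballAverage v x₀ ρ)
      (Set.Icc 0 r) := by
    refine monotoneOn_of_deriv_nonneg (convex_Icc 0 r)
      (fun ρ _ => (hd ρ).continuousAt.continuousWithinAt)
      (fun ρ _ => (hd ρ).differentiableAt.differentiableWithinAt) fun ρ hρ => ?_
    rw [interior_Icc] at hρ
    have hmem : ∀ y : V, ‖y‖ < 1 → x₀ + ρ • y ∈ Metric.ball x₀ r := fun y hy => by
      rw [mem_ball_iff_norm, add_sub_cancel_left, norm_smul, Real.norm_of_nonneg hρ.1.le]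
      nlinarith [hρ.1, hρ.2, norm_nonneg y]
    have hle : -κ * ballAverage v x₀ ρ
        ≤ ∫ y, (∑ i, pd i (pd i v) (x₀ + ρ • y)) * weightPot y := by
      rw [ballAverage, ← integral_const_mul]
      refine integral_mono ((integrable_mul_weight hv.continuous x₀ ρ).const_mul _) ?_ fun y => ?_
      · exact ((continuous_finsetSum _ fun i _ => ((hv.pd i).pd i).continuous.comp
          (by fun_prop)).mul contDiff_weightPot.continuous).integrable_of_hasCompactSupport
          hasCompactSupport_weightPot.mul_left
      · rcases le_or_gt 1 ‖y‖ with hy | hy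
        · simp [weight_eq_zero hy, weightPot_eq_zero hy]
        · have h1 := hΔ _ (hmem y hy)
          have h2 := hv0 _ (hmem y hy)
          have h3 := mul_le_mul_of_nonneg_right h1 (expNegInvGlue.nonneg (1 - ‖y‖ ^ 2))
          have h4 := mul_le_mul_of_nonneg_left (weightPot_le y) (mul_nonneg hκ h2)
          change _ * weightPot y ≤ _ * weightPot y at h3
          linarith
    rw [(hd ρ).deriv]
    have h1 := mul_le_mul_of_nonneg_left hle (by linarith [hρ.1] : 0 ≤ ρ / 2)
    have h2 := mul_le_mul_of_nonneg_left h1 (Real.exp_pos (κ * ρ ^ 2 / 4)).le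
    linarith
  have h := hmono (Set.left_mem_Icc.2 hr) (Set.right_mem_Icc.2 hr) hr
  have h0 : ballAverage v x₀ 0 = v x₀ * ∫ y, weight y := by
    simp only [ballAverage, zero_smul, add_zero, integral_const_mul]
  simpa [h0] using h

theorem ballAverage_le (hv : Continuous v) {x₀ : V} {r : ℝ} (hr : 0 < r)
    (hv0 : ∀ x ∈ Metric.ball x₀ r, 0 ≤ v x) :
    ballAverage v x₀ r ≤ 2 * ((r ^ 3)⁻¹ * ∫ x in Metric.ball x₀ r, v x) := by
  set g := (Metric.ball x₀ r).indicator v with hg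
  have hgi : Integrable g := (integrable_indicator_iff measurableSet_ball).2
    ((hv.continuousOn.integrableOn_compact (isCompact_closedBall x₀ r)).mono_set
      Metric.ball_subset_closedBall)
  have hg0 : ∀ x, 0 ≤ g x := fun x => Set.indicator_nonneg hv0 x
  have h1 : ∫ y, g (x₀ + r • y) = (r ^ 3)⁻¹ * ∫ x in Metric.ball x₀ r, v x := by
    have h2 := Measure.integral_comp_smul_of_nonneg volume (fun z : V => g (x₀ + z)) r (hR := hr.le)
    rw [h2, integral_add_left_eq_self g x₀, hg, integral_indicator measurableSet_ball]
    simp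
  have hgi2 : Integrable fun y => g (x₀ + r • y) :=
    (integrable_comp_smul_iff volume (fun z : V => g (x₀ + z)) hr.ne').2 (hgi.comp_add_left x₀)
  rw [← h1, ← integral_const_mul]
  refine integral_mono (integrable_mul_weight hv x₀ r) (hgi2.const_mul 2) fun y => ?_
  rcases le_or_gt 1 ‖y‖ with hy | hy
  · simp only [weight_eq_zero hy, mul_zero]
    have := hg0 (x₀ + r • y)
    positivity
  · have hmem : x₀ + r • y ∈ Metric.ball x₀ r := by
      rw [mem_ball_iff_norm, add_sub_cancel_left, norm_smul, Real.norm_of_nonneg hr.le]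
      nlinarith
    simp only [hg, Set.indicator_of_mem hmem]
    have h2 := mul_le_mul_of_nonneg_left (deriv_expNegInvGlue_le (1 - ‖y‖ ^ 2)) (hv0 _ hmem)
    change v _ * weight y ≤ _ at h2
    linarith

theorem mean_value_le (hv : ContDiff ℝ ∞ v) {x₀ : V} {r κ : ℝ} (hr : 0 < r)
    (hκ : 0 ≤ κ) (hv0 : ∀ x ∈ Metric.ball x₀ r, 0 ≤ v x)
    (hΔ : ∀ x ∈ Metric.ball x₀ r, -κ * v x ≤ ∑ i, pd i (pd i v) x) :
    v x₀ ≤ 2 * Real.exp (κ * r ^ 2 / 4) / (∫ y, weight y)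
      * ((r ^ 3)⁻¹ * ∫ x in Metric.ball x₀ r, v x) := by
  have h1 := mul_integral_weight_le_ballAverage hv hr.le hκ hv0 hΔ
  have h2 := mul_le_mul_of_nonneg_left (ballAverage_le hv.continuous hr hv0)
    (Real.exp_pos (κ * r ^ 2 / 4)).le
  have hw := integral_weight_pos
  rw [div_mul_eq_mul_div, le_div_iff₀ hw]
  linarith

end MeanValue

end

section

variable {m : ℝ} (M : HyperbolicMonopole m)

/-! ### A pointwise bound for the mass defect -/

theorem smooth_sqrt_conf : ContDiffOn ℝ ∞ (fun x => √(conf x)) H3 :=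
  smooth_conf.sqrt fun _ hx => (conf_pos hx).ne'

theorem pd_sqrt_conf (i : Fin 3) {x : V} (hx : x ∈ H3) :
    pd i (fun x => √(conf x)) x = √(conf x) * (1 / 2 * drift i x) := by
  have hc := conf_pos hx
  have h := Real.hasDerivAt_sqrt hc.ne'
  rw [pd_comp h.differentiableAt (smooth_conf.differentiableAt_H3 hx), h.deriv, pd_conf i hx, drift]
  have hs : √(conf x) ≠ 0 := (Real.sqrt_pos.2 hc).ne'
  have h2 : √(conf x) ^ 2 = conf x := Real.sq_sqrt hc.le
  field_simp
  rw [h2]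

theorem pd_pd_sqrt_conf_nonneg (i : Fin 3) {x : V} (hx : x ∈ H3) :
    0 ≤ pd i (pd i fun x => √(conf x)) x := by
  have hc := (conf_pos hx).le
  have hd := (smooth_drift i).differentiableAt_H3 hx
  rw [pd_congr_H3 (fun y hy => pd_sqrt_conf i hy) hx,
    pd_mul (smooth_sqrt_conf.differentiableAt_H3 hx) ((differentiableAt_const _).fun_mul hd),
    pd_mul (differentiableAt_const _) hd, pd_const, pd_sqrt_conf i hx, pd_drift i i hx, if_pos rfl]
  have h1 : 0 ≤ √(conf x) := Real.sqrt_nonneg _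
  have h2 : 0 ≤ √(conf x) * (drift i x) ^ 2 := by positivity
  have h3 : 0 ≤ √(conf x) * (conf x * 1) := by positivity
  have h4 : 0 ≤ √(conf x) * (conf x ^ 2 * x i ^ 2) := by positivity
  nlinarith

/-- The mass defect, normalised so that the drift term of its Laplacian disappears. -/
def scaledDefect (x : V) : ℝ := √(conf x) * defect M x

theorem smooth_scaledDefect : ContDiffOn ℝ ∞ (scaledDefect M) H3 :=
  smooth_sqrt_conf.mul (smooth_defect M)

theorem scaledDefect_nonneg (hm : 0 < m) {x : V} (hx : x ∈ H3) : 0 ≤ scaledDefect M x :=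
  mul_nonneg (Real.sqrt_nonneg _) (defect_nonneg M hm hx)

/-- Twice the logarithmic gradient of `√conf` is the drift, so the cross term of the product rule
supplies the first-order part of `lapL`. The leftover term is nonnegative because `√conf` is convex
in each coordinate. -/
theorem le_laplacian_scaledDefect (hm : 0 < m) {x : V} (hx : x ∈ H3) :
    -2 * √(conf x) * gradSq M x ≤ ∑ i, pd i (pd i (scaledDefect M)) x := by
  have hs := smooth_sqrt_conf
  have hd := smooth_defect M
  have h1 : ∀ i, √(conf x) * (pd i (pd i (defect M)) x + drift i x * pd i (defect M) x)
      ≤ pd i (pd i (scaledDefect M)) x := fun i => by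
    rw [show scaledDefect M = fun x => √(conf x) * defect M x from rfl, pd_pd_mul hs hd i hx,
      pd_sqrt_conf i hx]
    have := mul_nonneg (pd_pd_sqrt_conf_nonneg i hx) (defect_nonneg M hm hx)
    linarith
  have h2 : √(conf x) * lapL (defect M) x
      = ∑ i, √(conf x) * (pd i (pd i (defect M)) x + drift i x * pd i (defect M) x) := by
    simp only [lapL, Fin.sum_univ_three]
    ring
  refine le_trans (le_of_eq ?_) (Finset.sum_le_sum fun i _ => h1 i)
  rw [← h2, lapL_defect M hx]
  ring

theorem exists_eq_contDiff {f : V → ℝ} (hf : ContDiffOn ℝ ∞ f H3) {x₀ : V} {r : ℝ} (hr : 0 < r)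
    (hsub : Metric.closedBall x₀ (2 * r) ⊆ H3) :
    ∃ v : V → ℝ, ContDiff ℝ ∞ v ∧ ∀ x ∈ Metric.ball x₀ r, v x = f x := by
  let χ : ContDiffBump x₀ := ⟨r, 2 * r, hr, by linarith⟩
  refine ⟨H3.indicator fun x => χ x * f x,
    contDiff_indicator (isCompact_closedBall x₀ (2 * r)) hsub (χ.contDiff.contDiffOn.mul hf)
      fun x _ hxK => ?_, fun x hx => ?_⟩
  · rw [χ.zero_of_le_dist (not_le.1 fun h => hxK h).le, zero_mul]
  · have hxH : x ∈ H3 := hsub (Metric.closedBall_subset_closedBall (by linarith)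
      (Metric.ball_subset_closedBall hx))
    rw [Set.indicator_of_mem hxH, χ.one_of_mem_closedBall (Metric.ball_subset_closedBall hx), one_mul]

/-- A quarter of the distance to the boundary of the ball. -/
def quarterDist (x : V) : ℝ := (1 - ‖x‖) / 4

theorem quarterDist_pos {x : V} (hx : x ∈ H3) : 0 < quarterDist x := by
  have := norm_lt_one hx
  rw [quarterDist]
  linarith

theorem norm_le_of_mem_closedBall {x₀ x : V} (hx : x ∈ Metric.closedBall x₀ (2 * quarterDist x₀)) :
    ‖x‖ ≤ 1 - 2 * quarterDist x₀ := by
  have h : ‖x - x₀‖ ≤ 2 * quarterDist x₀ := by simpa [dist_eq_norm] using hx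
  have := norm_le_norm_add_norm_sub' x x₀
  rw [quarterDist] at *
  linarith

theorem closedBall_subset_H3 {x₀ : V} (hx₀ : x₀ ∈ H3) :
    Metric.closedBall x₀ (2 * quarterDist x₀) ⊆ H3 := fun x hx => by
  have h1 := norm_le_of_mem_closedBall hx
  have h2 := quarterDist_pos hx₀
  simp only [H3, mem_ball_zero_iff]
  linarith

theorem inv_one_sub_norm_le_conf {x : V} (hx : x ∈ H3) : (1 - ‖x‖)⁻¹ ≤ conf x := by
  have h1 := norm_lt_one hx
  have h2 := norm_nonneg x
  rw [conf, inv_eq_one_div, div_le_div_iff₀ (by linarith) (one_sub_norm_sq_pos hx)]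
  nlinarith

theorem conf_le_of_mem_ball {x₀ x : V} (hx₀ : x₀ ∈ H3) (hx : x ∈ Metric.ball x₀ (quarterDist x₀)) :
    conf x ≤ (quarterDist x₀)⁻¹ := by
  have hr := quarterDist_pos hx₀
  have h1 := norm_le_of_mem_closedBall (Metric.closedBall_subset_closedBall (by linarith)
    (Metric.ball_subset_closedBall hx))
  have h0 := norm_nonneg x
  rw [conf, inv_eq_one_div, div_le_div_iff₀ (by nlinarith) hr]
  nlinarith

/-- By the gradient bound the scaled defect satisfies the hypothesis of the mean value inequality
with `κ = 2 K / r²` on a ball of radius `r`. The product `κ r²` does not depend on the centre, so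
neither does the constant. -/
theorem exists_defect_le_setIntegral (hm : 0 < m) : ∃ C, 0 ≤ C ∧ ∀ x₀ ∈ H3,
    defect M x₀ ≤ C * ∫ x in Metric.ball x₀ (quarterDist x₀), conf x ^ 3 * defect M x := by
  obtain ⟨K, hK0, hK⟩ := exists_gradient_bound M hm
  have hw := integral_weight_pos
  refine ⟨500 * Real.exp (K / 2) / ∫ y, weight y, by positivity, fun x₀ hx₀ => ?_⟩
  have hr := quarterDist_pos hx₀
  have hsub := closedBall_subset_H3 hx₀
  set r := quarterDist x₀ with hrdef
  have hsubr : Metric.closedBall x₀ r ⊆ H3 :=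
    (Metric.closedBall_subset_closedBall (by linarith)).trans hsub
  have hballH : Metric.ball x₀ r ⊆ H3 := Metric.ball_subset_closedBall.trans hsubr
  obtain ⟨v, hv, hvf⟩ := exists_eq_contDiff (smooth_scaledDefect M) hr hsub
  have hΔ : ∀ x ∈ Metric.ball x₀ r, -(2 * K / r ^ 2) * v x ≤ ∑ i, pd i (pd i v) x := fun x hx => by
    have hxH := hballH hx
    have he : v =ᶠ[𝓝 x] scaledDefect M :=
      Filter.eventuallyEq_of_mem (Metric.isOpen_ball.mem_nhds hx) hvf
    have he2 : ∀ i, pd i v =ᶠ[𝓝 x] pd i (scaledDefect M) := fun i =>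
      he.eventuallyEq_nhds.mono fun y hy => pd_congr hy
    simp only [pd_congr (he2 _)]
    refine le_trans ?_ (le_laplacian_scaledDefect M hm hxH)
    rw [hvf x hx, scaledDefect]
    have h1 := hK x hxH
    have h2 : m ^ 2 - higgsSq M x = defect M x := by rw [defect]; ring
    have h3 := defect_nonneg M hm hxH
    have h4 : conf x ^ 2 ≤ (r⁻¹) ^ 2 :=
      pow_le_pow_left₀ (conf_pos hxH).le (conf_le_of_mem_ball hx₀ hx) 2
    have h5 : gradSq M x ≤ K * r⁻¹ ^ 2 * defect M x := by
      rw [← h2] at h3 ⊢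
      exact h1.trans (by gcongr)
    have h6 := mul_le_mul_of_nonneg_left h5 (Real.sqrt_nonneg (conf x))
    have h7 : 2 * K / r ^ 2 = 2 * K * r⁻¹ ^ 2 := by rw [inv_pow, div_eq_mul_inv]
    rw [h7]
    linarith
  have hv0 : ∀ x ∈ Metric.ball x₀ r, 0 ≤ v x := fun x hx => by
    rw [hvf x hx]
    exact scaledDefect_nonneg M hm (hballH hx)
  have hmv := mean_value_le hv hr (by positivity) hv0 hΔ
  rw [hvf x₀ (Metric.mem_ball_self hr), setIntegral_congr_fun measurableSet_ball hvf] at hmv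
  have hc0 := conf_pos hx₀
  have h4r : (4 * r)⁻¹ ≤ conf x₀ := by
    refine le_trans (le_of_eq ?_) (inv_one_sub_norm_le_conf hx₀)
    rw [hrdef, quarterDist]
    congr 1
    ring
  -- On this ball `conf` varies by a bounded factor, and `1 - ‖x‖ ≤ 5 r` gives `conf x ≥ 1 / (5 r)`.
  -- The Euclidean volume scale `r³` is thereby traded for the density `conf³`, with `125 = 5³`.
  have hint : ∫ x in Metric.ball x₀ r, scaledDefect M x
      ≤ ∫ x in Metric.ball x₀ r, 2 * √(conf x₀) * (125 * r ^ 3) * (conf x ^ 3 * defect M x) := by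
    refine setIntegral_mono_on ?_ ?_ measurableSet_ball fun x hx => ?_
    · exact (((smooth_scaledDefect M).continuousOn.mono hsubr).integrableOn_compact
        (isCompact_closedBall x₀ r)).mono_set Metric.ball_subset_closedBall
    · exact ((((smooth_conf.pow 3).mul (smooth_defect M)).continuousOn.mono
        hsubr).integrableOn_compact (isCompact_closedBall x₀ r)).mono_set
        Metric.ball_subset_closedBall |>.const_mul _
    · have hxH := hballH hx
      have h1 : √(conf x) ≤ 2 * √(conf x₀) := by
        rw [show (2 : ℝ) = √(2 ^ 2) by rw [Real.sqrt_sq two_pos.le], ← Real.sqrt_mul (by positivity)]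
        refine Real.sqrt_le_sqrt ((conf_le_of_mem_ball hx₀ hx).trans ?_)
        rw [mul_inv] at h4r
        linarith
      have h2 : 1 ≤ 125 * r ^ 3 * conf x ^ 3 := by
        have h3 : ‖x - x₀‖ < r := by simpa [dist_eq_norm] using hx
        have h4 := norm_le_norm_add_norm_sub x x₀
        have h5 : 1 - ‖x‖ ≤ 5 * r := by
          have : 4 * r = 1 - ‖x₀‖ := by rw [hrdef, quarterDist]; ring
          linarith
        have h6 := inv_one_sub_norm_le_conf hxH
        have h7 : 0 < 1 - ‖x‖ := by linarith [norm_lt_one hxH]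
        have h8 : (5 * r)⁻¹ ≤ conf x := (inv_anti₀ h7 h5).trans h6
        have h9 : 1 ≤ conf x * (5 * r) := (inv_le_iff_one_le_mul₀ (by positivity)).1 h8
        calc (1 : ℝ) ≤ (conf x * (5 * r)) ^ 3 := one_le_pow₀ h9
          _ = _ := by ring
      have h3 := defect_nonneg M hm hxH
      rw [scaledDefect]
      calc √(conf x) * defect M x ≤ 2 * √(conf x₀) * defect M x := by gcongr
        _ ≤ 2 * √(conf x₀) * ((125 * r ^ 3 * conf x ^ 3) * defect M x) := by
          gcongr
          exact le_mul_of_one_le_left h3 h2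
        _ = _ := by ring
  rw [integral_const_mul] at hint
  set I := ∫ x in Metric.ball x₀ r, conf x ^ 3 * defect M x
  have hs : 0 < √(conf x₀) := Real.sqrt_pos.2 hc0
  have hexp : 2 * K / r ^ 2 * r ^ 2 / 4 = K / 2 := by
    field_simp
    ring
  rw [hexp, scaledDefect] at hmv
  refine le_of_mul_le_mul_left (hmv.trans ?_) hs
  calc 2 * Real.exp (K / 2) / (∫ y, weight y) * ((r ^ 3)⁻¹ * ∫ x in Metric.ball x₀ r, scaledDefect M x)
      ≤ 2 * Real.exp (K / 2) / (∫ y, weight y)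
        * ((r ^ 3)⁻¹ * (2 * √(conf x₀) * (125 * r ^ 3) * I)) := by gcongr
    _ = _ := by
      field_simp
      ring

end

section

/-! ### Integrability of the mass defect along a geodesic -/

theorem norm_geodesic_sub_right_sq (a b : S2) (t : ℝ) : ‖geodesic a b t - b‖ ^ 2
    = ‖(a : V) - b‖ ^ 2 * Real.exp (-t) / geodesicDenom a b t := by
  have hD := (geodesicDenom_pos a b t).ne'
  have h1 : geodesic a b t - b = (geodesicDenom a b t)⁻¹ • (Real.exp (-t) • (a : V)
      + (-(‖(a : V) - b‖ + Real.exp (-t))) • (b : V)) := by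
    have h2 : (b : V) = (geodesicDenom a b t)⁻¹ • geodesicDenom a b t • (b : V) :=
      (inv_smul_smul₀ hD _).symm
    conv_lhs => rw [h2]
    rw [geodesic, ← geodesicDenom, ← smul_sub, geodesicDenom]
    congr 1
    module
  have hE := exp_neg_mul_exp t
  rw [h1, norm_smul, mul_pow, norm_sq_smul_add_smul, Real.norm_eq_abs, sq_abs]
  have hDdef : geodesicDenom a b t = ‖(a : V) - b‖ + Real.exp (-t) + Real.exp t := rfl
  field_simp
  rw [hDdef]
  linear_combination (-‖(a : V) - b‖ ^ 2) * hE

theorem norm_geodesic_sub_left_sq (a b : S2) (t : ℝ) : ‖geodesic a b t - a‖ ^ 2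
    = ‖(a : V) - b‖ ^ 2 * Real.exp t / geodesicDenom a b t := by
  have h := norm_geodesic_sub_right_sq b a (-t)
  rw [geodesic_neg, neg_neg, norm_sub_rev] at h
  rw [norm_sub_rev, h, norm_sub_rev (b : V)]
  congr 1
  rw [geodesicDenom, geodesicDenom, neg_neg, norm_sub_rev]
  ring

theorem tube_geodesic {a b : S2} (h : a ≠ b) (t : ℝ) : tube a b (geodesic a b t) = 1 := by
  have hD := (geodesicDenom_pos a b t).ne'
  have hδ := (norm_sub_pos h).ne'
  have hE := exp_neg_mul_exp t
  have h1 := (Real.exp_pos t).ne'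
  have h2 := (Real.exp_pos (-t)).ne'
  rw [tube, one_sub_norm_geodesic_sq, norm_geodesic_sub_left_sq, norm_geodesic_sub_right_sq]
  field_simp
  linear_combination -4 * hE

theorem norm_geodesic_sub_left (a b : S2) (t : ℝ) :
    ‖geodesic a b t - a‖ = Real.exp t * ‖geodesic a b t - b‖ := by
  rw [← pow_left_inj₀ (norm_nonneg _) (by positivity) two_ne_zero, mul_pow,
    norm_geodesic_sub_left_sq, norm_geodesic_sub_right_sq]
  have hE := exp_neg_mul_exp t
  rw [mul_div_assoc', sq (Real.exp t)]
  congr 1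
  linear_combination (-‖(a : V) - b‖ ^ 2 * Real.exp t) * hE

section Ball

variable {x₀ x : V}

theorem norm_sub_S2_le (a : S2) (hx : x ∈ Metric.ball x₀ (quarterDist x₀)) :
    ‖x - a‖ ≤ 5 / 4 * ‖x₀ - a‖ := by
  have h3 : ‖x - x₀‖ < quarterDist x₀ := by simpa [dist_eq_norm] using hx
  have h1 := one_sub_norm_le a x₀
  have h2 := norm_sub_le_norm_sub_add_norm_sub x x₀ (a : V)
  rw [quarterDist] at h3
  linarith

theorem le_norm_sub_S2 (a : S2) (hx : x ∈ Metric.ball x₀ (quarterDist x₀)) :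
    3 / 4 * ‖x₀ - a‖ ≤ ‖x - a‖ := by
  have h3 : ‖x - x₀‖ < quarterDist x₀ := by simpa [dist_eq_norm] using hx
  have h1 := one_sub_norm_le a x₀
  have h2 := norm_sub_le_norm_sub_add_norm_sub x₀ x (a : V)
  rw [norm_sub_rev x₀ x] at h2
  rw [quarterDist] at h3
  linarith

/-- A Harnack comparison: `1 - ‖x‖²` shrinks at most by `3 / 8` and each distance grows at most by
`5 / 4`. The quotient keeps the factor `(3 / 8) (4 / 5)² = 6 / 25`, whose inverse square is below
`20`. -/
theorem le_tube (a b : S2) (hx₀ : x₀ ∈ H3) (hx : x ∈ Metric.ball x₀ (quarterDist x₀)) :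
    tube a b x₀ ≤ 20 * tube a b x := by
  have hr := quarterDist_pos hx₀
  have hxH : x ∈ H3 := closedBall_subset_H3 hx₀ (Metric.closedBall_subset_closedBall (by linarith)
    (Metric.ball_subset_closedBall hx))
  have h3 : ‖x - x₀‖ < quarterDist x₀ := by simpa [dist_eq_norm] using hx
  have ha0 := norm_sub_S2_pos a hx₀
  have hb0 := norm_sub_S2_pos b hx₀
  have ha1 := norm_sub_S2_pos a hxH
  have hb1 := norm_sub_S2_pos b hxH
  have ha := norm_sub_S2_le a hx
  have hb := norm_sub_S2_le b hx
  have hσ : 3 / 8 * (1 - ‖x₀‖ ^ 2) ≤ 1 - ‖x‖ ^ 2 := by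
    have h4 := norm_le_norm_add_norm_sub' x x₀
    have h5 := norm_nonneg x
    have h6 := norm_nonneg x₀
    have h7 := norm_lt_one hx₀
    have h8 := norm_lt_one hxH
    rw [quarterDist] at h3
    nlinarith
  have hσ0 := one_sub_norm_sq_pos hx₀
  have hW : ∀ y : V, tube a b y
      = ‖(a : V) - b‖ ^ 2 / 4 * ((1 - ‖y‖ ^ 2) / (‖y - a‖ * ‖y - b‖)) ^ 2 := fun y => by
    rw [tube, div_pow, mul_pow, div_eq_mul_inv ((1 - ‖y‖ ^ 2) ^ 2)]
  have hq : 6 / 25 * ((1 - ‖x₀‖ ^ 2) / (‖x₀ - a‖ * ‖x₀ - b‖))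
      ≤ (1 - ‖x‖ ^ 2) / (‖x - a‖ * ‖x - b‖) := by
    rw [le_div_iff₀ (by positivity)]
    calc 6 / 25 * ((1 - ‖x₀‖ ^ 2) / (‖x₀ - a‖ * ‖x₀ - b‖)) * (‖x - a‖ * ‖x - b‖)
        ≤ 6 / 25 * ((1 - ‖x₀‖ ^ 2) / (‖x₀ - a‖ * ‖x₀ - b‖))
          * ((5 / 4 * ‖x₀ - a‖) * (5 / 4 * ‖x₀ - b‖)) := by gcongr
      _ = 3 / 8 * (1 - ‖x₀‖ ^ 2) := by
        field_simp
        ring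
      _ ≤ _ := hσ
  have hq0 : 0 ≤ (1 - ‖x₀‖ ^ 2) / (‖x₀ - a‖ * ‖x₀ - b‖) := by positivity
  have hq2 : ((1 - ‖x₀‖ ^ 2) / (‖x₀ - a‖ * ‖x₀ - b‖)) ^ 2
      ≤ 20 * ((1 - ‖x‖ ^ 2) / (‖x - a‖ * ‖x - b‖)) ^ 2 := by
    have := pow_le_pow_left₀ (by positivity) hq 2
    nlinarith
  have := mul_le_mul_of_nonneg_left hq2 (by positivity : 0 ≤ ‖(a : V) - b‖ ^ 2 / 4)
  rw [hW, hW]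
  linarith

end Ball

/-- The integral telescopes to one over an interval of length two at the far end minus another at
the near end, so the bound does not involve `T`. -/
theorem integral_shift_sub_le {Γ : ℝ → ℝ} {B T : ℝ} (hΓ : Monotone Γ) (h0 : ∀ s, 0 ≤ Γ s)
    (hB : ∀ s, Γ s ≤ B) : ∫ t in (0)..T, (Γ (t + 1) - Γ (t - 1)) ≤ 2 * B := by
  have hi : ∀ x y, IntervalIntegrable Γ volume x y := fun x y => hΓ.intervalIntegrable
  have hi1 : IntervalIntegrable (fun t => Γ (t + 1)) volume 0 T :=
    (hΓ.comp fun x y h => by simpa using h).intervalIntegrable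
  have hi2 : IntervalIntegrable (fun t => Γ (t - 1)) volume 0 T :=
    (hΓ.comp fun x y h => by simpa using h).intervalIntegrable
  rw [intervalIntegral.integral_sub hi1 hi2, intervalIntegral.integral_comp_add_right Γ,
    intervalIntegral.integral_comp_sub_right Γ,
    intervalIntegral.integral_interval_sub_interval_comm' (hi _ _) (hi _ _) (hi _ _)]
  have h1 : ∫ t in (T - 1)..(T + 1), Γ t ≤ ∫ _t in (T - 1)..(T + 1), B :=
    intervalIntegral.integral_mono_on (by linarith) (hi _ _) (by simp) fun t _ => hB t
  have h2 : 0 ≤ ∫ t in (0 - 1)..(0 + 1), Γ t :=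
    intervalIntegral.integral_nonneg (by norm_num) fun t _ => h0 t
  rw [intervalIntegral.integral_const, smul_eq_mul] at h1
  linarith

variable {m : ℝ} (M : HyperbolicMonopole m)

/-- The part of the ball of radius `R` lying on one side of a surface orthogonal to the geodesic
from `a` to `b`. -/
def cap (a b : S2) (R s : ℝ) : Set V :=
  Metric.closedBall 0 R ∩ {y | ‖y - a‖ < Real.exp s * ‖y - b‖}

theorem measurableSet_cap (a b : S2) (R s : ℝ) : MeasurableSet (cap a b R s) :=
  measurableSet_closedBall.inter (isOpen_lt (by fun_prop) (by fun_prop)).measurableSet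

theorem cap_subset_cap {a b : S2} {R s s' : ℝ} (h : s ≤ s') : cap a b R s ⊆ cap a b R s' :=
  fun _ hy => ⟨hy.1, lt_of_lt_of_le hy.2
    (mul_le_mul_of_nonneg_right (Real.exp_le_exp.2 h) (norm_nonneg _))⟩

/-- At the centre the ratio of the distances to `a` and `b` is `e^t`. Within the ball it changes at
most by the factor `(5 / 4) / (3 / 4) = 5 / 3`, which is less than `e`. -/
theorem ball_subset_cap_diff {a b : S2} (h : a ≠ b) {R t : ℝ}
    (hR : Metric.ball (geodesic a b t) (quarterDist (geodesic a b t)) ⊆ Metric.closedBall 0 R) :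
    Metric.ball (geodesic a b t) (quarterDist (geodesic a b t))
      ⊆ cap a b R (t + 1) \ cap a b R (t - 1) := fun y hy => by
  have hγ := geodesic_mem h t
  have hr := quarterDist_pos hγ
  have hyH : y ∈ H3 := closedBall_subset_H3 hγ (Metric.closedBall_subset_closedBall (by linarith)
    (Metric.ball_subset_closedBall hy))
  have ha := norm_sub_S2_le a hy
  have ha' := le_norm_sub_S2 a hy
  have hb := norm_sub_S2_le b hy
  have hb' := le_norm_sub_S2 b hy
  have hb0 := norm_sub_S2_pos b hyH
  have ht := Real.exp_pos t
  have he : 2 ≤ Real.exp 1 := by linarith [Real.add_one_le_exp 1]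
  rw [norm_geodesic_sub_left] at ha ha'
  have htb := mul_pos ht hb0
  have h1 := mul_le_mul_of_nonneg_left hb ht.le
  have h2 := mul_le_mul_of_nonneg_left hb' ht.le
  refine ⟨⟨hR hy, ?_⟩, fun hy' => ?_⟩
  · change ‖y - a‖ < Real.exp (t + 1) * ‖y - b‖
    rw [Real.exp_add]
    nlinarith
  · have h3 : ‖y - a‖ < Real.exp (t - 1) * ‖y - b‖ := hy'.2
    rw [Real.exp_sub, div_mul_eq_mul_div, lt_div_iff₀ (Real.exp_pos 1)] at h3
    nlinarith [norm_nonneg (y - (a : V))]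

/-- The defect at time `t` is bounded by the weighted mass in the slab between the levels `t - 1`
and `t + 1`. Integrating in `t` telescopes, and the total weighted mass is controlled by the energy,
uniformly in the length of the segment. -/
theorem exists_line_bound (hm : 0 < m) {a b : S2} (h : a ≠ b) : ∃ H, ∀ t ≥ 0,
    ∫ τ in (0)..t, (m ^ 2 - ‖M.Φ (geodesic a b τ)‖ ^ 2) ≤ H := by
  obtain ⟨C, hC0, hC⟩ := exists_defect_le_setIntegral M hm
  refine ⟨400 * C * (2 * (2 * ∫ x in H3, curvDensity M.A x)), fun T hT => ?_⟩
  obtain ⟨τ, -, hτ⟩ := (isCompact_Icc (a := 0) (b := T)).exists_isMaxOn ⟨0, by simpa using hT⟩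
    (continuous_geodesic a b).norm.continuousOn
  have hτ1 := norm_lt_one (geodesic_mem h τ)
  -- The smallest radius guaranteed to contain the quarter-distance balls around all points of the
  -- segment; it depends on `T`, but the resulting bound does not.
  set R := (1 + 3 * ‖geodesic a b τ‖) / 4 with hRdef
  have hR : R < 1 := by rw [hRdef]; linarith
  have hKH : Metric.closedBall (0 : V) R ⊆ H3 := Metric.closedBall_subset_ball hR
  have hballR : ∀ t ∈ Set.Icc 0 T,
      Metric.ball (geodesic a b t) (quarterDist (geodesic a b t)) ⊆ Metric.closedBall 0 R := by
    intro t ht y hy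
    have h1 : ‖geodesic a b t‖ ≤ ‖geodesic a b τ‖ := hτ ht
    have h2 : ‖y - geodesic a b t‖ < quarterDist (geodesic a b t) := by
      simpa [dist_eq_norm] using hy
    have h3 := norm_le_norm_add_norm_sub' y (geodesic a b t)
    rw [quarterDist] at h2
    rw [mem_closedBall_zero_iff, hRdef]
    linarith
  set G : V → ℝ := fun x => conf x ^ 3 * tube a b x ^ 2 * defect M x with hG
  have hG0 : ∀ x ∈ H3, 0 ≤ G x := fun x hx =>
    mul_nonneg (mul_nonneg (pow_nonneg (conf_pos hx).le 3) (sq_nonneg _)) (defect_nonneg M hm hx)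
  have hGi : IntegrableOn G (Metric.closedBall 0 R) :=
    ((continuousOn_weighted_defect M a b).mono hKH).integrableOn_compact (isCompact_closedBall 0 R)
  have hGcap : ∀ s, IntegrableOn G (cap a b R s) := fun s => hGi.mono_set Set.inter_subset_left
  have hcapH : ∀ s, cap a b R s ⊆ H3 := fun s => Set.inter_subset_left.trans hKH
  have hcap0 : ∀ s, 0 ≤ᵐ[volume.restrict (cap a b R s)] G := fun s => by
    filter_upwards [ae_restrict_mem (measurableSet_cap a b R s)] with x hx using hG0 x (hcapH s hx)
  set Γ : ℝ → ℝ := fun s => ∫ x in cap a b R s, G x with hΓdef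
  have hΓ : Monotone Γ := fun s s' hss => setIntegral_mono_set (hGcap s') (hcap0 s')
    (Filter.Eventually.of_forall (cap_subset_cap hss))
  have hΓ0 : ∀ s, 0 ≤ Γ s := fun s => setIntegral_nonneg (measurableSet_cap a b R s) fun x hx =>
    hG0 x (hcapH s hx)
  have hΓB : ∀ s, Γ s ≤ 2 * ∫ x in H3, curvDensity M.A x := fun s => by
    refine le_trans (setIntegral_mono_set hGi ?_ (Filter.Eventually.of_forall
      Set.inter_subset_left)) (setIntegral_weighted_defect_le M hR)
    filter_upwards [ae_restrict_mem measurableSet_closedBall] with x hx using hG0 x (hKH hx)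
  have hpt : ∀ t ∈ Set.Icc 0 T, m ^ 2 - ‖M.Φ (geodesic a b t)‖ ^ 2
      ≤ 400 * C * (Γ (t + 1) - Γ (t - 1)) := fun t ht => by
    have hγ := geodesic_mem h t
    set B := Metric.ball (geodesic a b t) (quarterDist (geodesic a b t)) with hBdef
    have hBR : B ⊆ Metric.closedBall 0 R := hballR t ht
    have hBH := hBR.trans hKH
    have hsub := ball_subset_cap_diff h hBR
    rw [← defect_eq M hγ]
    -- On the geodesic `tube = 1`, so `tube ≥ 1 / 20` on the ball and inserting its square costs
    -- `400 = 20²`.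
    have h1 : ∫ x in B, conf x ^ 3 * defect M x ≤ ∫ x in B, 400 * G x := by
      refine setIntegral_mono_on ((((smooth_conf.pow 3).mul (smooth_defect M)).continuousOn.mono
        hKH).integrableOn_compact (isCompact_closedBall 0 R) |>.mono_set hBR)
        ((hGi.mono_set hBR).const_mul _) measurableSet_ball fun x hx => ?_
      have h2 := le_tube a b hγ hx
      rw [tube_geodesic h] at h2
      have h3 : 1 ≤ 400 * tube a b x ^ 2 := by nlinarith
      have h4 : 0 ≤ conf x ^ 3 * defect M x :=
        mul_nonneg (pow_nonneg (conf_pos (hBH hx)).le 3) (defect_nonneg M hm (hBH hx))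
      have h5 := mul_le_mul_of_nonneg_left h3 h4
      rw [hG]
      linarith
    have h2 : ∫ x in B, G x ≤ ∫ x in cap a b R (t + 1) \ cap a b R (t - 1), G x := by
      refine setIntegral_mono_set ((hGcap (t + 1)).mono_set Set.sdiff_subset) ?_
        (Filter.Eventually.of_forall hsub)
      exact ae_restrict_of_ae_restrict_of_subset Set.sdiff_subset (hcap0 (t + 1))
    rw [setIntegral_sdiff (measurableSet_cap a b R (t - 1)) (hGcap (t + 1))
      (cap_subset_cap (by linarith))] at h2
    rw [integral_const_mul] at h1
    calc defect M (geodesic a b t) ≤ C * ∫ x in B, conf x ^ 3 * defect M x := hC _ hγ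
      _ ≤ C * (400 * (Γ (t + 1) - Γ (t - 1))) := by gcongr; linarith
      _ = _ := by ring
  have hcont : Continuous fun t => m ^ 2 - ‖M.Φ (geodesic a b t)‖ ^ 2 :=
    continuous_const.sub ((M.smooth_Φ.continuousOn.comp_continuous (continuous_geodesic a b)
      (geodesic_mem h)).norm.pow 2)
  have hi : IntervalIntegrable (fun t => Γ (t + 1) - Γ (t - 1)) volume 0 T :=
    IntervalIntegrable.sub (hΓ.comp fun x y h => by simpa using h).intervalIntegrable
      (hΓ.comp fun x y h => by simpa using h).intervalIntegrable
  refine (intervalIntegral.integral_mono_on hT (hcont.intervalIntegrable _ _) (hi.const_mul _)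
    hpt).trans ?_
  rw [intervalIntegral.integral_const_mul]
  exact mul_le_mul_of_nonneg_left (integral_shift_sub_le hΓ hΓ0 hΓB) (by positivity)

end

section

variable {m : ℝ} (M : HyperbolicMonopole m)

/-! ### Normalised solutions and the two-point function -/

/-- The unit speed of the geodesic cancels the conformal factor in the gradient bound, which becomes
the hypothesis on `D` along the line. -/
theorem exists_isNormalisedS (hm : 0 < m) {a b : S2} (h : a ≠ b) :
    ∃ s, IsNormalisedS M a b s := by
  obtain ⟨K, hK, hKb⟩ := exists_gradient_bound M hm
  obtain ⟨H, hH⟩ := exists_line_bound M hm h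
  refine (lineData M h).exists_decaying hm hK (fun t => norm_higgs_le M hm (geodesic_mem h t))
    (fun t => ?_) (M.mass.comp (tendsto_norm_geodesic h)) hH
  have h1 := norm_covDeriv_sq_le M.A M.Φ (geodesic a b t) (deriv (geodesic a b) t)
  have h2 := hKb _ (geodesic_mem h t)
  rw [gradSq_eq M (geodesic_mem h t), higgsSq_eq M (geodesic_mem h t)] at h2
  simp only [← covDeriv_eq_higgsD] at h2
  have h3 := conf_mul_norm_deriv_geodesic h t
  calc ‖(lineData M h).D t‖ ^ 2
      ≤ ‖deriv (geodesic a b) t‖ ^ 2 *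
        ∑ i, ‖covDeriv M.A M.Φ (geodesic a b t) (e i)‖ ^ 2 := h1
    _ ≤ ‖deriv (geodesic a b) t‖ ^ 2 *
        (K * conf (geodesic a b t) ^ 2 * (m ^ 2 - ‖M.Φ (geodesic a b t)‖ ^ 2)) := by gcongr
    _ = K * (m ^ 2 - ‖M.Φ (geodesic a b t)‖ ^ 2)
        * (conf (geodesic a b t) * ‖deriv (geodesic a b) t‖) ^ 2 := by ring
    _ = _ := by rw [h3, one_pow, mul_one]; rfl

variable {M}

theorem IsOppositeScatteringSol.reverse {a b : S2} {s : ℝ → E}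
    (hs : IsOppositeScatteringSol M a b s) : IsScatteringSol M b a fun t => s (-t) := fun t => by
  have h := (hs (-t)).scomp t (hasDerivAt_neg t)
  refine HasDerivAt.congr_deriv h ?_
  rw [deriv_geodesic_neg, geodesic_neg, map_neg]
  simp only [neg_smul, one_smul, _root_.neg_apply, neg_neg, neg_sub]
  abel

theorem IsNormalisedS.reverse {a b : S2} {s : ℝ → E} (hs : IsNormalisedS M a b s) :
    IsNormalisedR M b a fun t => s (-t) := by
  refine ⟨hs.1.reverse, (hs.2.comp tendsto_neg_atBot_atTop).congr fun t => ?_⟩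
  simp only [Function.comp, mul_neg]

theorem IsNormalisedR.reverse {a b : S2} {r : ℝ → E} (hr : IsNormalisedR M a b r) :
    IsNormalisedS M b a fun t => r (-t) := by
  refine ⟨hr.1.reverse, (hr.2.comp tendsto_neg_atTop_atBot).congr fun t => ?_⟩
  simp only [Function.comp, mul_neg, neg_neg]

theorem IsNormalisedS.exists_ne_zero {a b : S2} {s : ℝ → E} (hs : IsNormalisedS M a b s) :
    ∃ t, s t ≠ 0 := by
  by_contra! h
  have h1 := hs.2
  simp only [h, norm_zero, mul_zero] at h1
  exact zero_ne_one (tendsto_nhds_unique tendsto_const_nhds h1)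

theorem IsNormalisedS.tendsto_zero (hm : 0 < m) {a b : S2} {s : ℝ → E}
    (hs : IsNormalisedS M a b s) : Tendsto (fun t => ‖s t‖) atTop (𝓝 0) := by
  have h1 : Tendsto (fun t : ℝ => Real.exp (-(m * t))) atTop (𝓝 0) :=
    Real.tendsto_exp_neg_atTop_nhds_zero.comp (tendsto_id.const_mul_atTop hm)
  have h2 := h1.mul hs.2
  rw [zero_mul] at h2
  refine h2.congr fun t => ?_
  rw [← mul_assoc, exp_neg_mul_exp, one_mul]

theorem IsNormalisedR.tendsto_zero (hm : 0 < m) {a b : S2} {r : ℝ → E}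
    (hr : IsNormalisedR M a b r) : Tendsto (fun t => ‖r t‖) atBot (𝓝 0) := by
  refine ((hr.reverse.tendsto_zero hm).comp tendsto_neg_atBot_atTop).congr fun t => ?_
  simp only [Function.comp, neg_neg]

theorem IsNormalisedS.integrableOn (hm : 0 < m) {a b : S2} {s : ℝ → E}
    (hs : IsNormalisedS M a b s) : IntegrableOn (fun t => ‖s t‖ ^ 2) (Set.Ioi 0) := by
  have hc : Continuous s := continuous_iff_continuousAt.2 fun t => (hs.1 t).continuousAt
  refine integrable_of_isBigO_exp_neg (b := 2 * m) (by positivity)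
    (hc.norm.pow 2).continuousOn ?_
  refine Asymptotics.IsBigO.of_bound 4 ?_
  filter_upwards [hs.2.eventually_lt_const (show (1 : ℝ) < 2 by norm_num)] with t ht
  have h1 : ‖s t‖ = Real.exp (-(m * t)) * (Real.exp (m * t) * ‖s t‖) := by
    rw [← mul_assoc, exp_neg_mul_exp, one_mul]
  have h2 : Real.exp (-(2 * m) * t) = Real.exp (-(m * t)) ^ 2 := by
    rw [← Real.exp_nat_mul]; congr 1; push_cast; ring
  rw [Real.norm_of_nonneg (by positivity), Real.norm_of_nonneg (by positivity), h2, h1, mul_pow,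
    mul_comm]
  have h3 : 0 ≤ Real.exp (m * t) * ‖s t‖ := by positivity
  gcongr
  nlinarith

/-- Normalised solutions are unique up to a phase. -/
theorem IsNormalisedS.unique (hm : 0 < m) {a b : S2} (h : a ≠ b) {s s' : ℝ → E}
    (hs : IsNormalisedS M a b s) (hs' : IsNormalisedS M a b s') :
    ∃ z : ℂ, ‖z‖ = 1 ∧ s' = fun t => z • s t := by
  obtain ⟨t₀, ht₀⟩ := hs.exists_ne_zero
  have h1 : LineData.SSol (lineData M h) s := hs.1
  have h2 : LineData.SSol (lineData M h) s' := hs'.1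
  -- The Wronskian is constant and tends to zero, because both solutions decay at the same end.
  have hw : inner ℂ (J (s t₀)) (s' t₀) = 0 := by
    have hl : Tendsto (fun t => inner ℂ (J (s t)) (s' t)) atTop (𝓝 0) := by
      have h3 := (hs.tendsto_zero hm).mul (hs'.tendsto_zero hm)
      rw [zero_mul] at h3
      refine squeeze_zero_norm (fun t => ?_) h3
      refine (norm_inner_le_norm _ _).trans ?_
      rw [norm_J]
    refine tendsto_nhds_unique (tendsto_const_nhds.congr fun t => ?_) hl
    exact h1.wronskian_const h2 t₀ t
  obtain ⟨z, hz⟩ := h1.eq_smul_of_wronskian_eq_zero h2 ht₀ hw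
  refine ⟨z, ?_, hz⟩
  have h3 := hs.2.const_mul ‖z‖
  rw [mul_one] at h3
  refine (tendsto_nhds_unique (hs'.2.congr fun t => ?_) h3).symm
  rw [hz, norm_smul]; ring

theorem IsNormalisedR.unique (hm : 0 < m) {a b : S2} (h : a ≠ b) {r r' : ℝ → E}
    (hr : IsNormalisedR M a b r) (hr' : IsNormalisedR M a b r') :
    ∃ z : ℂ, ‖z‖ = 1 ∧ r' = fun t => z • r t := by
  obtain ⟨z, hz, h1⟩ := hr.reverse.unique hm h.symm hr'.reverse
  refine ⟨z, hz, funext fun t => ?_⟩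
  have := congrFun h1 (-t)
  simpa using this

/-- The solution `r₊` is the time reversal of `s₊` on the reversed geodesic, and the remaining
phases have modulus one. -/
theorem existsUnique_isTwoPointValue (hm : 0 < m) {a b : S2} (h : a ≠ b) :
    ∃! c : ℝ, IsTwoPointValue M a b c := by
  obtain ⟨s, hs⟩ := exists_isNormalisedS M hm h
  obtain ⟨s₁, hs₁⟩ := exists_isNormalisedS M hm h.symm
  set r := fun t => s₁ (-t)
  have hr : IsNormalisedR M a b r := hs₁.reverse
  have hrs : ∀ t, inner ℂ (r t) (s t) = inner ℂ (r 0) (s 0) := fun t =>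
    LineData.RSol.inner_const (L := lineData M h) hr.1 hs.1 t 0
  refine ⟨‖inner ℂ (r 0) (s 0)‖ ^ 2, ⟨r, s, hr, hs, fun t => by rw [hrs]⟩, ?_⟩
  rintro c ⟨r', s', hr', hs', hc⟩
  obtain ⟨z, hz, rfl⟩ := hs.unique hm h hs'
  obtain ⟨y, hy, rfl⟩ := hr.unique hm h hr'
  rw [← hc 0, inner_smul_left, inner_smul_right, norm_mul, norm_mul, RCLike.norm_conj, hz, hy,
    one_mul, one_mul]

theorem isTwoPointValue_twoPoint (hm : 0 < m) {a b : S2} (h : a ≠ b) :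
    IsTwoPointValue M a b (twoPoint M a b) := by
  rw [twoPoint, if_neg h]
  exact Classical.epsilon_spec (existsUnique_isTwoPointValue hm h).exists

/-- The pairing of a square integrable function with a decaying one cannot be a nonzero constant. -/
theorem inner_eq_zero_of_integrable {l : Filter ℝ} (hl : ∀ S ∈ l, volume S = ⊤) {f s : ℝ → E}
    (hs : Integrable fun t => ‖s t‖ ^ 2) (hf : Tendsto (fun t => ‖f t‖) l (𝓝 0)) {k : ℂ}
    (hk : ∀ t, inner ℂ (f t) (s t) = k) : k = 0 := by
  by_contra hk0
  have hkp : 0 < ‖k‖ := norm_pos_iff.2 hk0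
  -- Once `‖f‖ < ‖k‖`, Cauchy–Schwarz forces `‖s‖ ≥ 1` on a set of infinite measure, contrary to
  -- Chebyshev.
  have h1 : {t : ℝ | 1 ≤ ‖‖s t‖ ^ 2‖} ∈ l := by
    filter_upwards [hf.eventually_lt_const hkp] with t ht
    have h2 : ‖k‖ ≤ ‖f t‖ * ‖s t‖ := by rw [← hk t]; exact norm_inner_le_norm _ _
    have h3 : 1 ≤ ‖s t‖ := by
      by_contra! h4
      have := norm_nonneg (f t)
      nlinarith
    simp only [norm_pow, norm_norm]
    exact one_le_pow₀ h3
  have h2 := hs.measure_norm_ge_lt_top one_pos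
  exact h2.ne (hl _ h1)

theorem volume_eq_top_of_mem_atTop {S : Set ℝ} (h : S ∈ (atTop : Filter ℝ)) : volume S = ⊤ := by
  obtain ⟨T, hT⟩ := mem_atTop_sets.1 h
  exact measure_mono_top (s₁ := Set.Ici T) hT Real.volume_Ici

theorem volume_eq_top_of_mem_atBot {S : Set ℝ} (h : S ∈ (atBot : Filter ℝ)) : volume S = ⊤ := by
  obtain ⟨T, hT⟩ := mem_atBot_sets.1 h
  exact measure_mono_top (s₁ := Set.Iic T) hT Real.volume_Iic

/-- The solutions decaying at `b` are spanned by `s₊`, those decaying at `a` by `J r₊`. These two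
lines coincide exactly when `(r₊, s₊) = 0`. -/
theorem exists_integrable_iff_twoPoint_eq_zero (hm : 0 < m) {a b : S2} (h : a ≠ b) :
    (∃ s : ℝ → E, IsScatteringSol M a b s ∧ (∃ t, s t ≠ 0) ∧ Integrable fun t => ‖s t‖ ^ 2) ↔
      twoPoint M a b = 0 := by
  obtain ⟨r, s, hr, hs, hc⟩ := isTwoPointValue_twoPoint (M := M) hm h
  have hrL : LineData.RSol (lineData M h) r := hr.1
  have hsL : LineData.SSol (lineData M h) s := hs.1
  obtain ⟨t₁, ht₁⟩ := hs.exists_ne_zero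
  constructor
  · rintro ⟨s₁, hs₁, ⟨t₀, ht₀⟩, hint⟩
    have hs₁L : LineData.SSol (lineData M h) s₁ := hs₁
    have h1 : inner ℂ (r t₁) (s₁ t₁) = 0 :=
      inner_eq_zero_of_integrable (fun _ => volume_eq_top_of_mem_atBot) hint (hr.tendsto_zero hm)
        fun t => hrL.inner_const hs₁L t t₁
    have h2 : inner ℂ (J (s t₁)) (s₁ t₁) = 0 :=
      inner_eq_zero_of_integrable (f := fun t => J (s t))
        (fun _ => volume_eq_top_of_mem_atTop) hint
        (by simpa only [norm_J] using hs.tendsto_zero hm) fun t => hsL.wronskian_const hs₁L t t₁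
    obtain ⟨z, rfl⟩ := hsL.eq_smul_of_wronskian_eq_zero hs₁L ht₁ h2
    have hz : z ≠ 0 := fun hz => ht₀ (by simp [hz])
    rw [inner_smul_right, mul_eq_zero, or_iff_right hz] at h1
    rw [← hc t₁, h1, norm_zero, zero_pow two_ne_zero]
  · intro h0
    refine ⟨s, hs.1, ⟨t₁, ht₁⟩, ?_⟩
    obtain ⟨t₂, ht₂⟩ := hr.reverse.exists_ne_zero
    have hJr : J (r (-t₂)) ≠ 0 := by
      rw [← norm_ne_zero_iff, norm_J]; exact norm_ne_zero_iff.2 ht₂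
    have hw : inner ℂ (J (J (r (-t₂)))) (s (-t₂)) = 0 := by
      have h1 := hc (-t₂)
      rw [h0, sq_eq_zero_iff, norm_eq_zero] at h1
      rw [J_J, inner_neg_left, h1, neg_zero]
    -- The solution `s₊` is a multiple of `J r₊`, hence also decays exponentially at `a`. The two
    -- half-lines are then treated separately.
    obtain ⟨z, hz⟩ := hrL.J.eq_smul_of_wronskian_eq_zero hsL hJr hw
    have hpos := hs.integrableOn hm
    have hneg : IntegrableOn (fun t => ‖s t‖ ^ 2) (Set.Iio 0) := by
      have h1 := (hr.reverse.integrableOn hm).const_mul (‖z‖ ^ 2)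
      refine ((Measure.measurePreserving_neg volume).integrableOn_comp_preimage
        (Homeomorph.neg ℝ).measurableEmbedding).1 ?_
      rw [Set.neg_preimage, Set.neg_Iio, neg_zero]
      refine IntegrableOn.congr_fun h1 (fun t _ => ?_) measurableSet_Ioi
      simp only [Function.comp]
      rw [hz, norm_smul, norm_J, mul_pow]
    have h3 := ((integrableOn_Iic_iff_integrableOn_Iio (by simp)).2 hneg).union hpos
    rwa [Set.Iic_union_Ioi, integrableOn_univ] at h3

theorem spectralCurve_eq (hm : 0 < m) :
    spectralCurve M = {p : S2 × S2 | twoPoint M (-p.1) p.2 = 0} := by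
  ext p
  simp only [spectralCurve, Set.mem_ofPred_eq]
  by_cases h : -p.1 = p.2
  -- The anti-diagonal is absent from both sides, since the 2-point function equals one there.
  · simp [h, twoPoint]
  · rw [exists_integrable_iff_twoPoint_eq_zero hm h]
    exact and_iff_right h

end

end HypMonopole

end

/-! ### The main theorem -/

theorem mainTheorem3 {m : ℝ} (hm : 0 < m) (M : HyperbolicMonopole m) :
    (∀ a b : HypMonopole.S2, a ≠ b → ∃! c : ℝ, HypMonopole.IsTwoPointValue M a b c) ∧
    HypMonopole.spectralCurve M =
      {p : HypMonopole.S2 × HypMonopole.S2 | HypMonopole.twoPoint M (-p.1) p.2 = 0} ∧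
    (∀ (m' : ℝ), 0 < m' → ∀ M' : HyperbolicMonopole m',
      (∀ a b : HypMonopole.S2, HypMonopole.twoPoint M' a b = HypMonopole.twoPoint M a b) →
        HypMonopole.spectralCurve M' = HypMonopole.spectralCurve M) := by
  refine ⟨fun a b h => HypMonopole.existsUnique_isTwoPointValue hm h,
    HypMonopole.spectralCurve_eq hm, fun m' hm' M' h => ?_⟩
  rw [HypMonopole.spectralCurve_eq hm, HypMonopole.spectralCurve_eq hm']
  ext p
  simp only [Set.mem_ofPred_eq, h]
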